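/- **Setting.** Let $d\ge 1$, $\beta>0$ and $a>b>0$. For $\alpha<0$, $\mu\in\mathbb R$, a centred box $\Lambda\subset\mathbb R^d$ and $m_\Lambda\in\mathbb N$, let the cycle counts $(|\Lambda|\lambda_k)_{k\ge 1}$ be, under the reference law $\mathsf Q_\Lambda$, independent Poisson variables with means $|\Lambda| q_k e^{\beta\alpha k}$, where $q_k=(4\pi\beta)^{-d/2}k^{-1-d/2}$. Put $$H_\Lambda=|\Lambda|\Big(-(\mu-\alpha)\sum_{k}k\lambda_k+\frac a2\Big(\sum_k k\lambda_k\Big)^2-\frac b2\sum_{k\ge m_\Lambda}k^2\lambda_k^2\Big),\qquad \frac{d\mathbb P_\Lambda}{d\mathsf Q_\Lambda}=\frac{e^{-\beta H_\Lambda}}{\mathsf E_{\mathsf Q_\Lambda}[e^{-\beta H_\Lambda}]},\qquad M^{(2)}_\Lambda=\sum_{k\ge m_\Lambda}k\lambda_k .$$ For $\kappa\in[0,\infty]$ let $\varrho^{(\kappa)}(\mu)=\lim \mathbb E_{\mathbb P_\Lambda}[M^{(2)}_\Lambda]$, the limit being along any sequence of centred boxes with $|\Lambda|\to\infty$, $m_\Lambda\to\infty$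 and $m_\Lambda/|\Lambda|\to\kappa$. Let $p_0(\beta,s)=\frac{1}{\beta(4\pi\beta)^{d/2}}\sum_{k\ge1}e^{\beta sk}k^{-1-d/2}$ for $s\le 0$ and $p_0(\beta,s)=+\infty$ for $s>0$; primes denote derivatives in $s$, and $p_0''(\beta,0)\in[0,\infty]$ is the limit of $p_0''(\beta,s)$ as $s\uparrow0$. Let $f_0(\beta,x)=\sup_s\{sx-p_0(\beta,s)\}$; $\varrho_{\rm c}=(4\pi\beta)^{-d/2}\sum_{k\ge 1} k^{-d/2}$ if $d\ge3$, $\varrho_{\rm c}=\infty$ if $d\le2$; $\mu_{\rm c}=a\varrho_{\rm c}$. For $x>0$ let $s_\beta(x)=0$ if $x\ge\varrho_{\rm c}$, and otherwise let $s_\beta(x)$ be the unique $s<0$ with $p_0'(\beta,s)=x$. Put $\mu_{\rm t}=\inf_{s<0}\{ap_0'(\beta,s)-\frac{a-b}{b}s\}$. Let $\tilde x_1(\mu)$ be the unique solution $x>0$ of $s_\beta(x)=\mu-ax$, and, for $\mu\ge\mu_{\rm t}$, let $\tilde x_2(\mu)$ be the minimal solution $x>0$ of $s_\beta(x)=-\frac{b}{a-b}(\mu-ax)$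 and $\tilde y_2(\mu)=\frac{\mu-a\tilde x_2(\mu)}{a-b}$. For $\kappa\in(0,\infty)$ put $\tilde x_3(\mu)=\tilde x_1(\mu-a\kappa)$ and $\mu_{\rm r}=\inf\{s\ge\mu_{\rm t}:\tilde x_2(s)\le\frac1a(s-\kappa(a-b))\}$. Let $K(\kappa)=[0,\infty)\times(\{0\}\cup[\kappa,\infty))$ (for $\kappa=\infty$: $[0,\infty)\times\{0\}$), let $F_\mu(x,y)=f_0(\beta,x)-\mu(x+y)+\frac a2(x+y)^2-\frac b2y^2$, let $I^{(\kappa)}=F_\mu-\inf_{K(\kappa)}F_\mu$ on $K(\kappa)$ and $+\infty$ elsewhere, and let $\mathscr M^{(\kappa)}(\mu)$ be the set of zeroes of $I^{(\kappa)}$. **Statement.** For all $\alpha<0$, $\mu\in\mathbb R$ and every $\Lambda$, $m_\Lambda$, the measure $\mathbb P_\Lambda$ is a well-defined probability measure and $M_\Lambda^{(2)}$ is $\mathbb P_\Lambda$-integrable. There is a transition chemical potential $\mu^*\in\mathbb R$, $\mu_{\rm t}\le\mu^*\le\mu_{\rm c}$, with $\mathscr M^{(0)}(\mu)$ equal to $\{(\tilde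 x_1,0)\}$ for $\mu<\mu^*$, to $\{(\tilde x_1,0),(\tilde x_2,\tilde y_2)\}$ for $\mu=\mu^*$, and to $\{(\tilde x_2,\tilde y_2)\}$ for $\mu>\mu^*$, and for each $\kappa\in(0,\infty)$ there is $\mu^*_\kappa\in\mathbb R$, with $\mu^*_\kappa=\mu^*$ if $\mu_{\rm r}\le\mu^*$ and $\mu^*_\kappa\in(\mu^*,\mu_{\rm r})$ if $\mu_{\rm r}>\mu^*$, such that $\mathscr M^{(\kappa)}(\mu)$ equals $\{(\tilde x_1,0)\}$ for $\mu<\mu^*_\kappa$; $\{(\tilde x_3,\kappa)\}$ for $\mu_\kappa^*<\mu\le\mu_{\rm r}$; $\{(\tilde x_2,\tilde y_2)\}$ for $\mu\ge\mu_{\rm r}$ with $\mu>\mu^*_\kappa$; and, for $\mu=\mu^*_\kappa$, $\{(\tilde x_1,0),(\tilde x_3,\kappa)\}$ if $\mu_{\rm r}>\mu^*$ and $\{(\tilde x_1,0),(\tilde x_2,\tilde y_2)\}$ if $\mu_{\rm r}\le\mu^*$. None of these depends on $\alpha$ or on the sequences. For every $\alpha<0$ the following holds; in particular the limits exist at the stated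 values of $\mu$. 1. $\kappa=0$: $\varrho^{(0)}(\mu)=0$ for $\mu<\mu^*$ and $\varrho^{(0)}(\mu)=\frac{\mu-a\tilde x_2(\mu)}{a-b}$ for $\mu>\mu^*$. If $\mu^*<\mu_{\rm c}$, then $\varrho^{(0)}$ is not continuous at $\mu^*$, whatever value it is given there. If $\mu^*=\mu_{\rm c}$, then $\tilde x_1(\mu^*)=\tilde x_2(\mu^*)$, the limit $\varrho^{(0)}(\mu^*)$ exists and is $0$, and $\varrho^{(0)}$ is continuous at $\mu^*$. Moreover $\mu^*=\mu_{\rm c}$ if and only if $p_0''(\beta,0)\le\frac{a-b}{ab}$. 2. $\kappa\in(0,\infty)$: $\varrho^{(\kappa)}(\mu)=0$ for $\mu<\mu^*_\kappa$; $\varrho^{(\kappa)}(\mu)=\kappa$ for $\mu^*_\kappa<\mu\le\mu_{\rm r}$; $\varrho^{(\kappa)}(\mu)=\frac{\mu-a\tilde x_2(\mu)}{a-b}$ for $\mu\ge\mu_{\rm r}$ with $\mu>\mu^*_\kappa$. It is continuous at $\mu_{\rm r}$ if $\mu_{\rm r}\ne\mu^*_\kappa$, and it is discontinuous at $\mu^*_\kappa$,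 whatever value it is given there. 3. $\kappa=\infty$: $\varrho^{(\infty)}(\mu)=0$ for all $\mu\in\mathbb R$. -/

import Mathlib

open MeasureTheory Filter Topology
open scoped ENNReal

noncomputable section

namespace CycleHYL

/-! ### The spatial cycle HYL model in a finite volume -/

/-- A configuration of cycle counts: `n k` is the number `|Λ| λ_k` of cycles of length `k`. -/
abbrev CycleCounts : Type := ℕ+ →₀ ℕ

/-- The configuration space is countable and carries the discrete σ-algebra. -/
instance : MeasurableSpace CycleCounts := ⊤

/-- `q_k = 1 / ((4πβ)^{d/2} k^{1+d/2})`. -/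
def cycleWeight (d : ℕ) (β : ℝ) (k : ℕ+) : ℝ :=
  1 / ((4 * Real.pi * β) ^ ((d : ℝ) / 2) * (k : ℝ) ^ (1 + (d : ℝ) / 2))

/-- `q̄^{(α)} = ∑_k q_k e^{βαk}`. -/
def totalCycleWeight (d : ℕ) (β α : ℝ) : ℝ :=
  ∑' k : ℕ+, cycleWeight d β k * Real.exp (β * α * k)

/-- The probability, under the reference process in a box of volume `V`, of the cycle counts `n`:
`e^{-V q̄} ∏_k (V q_k e^{βαk})^{n_k} / n_k!`
(independent Poisson variables with means `V q_k e^{βαk}`). -/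
def referenceMass (d : ℕ) (β α V : ℝ) (n : CycleCounts) : ℝ :=
  Real.exp (-(V * totalCycleWeight d β α)) *
    n.prod fun k j => (V * cycleWeight d β k * Real.exp (β * α * k)) ^ j / (j.factorial : ℝ)

/-- The law `Q_Λ` of the cycle counts under the reference process, `|Λ| = V`. -/
def referenceMeasure (d : ℕ) (β α V : ℝ) : Measure CycleCounts :=
  Measure.sum fun n => ENNReal.ofReal (referenceMass d β α V n) • Measure.dirac n

/-- The particle density `∑_k k λ_k`, where `λ_k = n_k / V`. -/
def particleDensity (V : ℝ) (n : CycleCounts) : ℝ :=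
  n.sum fun k j => (k : ℝ) * ((j : ℝ) / V)

/-- `M_Λ^{(2)} = ∑_{k ≥ m} k λ_k`, the density of particles in cycles of length at least `m`. -/
def longCycleDensity (V : ℝ) (m : ℕ) (n : CycleCounts) : ℝ :=
  n.sum fun k j => if m ≤ (k : ℕ) then (k : ℝ) * ((j : ℝ) / V) else 0

/-- The Hamiltonian
`|Λ| (-(μ - α) ∑_k k λ_k + (a/2) (∑_k k λ_k)² - (b/2) ∑_{k ≥ m} k² λ_k²)`, `|Λ| = V`. -/
def hamiltonian (α μ a b V : ℝ) (m : ℕ) (n : CycleCounts) : ℝ :=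
  V * (-(μ - α) * particleDensity V n + a / 2 * particleDensity V n ^ 2
    - b / 2 * n.sum fun k j => if m ≤ (k : ℕ) then (k : ℝ) ^ 2 * ((j : ℝ) / V) ^ 2 else 0)

/-- The Gibbs measure `P_Λ`, with `dP_Λ/dQ_Λ = e^{-βH_Λ} / E_{Q_Λ}[e^{-βH_Λ}]`. -/
def gibbsMeasure (d : ℕ) (β α μ a b V : ℝ) (m : ℕ) : Measure CycleCounts :=
  (referenceMeasure d β α V).tilted fun n => -(β * hamiltonian α μ a b V m n)

/-! ### The thermodynamic limit -/

/-- `Λ` is a sequence of centred boxes in `ℝ^d` with `|Λ| → ∞`, and `m` is a sequence of cut-offs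
with `m → ∞` and `m / |Λ| → κ ∈ [0, ∞]`. -/
def IsThermodynamicSequence (d : ℕ) (κ : ℝ≥0∞) (Λ : ℕ → Set (Fin d → ℝ)) (m : ℕ → ℕ) : Prop :=
  (∀ i, ∃ l : Fin d → ℝ, (∀ j, 0 < l j) ∧ Λ i = Set.Icc (-l) l) ∧
  Tendsto (fun i => volume.real (Λ i)) atTop atTop ∧
  Tendsto m atTop atTop ∧
  Tendsto (fun i => (m i : ℝ≥0∞) / volume (Λ i)) atTop (𝓝 κ)

/-- `ϱ^{(κ)}(μ) = lim E_{P_Λ}[M_Λ^{(2)}]` exists, along every sequence of boxes and cut-offs with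
parameter `κ`, and equals `r`. -/
def IsLongCycleLimit (d : ℕ) (β α a b : ℝ) (κ : ℝ≥0∞) (μ r : ℝ) : Prop :=
  ∀ (Λ : ℕ → Set (Fin d → ℝ)) (m : ℕ → ℕ), IsThermodynamicSequence d κ Λ m →
    Tendsto
      (fun i => ∫ n, longCycleDensity (volume.real (Λ i)) (m i) n
        ∂(gibbsMeasure d β α μ a b (volume.real (Λ i)) (m i)))
      atTop (𝓝 r)

/-! ### The ideal Bose gas -/

/-- The pressure `p_0(β, s)` of the ideal Bose gas, for `s ≤ 0` (it is `+∞` for `s > 0`). -/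
def idealPressure (d : ℕ) (β s : ℝ) : ℝ :=
  1 / (β * (4 * Real.pi * β) ^ ((d : ℝ) / 2)) *
    ∑' k : ℕ+, Real.exp (β * s * k) / (k : ℝ) ^ (1 + (d : ℝ) / 2)

/-- `p_0''(β, 0) ∈ [0, ∞]`: the left limit at `0` of the second derivative of `p_0(β, ·)`, which
is increasing on `(-∞, 0)`. It is `+∞` exactly for `d ≤ 4`. -/
def idealPressureSecondAtZero (d : ℕ) (β : ℝ) : EReal :=
  limsup (fun s : ℝ => ((iteratedDeriv 2 (idealPressure d β) s : ℝ) : EReal)) (𝓝[<] (0 : ℝ))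

/-- The free energy `f_0(β, x) = sup_s {s x - p_0(β, s)}`; the values `s > 0`, for which
`p_0(β, s) = +∞`, do not contribute to the supremum. -/
def idealFreeEnergy (d : ℕ) (β x : ℝ) : ℝ :=
  sSup ((fun s : ℝ => s * x - idealPressure d β s) '' Set.Iic 0)

/-- The critical density `ϱ_c(d)`, infinite for `d ≤ 2`. -/
def criticalDensity (d : ℕ) (β : ℝ) : EReal :=
  if 3 ≤ d then
    ((1 / (4 * Real.pi * β) ^ ((d : ℝ) / 2) * ∑' k : ℕ+, 1 / (k : ℝ) ^ ((d : ℝ) / 2) : ℝ) : EReal)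
  else ⊤

/-- `μ_c = a ϱ_c(d)`. -/
def muC (d : ℕ) (β a : ℝ) : EReal := (a : EReal) * criticalDensity d β

open Classical in
/-- `s_β(x)`, for `x > 0`: it is `0` for `x ≥ ϱ_c`, and the unique `s < 0` with
`p_0'(β, s) = x` for `x < ϱ_c`. -/
def sBeta (d : ℕ) (β x : ℝ) : ℝ :=
  if criticalDensity d β ≤ (x : EReal) then 0
  else Classical.epsilon fun s : ℝ => s < 0 ∧ deriv (idealPressure d β) s = x

/-! ### The stationary points and the special values of the chemical potential -/

/-- `μ_t = inf_{s < 0} {a p_0'(β, s) - ((a - b)/b) s}`. -/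
def muT (d : ℕ) (β a b : ℝ) : ℝ :=
  sInf ((fun s : ℝ => a * deriv (idealPressure d β) s - (a - b) / b * s) '' Set.Iio 0)

/-- `x̃₁(μ)`: the unique solution `x > 0` of `s_β(x) = μ - a x`. -/
def xOne (d : ℕ) (β a μ : ℝ) : ℝ :=
  Classical.epsilon fun x : ℝ => 0 < x ∧ sBeta d β x = μ - a * x

/-- `x̃₂(μ)`, for `μ ≥ μ_t`: the minimal solution `x > 0` of
`s_β(x) = -(b/(a - b)) (μ - a x)`. -/
def xTwo (d : ℕ) (β a b μ : ℝ) : ℝ :=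
  sInf {x : ℝ | 0 < x ∧ sBeta d β x = -(b / (a - b)) * (μ - a * x)}

/-- `x̃₃(μ) = x̃₁(μ - a κ)`. -/
def xThree (d : ℕ) (β a κ μ : ℝ) : ℝ := xOne d β a (μ - a * κ)

/-- `μ_r = inf {s ≥ μ_t : x̃₂(s) ≤ (s - κ (a - b)) / a}`. -/
def muR (d : ℕ) (β a b κ : ℝ) : ℝ :=
  sInf {s : ℝ | muT d β a b ≤ s ∧ xTwo d β a b s ≤ 1 / a * (s - κ * (a - b))}

/-- The density `(μ - a x̃₂(μ)) / (a - b)`. -/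
def yTwo (d : ℕ) (β a b μ : ℝ) : ℝ := (μ - a * xTwo d β a b μ) / (a - b)

/-! ### The rate function and its zeroes -/

/-- `K(κ) = ℝ_+ × ({0} ∪ [κ, ∞))`; for `κ = ∞` this is `ℝ_+ × {0}`. -/
def rateDomain (κ : ℝ≥0∞) : Set (ℝ × ℝ) :=
  {z | 0 ≤ z.1 ∧ 0 ≤ z.2 ∧ (z.2 = 0 ∨ κ ≤ ENNReal.ofReal z.2)}

/-- `f_0(β, x) - μ (x + y) + (a/2) (x + y)² - (b/2) y²`. -/
def freeEnergyFunctional (d : ℕ) (β a b μ : ℝ) (z : ℝ × ℝ) : ℝ :=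
  idealFreeEnergy d β z.1 - μ * (z.1 + z.2) + a / 2 * (z.1 + z.2) ^ 2 - b / 2 * z.2 ^ 2

/-- The pressure `p^{(κ)}`, given by its variational formula. -/
def pressure (d : ℕ) (β a b : ℝ) (κ : ℝ≥0∞) (μ : ℝ) : ℝ :=
  sSup ((fun z => -freeEnergyFunctional d β a b μ z) '' rateDomain κ)

open Classical in
/-- The rate function `I^{(κ)}` of the pair particle density. -/
def rateFunction (d : ℕ) (β a b : ℝ) (κ : ℝ≥0∞) (μ : ℝ) (z : ℝ × ℝ) : EReal :=
  if z ∈ rateDomain κ then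
    ((freeEnergyFunctional d β a b μ z + pressure d β a b κ μ : ℝ) : EReal)
  else ⊤

/-- The set of zeroes of `I^{(κ)}`. -/
def rateZeroes (d : ℕ) (β a b : ℝ) (κ : ℝ≥0∞) (μ : ℝ) : Set (ℝ × ℝ) :=
  {z | rateFunction d β a b κ μ z = 0}

/-- `μs` is the transition chemical potential `μ^*` for `κ = 0`. -/
def IsTransitionZero (d : ℕ) (β a b μs : ℝ) : Prop :=
  muT d β a b ≤ μs ∧ (μs : EReal) ≤ muC d β a ∧
  ∀ μ : ℝ,
    (μ < μs → rateZeroes d β a b 0 μ = {(xOne d β a μ, 0)}) ∧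
    (μ = μs → rateZeroes d β a b 0 μ =
      {(xOne d β a μ, 0), (xTwo d β a b μ, yTwo d β a b μ)}) ∧
    (μs < μ → rateZeroes d β a b 0 μ = {(xTwo d β a b μ, yTwo d β a b μ)})

/-- `μκ` is the transition chemical potential `μ^*_κ` for `κ ∈ (0, ∞)`, where `μs` is the one for
`κ = 0`. If `μ_r ≤ μs` then `μκ = μs`, and there is no interval on which the second component of
the zero equals `κ`. -/
def IsTransitionPos (d : ℕ) (β a b κ μs μκ : ℝ) : Prop :=
  (muR d β a b κ ≤ μs → μκ = μs) ∧
  (μs < muR d β a b κ → μs < μκ ∧ μκ < muR d β a b κ) ∧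
  ∀ μ : ℝ,
    (μ < μκ → rateZeroes d β a b (ENNReal.ofReal κ) μ = {(xOne d β a μ, 0)}) ∧
    (μ = μκ → μs < muR d β a b κ → rateZeroes d β a b (ENNReal.ofReal κ) μ =
      {(xOne d β a μ, 0), (xThree d β a κ μ, κ)}) ∧
    (μ = μκ → muR d β a b κ ≤ μs → rateZeroes d β a b (ENNReal.ofReal κ) μ =
      {(xOne d β a μ, 0), (xTwo d β a b μ, yTwo d β a b μ)}) ∧
    (μκ < μ → μ ≤ muR d β a b κ →
      rateZeroes d β a b (ENNReal.ofReal κ) μ = {(xThree d β a κ μ, κ)}) ∧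
    (μκ < μ → muR d β a b κ ≤ μ →
      rateZeroes d β a b (ENNReal.ofReal κ) μ = {(xTwo d β a b μ, yTwo d β a b μ)})

end CycleHYL

end

open CycleHYL

/-! The argument has a variational half and a probabilistic half, joined by the function
`energyGap`, the infimum of F_μ(x, y) over x, normalised to vanish at y = 0.

Minimising over x. Stationary densities are parametrised by u = s + a x with s = s_β(x): `statSlope`
and `statDensity` are the two coordinates, and both remain continuous and monotone through
condensation, where s sticks at 0. The Legendre inequality for f_0 at the slope belonging to u = μ -
a y, followed by completing a square, gives F_μ(x, y) ≥ gap + const + (a/2)(x - `statDensity` u)²,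
with equality at the stationary x. Hence zeroes of the rate function correspond exactly to
minimisers of the gap over the admissible y (`rateZeroes_eq_image`).

Minimising over y. The y-derivative of the gap is (b/a)(`statLevel`(μ - a y) - μ). The level is
strictly quasiconvex (`statLevel_lt_max`), because it is a strictly convex function of the slope
while s < 0 and the identity once s = 0; its minimum is μ_t. So in y the gap may rise, then fall,
then rise, and the only candidates for a minimum on [0, ∞) are 0 and ỹ₂ (`energyGap_trichotomy`). In
μ the gap is nonincreasing, and once it is ≤ 0 at some y > 0 it is negative for all larger μ. Hence
the infimum of those μ at which an admissible y > 0 wins is a genuine transition point. For κ > 0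
the constraint y ≥ κ binds exactly as long as ỹ₂ < κ, that is, for μ < μ_r. The transition reaches
μ_c exactly when the level has no dip before condensation, which is the condition on p_0''(β, 0).

Finite volume. The parameter α drops out of the Gibbs law. For the upper bound, fix the number j of
particles in long cycles, replace ∑ k²λ_k² by the square of the long density, linearise the square
of the short density, and sum the tilted Poisson weights: the fibre has weight at most
exp(-βV·gap(j/V) + const·V + o(V)) (`sum_gibbsWeight_fibre_le`). For the lower bound, a single
configuration suffices: about V t_k cycles of each of finitely many short lengths k, and one cycle
of length about V y (`eventually_exp_le_tsum_gibbsWeight`). Away from a unique minimiser the gap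
exceeds its minimum by at least η(1 + j/V), so the sum over j converges uniformly in V, and the mean
of the long density converges to the minimiser. -/

namespace CycleHYL

/-! ### The ideal Bose gas -/

section IdealGas

variable {d : ℕ} {β : ℝ}

/-- `∑_k k^j q_k e^{βsk}`, which is `p_0'(β, s)` for `j = 1`. -/
noncomputable def cycleMoment (d : ℕ) (β : ℝ) (j : ℕ) (s : ℝ) : ℝ :=
  ∑' k : ℕ+, (k : ℝ) ^ j * cycleWeight d β k * Real.exp (β * s * k)

lemma one_le_pnat (k : ℕ+) : (1 : ℝ) ≤ (k : ℝ) := by exact_mod_cast Nat.one_le_iff_ne_zero.2 k.ne_zero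

lemma pnat_pos (k : ℕ+) : (0 : ℝ) < (k : ℝ) := by exact_mod_cast k.pos

lemma cycleWeight_const_pos (hβ : 0 < β) : 0 < (4 * Real.pi * β) ^ ((d : ℝ) / 2) := by
  have := Real.pi_pos
  positivity

lemma cycleWeight_pos (hβ : 0 < β) (k : ℕ+) : 0 < cycleWeight d β k := by
  have h1 := cycleWeight_const_pos (d := d) hβ
  have h2 := Real.rpow_pos_of_pos (pnat_pos k) (1 + (d : ℝ) / 2)
  unfold cycleWeight
  positivity

lemma cycleWeight_eq (k : ℕ+) : cycleWeight d β k =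
    ((4 * Real.pi * β) ^ ((d : ℝ) / 2))⁻¹ * (1 / (k : ℝ) ^ (1 + (d : ℝ) / 2)) := by
  unfold cycleWeight
  rw [one_div, mul_inv, one_div]

lemma natCast_mul_cycleWeight (k : ℕ+) : (k : ℝ) * cycleWeight d β k =
    ((4 * Real.pi * β) ^ ((d : ℝ) / 2))⁻¹ * (1 / (k : ℝ) ^ ((d : ℝ) / 2)) := by
  have h1 := pnat_pos k
  have h2 := Real.rpow_pos_of_pos h1 ((d : ℝ) / 2)
  rw [cycleWeight_eq, Real.rpow_add h1, Real.rpow_one]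
  field_simp

lemma summable_pnat_rpow {p : ℝ} : (Summable fun k : ℕ+ => 1 / (k : ℝ) ^ p) ↔ 1 < p := by
  rw [← Real.summable_one_div_nat_rpow]
  exact summable_pnat_iff_summable_nat (f := fun n : ℕ => 1 / (n : ℝ) ^ p)

lemma summable_cycleWeight (hd : 1 ≤ d) : Summable (cycleWeight d β) := by
  have : (1 : ℝ) ≤ d := by exact_mod_cast hd
  have h : Summable fun k : ℕ+ => 1 / (k : ℝ) ^ (1 + (d : ℝ) / 2) :=
    summable_pnat_rpow.2 (by linarith)
  exact (h.mul_left ((4 * Real.pi * β) ^ ((d : ℝ) / 2))⁻¹).congr fun k => (cycleWeight_eq k).symm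

lemma summable_natCast_mul_cycleWeight (hd : 3 ≤ d) :
    Summable fun k : ℕ+ => (k : ℝ) * cycleWeight d β k := by
  have : (3 : ℝ) ≤ d := by exact_mod_cast hd
  have h : Summable fun k : ℕ+ => 1 / (k : ℝ) ^ ((d : ℝ) / 2) :=
    summable_pnat_rpow.2 (by linarith)
  exact (h.mul_left ((4 * Real.pi * β) ^ ((d : ℝ) / 2))⁻¹).congr
    fun k => (natCast_mul_cycleWeight k).symm

lemma not_summable_natCast_mul_cycleWeight (hβ : 0 < β) (hd : ¬ 3 ≤ d) :
    ¬ Summable fun k : ℕ+ => (k : ℝ) * cycleWeight d β k := by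
  intro h
  have hd' : (d : ℝ) ≤ 2 := by
    have : d ≤ 2 := by omega
    exact_mod_cast this
  have hc := cycleWeight_const_pos (d := d) hβ
  have h' : Summable fun k : ℕ+ => 1 / (k : ℝ) ^ ((d : ℝ) / 2) := by
    refine (h.mul_left ((4 * Real.pi * β) ^ ((d : ℝ) / 2))).congr fun k => ?_
    rw [natCast_mul_cycleWeight, mul_inv_cancel_left₀ hc.ne']
  have := summable_pnat_rpow.1 h'
  linarith

lemma criticalDensity_of_three_le (hd : 3 ≤ d) : criticalDensity d β =
    ((∑' k : ℕ+, (k : ℝ) * cycleWeight d β k : ℝ) : EReal) := by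
  rw [criticalDensity, if_pos hd]
  congr 1
  rw [one_div, ← tsum_mul_left]
  exact tsum_congr fun k => (natCast_mul_cycleWeight k).symm

lemma criticalDensity_of_not_three_le (hd : ¬ 3 ≤ d) : criticalDensity d β = ⊤ := by
  rw [criticalDensity, if_neg hd]

lemma cycleWeight_le (hβ : 0 < β) (k : ℕ+) :
    cycleWeight d β k ≤ ((4 * Real.pi * β) ^ ((d : ℝ) / 2))⁻¹ := by
  have hc := cycleWeight_const_pos (d := d) hβ
  rw [cycleWeight_eq]
  refine mul_le_of_le_one_right (by positivity) ?_
  rw [div_le_one (Real.rpow_pos_of_pos (pnat_pos k) _)]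
  exact Real.one_le_rpow (one_le_pnat k) (by positivity)

lemma summable_cycleMoment (hβ : 0 < β) (j : ℕ) {s : ℝ} (hs : s < 0) :
    Summable fun k : ℕ+ => (k : ℝ) ^ j * cycleWeight d β k * Real.exp (β * s * k) := by
  have hr : 0 < -(β * s) := by nlinarith
  have h1 : Summable fun k : ℕ+ => (k : ℝ) ^ j * Real.exp (β * s * k) := by
    have := (summable_pnat_iff_summable_nat
      (f := fun n : ℕ => (n : ℝ) ^ j * Real.exp (-(-(β * s)) * n))).2
      (Real.summable_pow_mul_exp_neg_nat_mul j hr)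
    simpa using this
  refine Summable.of_nonneg_of_le (fun k => ?_) (fun k => ?_)
    (h1.mul_left ((4 * Real.pi * β) ^ ((d : ℝ) / 2))⁻¹)
  · have := (cycleWeight_pos (d := d) hβ k).le
    positivity
  · have h2 : 0 ≤ (k : ℝ) ^ j * Real.exp (β * s * k) := by positivity
    calc _ = cycleWeight d β k * ((k : ℝ) ^ j * Real.exp (β * s * k)) := by ring
      _ ≤ _ := mul_le_mul_of_nonneg_right (cycleWeight_le hβ k) h2

lemma summable_cycleWeight_mul_exp (hd : 1 ≤ d) (hβ : 0 < β) {s : ℝ} (hs : s ≤ 0) :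
    Summable fun k : ℕ+ => cycleWeight d β k * Real.exp (β * s * k) := by
  refine Summable.of_nonneg_of_le (fun k => ?_) (fun k => ?_) (summable_cycleWeight (β := β) hd)
  · have := (cycleWeight_pos (d := d) hβ k).le
    positivity
  · refine mul_le_of_le_one_right (cycleWeight_pos hβ k).le (Real.exp_le_one_iff.2 ?_)
    have := pnat_pos k
    have : β * s ≤ 0 := by nlinarith
    nlinarith

lemma hasDerivAt_cycleMoment (hβ : 0 < β) (j : ℕ) {s : ℝ} (hs : s < 0) :
    HasDerivAt (cycleMoment d β j) (β * cycleMoment d β (j + 1) s) s := by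
  -- On `Iio (s / 2)`, a neighbourhood of `s`, each differentiated term is dominated by its value at
  -- `s / 2`, which is still negative.
  have hu := (summable_cycleMoment (d := d) hβ (j + 1) (s := s / 2) (by linarith)).mul_left β
  have key := hasDerivAt_tsum_of_isPreconnected (𝕜 := ℝ) (t := Set.Iio (s / 2))
    (g := fun (k : ℕ+) (x : ℝ) => (k : ℝ) ^ j * cycleWeight d β k * Real.exp (β * x * k))
    (g' := fun k x => β * ((k : ℝ) ^ (j + 1) * cycleWeight d β k * Real.exp (β * x * k)))
    (y₀ := s) (y := s) hu isOpen_Iio isPreconnected_Iio ?_ ?_ (by simp only [Set.mem_Iio]; linarith)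
    (summable_cycleMoment hβ j hs) (by simp only [Set.mem_Iio]; linarith)
  · rw [tsum_mul_left] at key
    exact key
  · intro k y _
    have h1 : HasDerivAt (fun x : ℝ => β * x * k) (β * k) y := by
      simpa using ((hasDerivAt_id y).const_mul β).mul_const (k : ℝ)
    convert! h1.exp.const_mul ((k : ℝ) ^ j * cycleWeight d β k) using 1
    ring
  · intro k y hy
    have hw := (cycleWeight_pos (d := d) hβ k).le
    have hk := pnat_pos k
    rw [Real.norm_of_nonneg (by positivity)]
    have hy' : y ≤ s / 2 := le_of_lt hy
    gcongr

lemma continuousOn_cycleMoment (hβ : 0 < β) (j : ℕ) :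
    ContinuousOn (cycleMoment d β j) (Set.Iio 0) := fun _ hs =>
  (hasDerivAt_cycleMoment hβ j hs).continuousAt.continuousWithinAt

lemma cycleMoment_pos (hβ : 0 < β) (j : ℕ) {s : ℝ} (hs : s < 0) : 0 < cycleMoment d β j s := by
  have h : ∀ k : ℕ+, 0 < (k : ℝ) ^ j * cycleWeight d β k * Real.exp (β * s * k) := fun k => by
    have := cycleWeight_pos (d := d) hβ k
    have := pnat_pos k
    positivity
  exact (summable_cycleMoment hβ j hs).tsum_pos (fun k => (h k).le) 1 (h 1)

lemma strictMonoOn_cycleMoment (hβ : 0 < β) (j : ℕ) :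
    StrictMonoOn (cycleMoment d β j) (Set.Iio 0) := by
  refine strictMonoOn_of_deriv_pos (convex_Iio 0) (continuousOn_cycleMoment hβ j) fun s hs => ?_
  rw [interior_Iio] at hs
  rw [(hasDerivAt_cycleMoment hβ j hs).deriv]
  exact mul_pos hβ (cycleMoment_pos hβ _ hs)

lemma strictConvexOn_cycleMoment (hβ : 0 < β) (j : ℕ) :
    StrictConvexOn ℝ (Set.Iio 0) (cycleMoment d β j) := by
  refine StrictMonoOn.strictConvexOn_of_deriv (convex_Iio 0) (continuousOn_cycleMoment hβ j) ?_
  rw [interior_Iio]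
  intro s hs t ht hst
  rw [(hasDerivAt_cycleMoment hβ j hs).deriv, (hasDerivAt_cycleMoment hβ j ht).deriv]
  exact mul_lt_mul_of_pos_left (strictMonoOn_cycleMoment hβ _ hs ht hst) hβ

lemma idealPressure_eq (s : ℝ) : idealPressure d β s =
    β⁻¹ * ∑' k : ℕ+, cycleWeight d β k * Real.exp (β * s * k) := by
  rw [idealPressure, one_div, mul_inv, mul_assoc, ← tsum_mul_left]
  congr 1
  refine tsum_congr fun k => ?_
  rw [cycleWeight_eq]
  ring

lemma idealPressure_eq_cycleMoment :
    idealPressure d β = fun s => β⁻¹ * cycleMoment d β 0 s := by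
  funext s
  simp [idealPressure_eq, cycleMoment]

lemma hasDerivAt_idealPressure (hβ : 0 < β) {s : ℝ} (hs : s < 0) :
    HasDerivAt (idealPressure d β) (cycleMoment d β 1 s) s := by
  rw [idealPressure_eq_cycleMoment]
  convert! (hasDerivAt_cycleMoment (d := d) hβ 0 hs).const_mul β⁻¹ using 1
  field_simp

lemma deriv_idealPressure (hβ : 0 < β) {s : ℝ} (hs : s < 0) :
    deriv (idealPressure d β) s = cycleMoment d β 1 s := (hasDerivAt_idealPressure hβ hs).deriv

lemma iteratedDeriv_two_idealPressure (hβ : 0 < β) {s : ℝ} (hs : s < 0) :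
    iteratedDeriv 2 (idealPressure d β) s = β * cycleMoment d β 2 s := by
  rw [iteratedDeriv_succ, iteratedDeriv_one]
  have : deriv (idealPressure d β) =ᶠ[𝓝 s] cycleMoment d β 1 := by
    filter_upwards [Iio_mem_nhds hs] with t ht using deriv_idealPressure hβ ht
  rw [this.deriv_eq, (hasDerivAt_cycleMoment hβ 1 hs).deriv]

lemma idealPressure_nonneg (hβ : 0 < β) (s : ℝ) : 0 ≤ idealPressure d β s := by
  rw [idealPressure_eq]
  have : 0 ≤ ∑' k : ℕ+, cycleWeight d β k * Real.exp (β * s * k) :=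
    tsum_nonneg fun k => mul_nonneg (cycleWeight_pos hβ k).le (Real.exp_pos _).le
  positivity

/-- Separates the two branches of `sBeta`: densities produced by a negative slope never reach the
condensed branch. -/
lemma cycleMoment_one_lt_criticalDensity (hβ : 0 < β) {s : ℝ} (hs : s < 0) :
    (cycleMoment d β 1 s : EReal) < criticalDensity d β := by
  by_cases hd : 3 ≤ d
  · rw [criticalDensity_of_three_le hd, EReal.coe_lt_coe_iff]
    have h : ∀ k : ℕ+, (k : ℝ) ^ 1 * cycleWeight d β k * Real.exp (β * s * k) <
        (k : ℝ) * cycleWeight d β k := fun k => by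
      have := cycleWeight_pos (d := d) hβ k
      have hk := pnat_pos k
      rw [pow_one]
      refine mul_lt_of_lt_one_right (by positivity) (Real.exp_lt_one_iff.2 ?_)
      have : β * s < 0 := by nlinarith
      nlinarith
    exact (summable_cycleMoment hβ 1 hs).tsum_lt_tsum (fun k => (h k).le) (h 1)
      (summable_natCast_mul_cycleWeight hd)
  · rw [criticalDensity_of_not_three_le hd]
    exact EReal.coe_lt_top _

/-- Finite partial sums at `s = 0` exceed every `B < ϱ_c`. -/
lemma exists_finset_lt_of_lt_criticalDensity (hβ : 0 < β) {B : ℝ}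
    (hB : (B : EReal) < criticalDensity d β) :
    ∃ A : Finset ℕ+, B < ∑ k ∈ A, (k : ℝ) * cycleWeight d β k := by
  by_cases hd : 3 ≤ d
  · rw [criticalDensity_of_three_le hd, EReal.coe_lt_coe_iff] at hB
    have h := (summable_natCast_mul_cycleWeight (β := β) hd).hasSum
    exact ((tendsto_order.1 h).1 B hB).exists
  · by_contra! hcon
    refine not_summable_natCast_mul_cycleWeight hβ hd (summable_of_sum_le (fun k => ?_) hcon)
    exact mul_nonneg (pnat_pos k).le (cycleWeight_pos hβ k).le

lemma sum_le_cycleMoment_one (hβ : 0 < β) {s : ℝ} (hs : s < 0) (A : Finset ℕ+) :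
    ∑ k ∈ A, (k : ℝ) * cycleWeight d β k * Real.exp (β * s * k) ≤ cycleMoment d β 1 s := by
  have := (summable_cycleMoment (d := d) hβ 1 hs).sum_le_tsum A fun k _ => by
    have := (cycleWeight_pos (d := d) hβ k).le
    positivity
  simpa [cycleMoment] using this

/-- A finite partial sum that exceeds `B` at slope 0 is continuous in `s` and bounds the whole
series from below; this covers finite and infinite ϱ_c at once. -/
lemma eventually_lt_cycleMoment_one (hβ : 0 < β) {B : ℝ}
    (hB : (B : EReal) < criticalDensity d β) :
    ∀ᶠ s in 𝓝[<] (0 : ℝ), B < cycleMoment d β 1 s := by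
  obtain ⟨A, hA⟩ := exists_finset_lt_of_lt_criticalDensity hβ hB
  have hc : Continuous fun s : ℝ => ∑ k ∈ A, (k : ℝ) * cycleWeight d β k * Real.exp (β * s * k) := by
    fun_prop
  have h0 := (hc.tendsto 0).eventually (lt_mem_nhds (a := B) (by simpa using hA))
  filter_upwards [nhdsWithin_le_nhds h0, self_mem_nhdsWithin] with s h1 h2
  exact h1.trans_le (sum_le_cycleMoment_one hβ h2 A)

lemma exp_tangent (x y : ℝ) : Real.exp x * (1 + (y - x)) ≤ Real.exp y := by
  have h1 : y = x + (y - x) := by ring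
  have h2 := Real.add_one_le_exp (y - x)
  have h3 := Real.exp_pos x
  nth_rewrite 2 [h1]
  rw [Real.exp_add]
  nlinarith

/-- Convexity of the exponential, applied term by term; in this form the supporting line is valid up
to the boundary point `s = 0`. -/
lemma idealPressure_tangent (hd : 1 ≤ d) (hβ : 0 < β) {s t : ℝ} (hs : s ≤ 0) (ht : t < 0) :
    idealPressure d β t + cycleMoment d β 1 t * (s - t) ≤ idealPressure d β s := by
  rw [idealPressure_eq, idealPressure_eq, cycleMoment]
  have S1 := summable_cycleWeight_mul_exp hd hβ ht.le
  have S2 := (summable_cycleMoment (d := d) hβ 1 ht).mul_left (β * (s - t))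
  have key : ∑' k : ℕ+, (cycleWeight d β k * Real.exp (β * t * k) +
      β * (s - t) * ((k : ℝ) ^ 1 * cycleWeight d β k * Real.exp (β * t * k))) ≤
      ∑' k : ℕ+, cycleWeight d β k * Real.exp (β * s * k) := by
    refine (S1.add S2).tsum_le_tsum (fun k => ?_) (summable_cycleWeight_mul_exp hd hβ hs)
    have h1 := exp_tangent (β * t * k) (β * s * k)
    have h2 := mul_le_mul_of_nonneg_left h1 (cycleWeight_pos (d := d) hβ k).le
    refine le_trans (le_of_eq ?_) h2
    ring
  rw [S1.tsum_add S2, tsum_mul_left] at key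
  have := mul_le_mul_of_nonneg_left key (inv_pos.2 hβ).le
  refine le_trans (le_of_eq ?_) this
  field_simp

/-- At the endpoint 0 the left derivative of the pressure is ϱ_c, so on `s ≤ 0` any larger slope
also gives a supporting line. The hypothesis makes ϱ_c finite, which forces d ≥ 3. -/
lemma idealPressure_tangent_zero (hd : 1 ≤ d) (hβ : 0 < β) {s x : ℝ} (hs : s ≤ 0)
    (hx : criticalDensity d β ≤ (x : EReal)) :
    idealPressure d β 0 + x * s ≤ idealPressure d β s := by
  have hd3 : 3 ≤ d := by
    by_contra h
    rw [criticalDensity_of_not_three_le h, top_le_iff] at hx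
    exact EReal.coe_ne_top x hx
  rw [criticalDensity_of_three_le hd3, EReal.coe_le_coe_iff] at hx
  rw [idealPressure_eq, idealPressure_eq]
  have S1 := summable_cycleWeight_mul_exp hd hβ (le_refl (0 : ℝ))
  have S2 := (summable_natCast_mul_cycleWeight (β := β) hd3).mul_left (β * s)
  have key : ∑' k : ℕ+, (cycleWeight d β k * Real.exp (β * 0 * k) +
      β * s * ((k : ℝ) * cycleWeight d β k)) ≤
      ∑' k : ℕ+, cycleWeight d β k * Real.exp (β * s * k) := by
    refine (S1.add S2).tsum_le_tsum (fun k => ?_) (summable_cycleWeight_mul_exp hd hβ hs)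
    have h1 := exp_tangent (β * 0 * k) (β * s * k)
    have h2 := mul_le_mul_of_nonneg_left h1 (cycleWeight_pos (d := d) hβ k).le
    refine le_trans (le_of_eq ?_) h2
    simp
    ring
  rw [S1.tsum_add S2, tsum_mul_left] at key
  have := mul_le_mul_of_nonneg_left key (inv_pos.2 hβ).le
  refine le_trans ?_ this
  rw [mul_add, ← mul_assoc, ← mul_assoc, inv_mul_cancel₀ hβ.ne', one_mul]
  nlinarith

end IdealGas

/-! ### Stationary points -/

section Stationary

variable {d : ℕ} {β a b : ℝ}

open Classical in
/-- The solution `s ≤ 0` of `s = u - a x` with `s = s_β(x)`. -/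
noncomputable def statSlope (d : ℕ) (β a u : ℝ) : ℝ :=
  if criticalDensity d β ≤ ((u / a : ℝ) : EReal) then 0
  else Classical.epsilon fun s : ℝ => s < 0 ∧ s + a * cycleMoment d β 1 s = u

/-- The solution `x > 0` of `s_β(x) = u - a x`, as a function of `u`. -/
noncomputable def statDensity (d : ℕ) (β a u : ℝ) : ℝ := (u - statSlope d β a u) / a

/-- `sup_x {u x - a x² / 2 - f_0(β, x)}`. -/
noncomputable def meanFieldPressure (d : ℕ) (β a u : ℝ) : ℝ :=
  (u - statSlope d β a u) ^ 2 / (2 * a) + idealPressure d β (statSlope d β a u)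

lemma exists_statSlope (hβ : 0 < β) (ha : 0 < a) {u : ℝ}
    (hu : ((u / a : ℝ) : EReal) < criticalDensity d β) :
    ∃ s : ℝ, s < 0 ∧ s + a * cycleMoment d β 1 s = u := by
  obtain ⟨B, hB1, hB2⟩ := EReal.lt_iff_exists_real_btwn.1 hu
  rw [EReal.coe_lt_coe_iff] at hB1
  have hδ : u - a * B < 0 := by rw [div_lt_iff₀ ha] at hB1; linarith
  have h1 : ∀ᶠ s in 𝓝[<] (0 : ℝ), u - a * B < s :=
    nhdsWithin_le_nhds (lt_mem_nhds hδ)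
  obtain ⟨s₁, ⟨hs1, hs2⟩, hs3⟩ := ((h1.and (eventually_lt_cycleMoment_one hβ hB2)).and
    (self_mem_nhdsWithin : Set.Iio (0 : ℝ) ∈ 𝓝[<] (0 : ℝ))).exists
  have hs3 : s₁ < 0 := hs3
  -- At a slope at most u - a p_0'(s₁), monotonicity of p_0' already gives s + a p_0'(s) ≤ u, so no
  -- limit at -∞ is needed.
  set s₀ := min s₁ (u - a * cycleMoment d β 1 s₁) with hs0
  have h01 : s₀ ≤ s₁ := min_le_left _ _
  have hcont : ContinuousOn (fun s => s + a * cycleMoment d β 1 s) (Set.Icc s₀ s₁) :=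
    continuousOn_id.add (continuousOn_const.mul ((continuousOn_cycleMoment hβ 1).mono
      fun s hs => lt_of_le_of_lt hs.2 hs3))
  have hmono := (strictMonoOn_cycleMoment (d := d) hβ 1).monotoneOn
    (show s₀ ∈ Set.Iio 0 from h01.trans_lt hs3) hs3 h01
  obtain ⟨s, hs, hsu⟩ := intermediate_value_Icc h01 hcont (show u ∈ Set.Icc _ _ from
    ⟨by have := min_le_right s₁ (u - a * cycleMoment d β 1 s₁)
        nlinarith, by nlinarith⟩)
  exact ⟨s, hs.2.trans_lt hs3, hsu⟩

lemma statSlope_of_le {u : ℝ} (hu : criticalDensity d β ≤ ((u / a : ℝ) : EReal)) :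
    statSlope d β a u = 0 := if_pos hu

lemma statSlope_spec (hβ : 0 < β) (ha : 0 < a) {u : ℝ}
    (hu : ((u / a : ℝ) : EReal) < criticalDensity d β) :
    statSlope d β a u < 0 ∧
      statSlope d β a u + a * cycleMoment d β 1 (statSlope d β a u) = u := by
  rw [statSlope, if_neg hu.not_ge]
  exact Classical.epsilon_spec (exists_statSlope hβ ha hu)

lemma statSlope_nonpos (hβ : 0 < β) (ha : 0 < a) (u : ℝ) : statSlope d β a u ≤ 0 := by
  rcases le_or_gt (criticalDensity d β) ((u / a : ℝ) : EReal) with h | h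
  · exact (statSlope_of_le h).le
  · exact (statSlope_spec hβ ha h).1.le

lemma statSlope_neg_iff (hβ : 0 < β) (ha : 0 < a) {u : ℝ} :
    statSlope d β a u < 0 ↔ ((u / a : ℝ) : EReal) < criticalDensity d β := by
  refine ⟨fun h => ?_, fun h => (statSlope_spec hβ ha h).1⟩
  by_contra! hcon
  exact h.ne (statSlope_of_le hcon)

lemma statDensity_of_neg (hβ : 0 < β) (ha : 0 < a) {u : ℝ} (h : statSlope d β a u < 0) :
    statDensity d β a u = cycleMoment d β 1 (statSlope d β a u) := by
  have := (statSlope_spec hβ ha ((statSlope_neg_iff hβ ha).1 h)).2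
  rw [statDensity, div_eq_iff ha.ne']
  linarith

lemma mul_statDensity (ha : 0 < a) (u : ℝ) :
    a * statDensity d β a u = u - statSlope d β a u := by
  rw [statDensity, mul_div_cancel₀ _ ha.ne']

lemma strictMonoOn_slope_add (hβ : 0 < β) (ha : 0 < a) :
    StrictMonoOn (fun s => s + a * cycleMoment d β 1 s) (Set.Iio 0) := fun s hs t ht hst => by
  have := strictMonoOn_cycleMoment (d := d) hβ 1 hs ht hst
  have := mul_lt_mul_of_pos_left this ha
  show s + _ < t + _
  linarith

lemma statSlope_eq (hβ : 0 < β) (ha : 0 < a) {s u : ℝ} (hs : s < 0)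
    (h : s + a * cycleMoment d β 1 s = u) : statSlope d β a u = s := by
  have h1 : ((u / a : ℝ) : EReal) < criticalDensity d β := by
    refine lt_trans ?_ (cycleMoment_one_lt_criticalDensity hβ hs)
    rw [EReal.coe_lt_coe_iff, div_lt_iff₀ ha]
    linarith
  have h2 := statSlope_spec hβ ha h1
  exact (strictMonoOn_slope_add hβ ha).injOn h2.1 hs (h2.2.trans h.symm)

lemma statSlope_lt (hβ : 0 < β) (ha : 0 < a) {u v : ℝ} (huv : u < v)
    (hu : statSlope d β a u < 0) : statSlope d β a u < statSlope d β a v := by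
  rcases (statSlope_nonpos (d := d) hβ ha v).lt_or_eq with hv | hv
  · have h1 := (statSlope_spec hβ ha ((statSlope_neg_iff hβ ha).1 hu)).2
    have h2 := (statSlope_spec hβ ha ((statSlope_neg_iff hβ ha).1 hv)).2
    exact ((strictMonoOn_slope_add (d := d) hβ ha).lt_iff_lt hu hv).1 (by simpa only [h1, h2] using huv)
  · rwa [hv]

lemma statSlope_mono (hβ : 0 < β) (ha : 0 < a) : Monotone (statSlope d β a) := by
  intro u v huv
  rcases huv.lt_or_eq with h | rfl
  · rcases (statSlope_nonpos (d := d) hβ ha u).lt_or_eq with hu | hu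
    · exact (statSlope_lt hβ ha h hu).le
    · have h1 : criticalDensity d β ≤ ((u / a : ℝ) : EReal) := by
        by_contra! h1
        exact ((statSlope_neg_iff hβ ha).2 h1).ne hu
      have h2 : criticalDensity d β ≤ ((v / a : ℝ) : EReal) :=
        h1.trans (EReal.coe_le_coe_iff.2 (by gcongr))
      rw [hu, statSlope_of_le h2]
  · rfl

lemma statDensity_strictMono (hβ : 0 < β) (ha : 0 < a) : StrictMono (statDensity d β a) := by
  intro u v huv
  rcases (statSlope_nonpos (d := d) hβ ha u).lt_or_eq with hu | hu
  · rw [statDensity_of_neg hβ ha hu]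
    rcases (statSlope_nonpos (d := d) hβ ha v).lt_or_eq with hv | hv
    · rw [statDensity_of_neg hβ ha hv]
      exact strictMonoOn_cycleMoment hβ 1 hu hv (statSlope_lt hβ ha huv hu)
    · have h1 : criticalDensity d β ≤ ((v / a : ℝ) : EReal) := by
        by_contra! h1
        exact ((statSlope_neg_iff hβ ha).2 h1).ne hv
      have h2 := (cycleMoment_one_lt_criticalDensity (d := d) hβ hu).trans_le h1
      rw [EReal.coe_lt_coe_iff] at h2
      rwa [statDensity, hv, sub_zero]
  · have hv := statSlope_nonpos (d := d) hβ ha v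
    exact div_lt_div_of_pos_right (by linarith) ha

/-- The slope and `a` times the density are both nondecreasing in `u` and add up to `u`, so each is
1-Lipschitz, also across the condensation point. -/
lemma continuous_statSlope (hβ : 0 < β) (ha : 0 < a) : Continuous (statSlope d β a) := by
  have key : ∀ u v, u ≤ v → |statSlope d β a v - statSlope d β a u| ≤ |v - u| := fun u v h => by
    have h1 := statSlope_mono (d := d) hβ ha h
    have h2 := (statDensity_strictMono (d := d) hβ ha).monotone h
    have h3 := mul_le_mul_of_nonneg_left h2 ha.le
    rw [mul_statDensity ha, mul_statDensity ha] at h3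
    rw [abs_of_nonneg (by linarith), abs_of_nonneg (by linarith)]
    linarith
  have : LipschitzWith 1 (statSlope d β a) := LipschitzWith.of_dist_le_mul fun u v => by
    rw [Real.dist_eq, Real.dist_eq, NNReal.coe_one, one_mul]
    rcases le_total u v with h | h
    · rw [abs_sub_comm, abs_sub_comm u]; exact key u v h
    · exact key v u h
  exact this.continuous

lemma continuous_statDensity (hβ : 0 < β) (ha : 0 < a) : Continuous (statDensity d β a) :=
  (continuous_id.sub (continuous_statSlope hβ ha)).div_const a

lemma statDensity_pos (hβ : 0 < β) (ha : 0 < a) (u : ℝ) : 0 < statDensity d β a u := by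
  have key : ∀ v, statSlope d β a v < 0 → 0 < statDensity d β a v := fun v hv => by
    rw [statDensity_of_neg hβ ha hv]; exact cycleMoment_pos hβ 1 hv
  rcases (statSlope_nonpos (d := d) hβ ha u).lt_or_eq with hu | hu
  · exact key u hu
  -- In the condensed regime compare with the parameter `v` whose slope is -1, which lies to the
  -- left of `u`.
  · have h1 := statSlope_eq (d := d) (a := a) hβ ha (s := -1) (by norm_num) rfl
    set v := -1 + a * cycleMoment d β 1 (-1)
    have h2 : statSlope d β a v < 0 := by rw [h1]; norm_num
    refine (key v h2).trans (statDensity_strictMono hβ ha ?_)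
    by_contra! hcon
    have := statSlope_mono (d := d) hβ ha hcon
    linarith

/-- All cycles have length at least 1, so lowering the slope from -1 to `s` gains a factor
e^{β(s+1)} in every term. -/
lemma exists_cycleMoment_one_lt (hβ : 0 < β) {x : ℝ} (hx : 0 < x) :
    ∃ s : ℝ, s < 0 ∧ cycleMoment d β 1 s < x := by
  have hb : ∀ s : ℝ, s ≤ -1 →
      cycleMoment d β 1 s ≤ Real.exp (β * (s + 1)) * cycleMoment d β 1 (-1) := fun s hs => by
    rw [cycleMoment, cycleMoment, ← tsum_mul_left]
    refine (summable_cycleMoment hβ 1 (by linarith)).tsum_le_tsum (fun k => ?_)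
      ((summable_cycleMoment hβ 1 (by norm_num)).mul_left _)
    have hw := (cycleWeight_pos (d := d) hβ k).le
    have hk := one_le_pnat k
    have h0 : β * (s + 1) ≤ 0 := by nlinarith
    calc (k : ℝ) ^ 1 * cycleWeight d β k * Real.exp (β * s * k)
        ≤ (k : ℝ) ^ 1 * cycleWeight d β k * Real.exp (β * (s + 1) + β * (-1) * k) := by
          gcongr
          nlinarith
      _ = _ := by rw [Real.exp_add]; ring
  have hlim : Tendsto (fun s : ℝ => Real.exp (β * (s + 1)) * cycleMoment d β 1 (-1)) atBot
      (𝓝 (0 * cycleMoment d β 1 (-1))) := by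
    refine (Real.tendsto_exp_atBot.comp ?_).mul_const _
    exact (tendsto_atBot_add_const_right _ _ tendsto_id).const_mul_atBot hβ
  rw [zero_mul] at hlim
  obtain ⟨s, hs1, hs2⟩ := ((hlim.eventually (gt_mem_nhds hx)).and
    (eventually_le_atBot (-1 : ℝ))).exists
  exact ⟨s, by linarith, (hb s hs2).trans_lt hs1⟩

lemma exists_statDensity_eq (hβ : 0 < β) (ha : 0 < a) {x : ℝ} (hx : 0 < x) :
    ∃ u, statDensity d β a u = x := by
  obtain ⟨s, hs, hsx⟩ := exists_cycleMoment_one_lt (d := d) hβ hx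
  have h1 := statSlope_eq (d := d) (a := a) hβ ha hs rfl
  have h2 := statDensity_of_neg (d := d) (a := a) hβ ha (h1.symm ▸ hs)
  rw [h1] at h2
  have h3 : x ≤ statDensity d β a (a * x) := by
    rw [statDensity, le_div_iff₀ ha]
    linarith [statSlope_nonpos (d := d) hβ ha (a * x)]
  exact mem_range_of_exists_le_of_exists_ge (continuous_statDensity hβ ha)
    ⟨_, h2.trans_le hsx.le⟩ ⟨_, h3⟩

/-- Justifies the parametrisation by `u`: injectivity of p_0' identifies the value selected by
`epsilon` in `sBeta`. -/
lemma sBeta_statDensity (hβ : 0 < β) (ha : 0 < a) (u : ℝ) :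
    sBeta d β (statDensity d β a u) = statSlope d β a u := by
  rcases (statSlope_nonpos (d := d) hβ ha u).lt_or_eq with hu | hu
  · rw [statDensity_of_neg hβ ha hu, sBeta,
      if_neg (cycleMoment_one_lt_criticalDensity hβ hu).not_ge]
    have := Classical.epsilon_spec (p := fun s : ℝ => s < 0 ∧ deriv (idealPressure d β) s =
      cycleMoment d β 1 (statSlope d β a u)) ⟨_, hu, deriv_idealPressure hβ hu⟩
    refine (strictMonoOn_cycleMoment (d := d) hβ 1).injOn this.1 hu ?_
    rw [← deriv_idealPressure hβ this.1, this.2]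
  · have h1 : criticalDensity d β ≤ ((u / a : ℝ) : EReal) := by
      by_contra! h1
      exact ((statSlope_neg_iff hβ ha).2 h1).ne hu
    rw [hu, sBeta, if_pos]
    rwa [statDensity, hu, sub_zero]

/-- The density map is onto (0, ∞), so any solution is `statDensity u` for some `u`, and the
defining equation then reads u = ν. -/
lemma xOne_eq (hβ : 0 < β) (ha : 0 < a) (ν : ℝ) : xOne d β a ν = statDensity d β a ν := by
  have h := Classical.epsilon_spec (p := fun x : ℝ => 0 < x ∧ sBeta d β x = ν - a * x)
    ⟨statDensity d β a ν, statDensity_pos hβ ha ν, by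
      rw [sBeta_statDensity hβ ha, mul_statDensity ha]; ring⟩
  obtain ⟨u, hu⟩ := exists_statDensity_eq (d := d) hβ ha h.1
  have h2 := h.2
  rw [← hu, sBeta_statDensity hβ ha, mul_statDensity ha] at h2
  have : u = ν := by linarith
  rw [xOne, ← hu, this]

/-! ### The Legendre transform and the mean-field pressure -/

/-- The tangent of the ideal pressure at a stationary slope. -/
lemma idealPressure_tangent_statSlope (hd : 1 ≤ d) (hβ : 0 < β) (ha : 0 < a) (u : ℝ) {s : ℝ}
    (hs : s ≤ 0) : idealPressure d β (statSlope d β a u) +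
      statDensity d β a u * (s - statSlope d β a u) ≤ idealPressure d β s := by
  rcases (statSlope_nonpos (d := d) hβ ha u).lt_or_eq with hu | hu
  · rw [statDensity_of_neg hβ ha hu]
    exact idealPressure_tangent hd hβ hs hu
  · have h1 : criticalDensity d β ≤ ((u / a : ℝ) : EReal) := by
      by_contra! h1
      exact ((statSlope_neg_iff hβ ha).2 h1).ne hu
    rw [statDensity, hu, sub_zero, sub_zero]
    exact idealPressure_tangent_zero hd hβ hs h1

lemma bddAbove_legendre (hβ : 0 < β) {x : ℝ} (hx : 0 ≤ x) :
    BddAbove ((fun s : ℝ => s * x - idealPressure d β s) '' Set.Iic 0) := by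
  refine ⟨0, ?_⟩
  rintro _ ⟨s, hs, rfl⟩
  have hs : s ≤ 0 := hs
  have := idealPressure_nonneg (d := d) hβ s
  show s * x - _ ≤ 0
  nlinarith

lemma le_idealFreeEnergy (hβ : 0 < β) {x s : ℝ} (hx : 0 ≤ x) (hs : s ≤ 0) :
    s * x - idealPressure d β s ≤ idealFreeEnergy d β x :=
  le_csSup (bddAbove_legendre hβ hx) ⟨s, hs, rfl⟩

/-- The supporting line at the stationary slope says that the supremum in the Legendre transform is
attained there. -/
lemma idealFreeEnergy_statDensity (hd : 1 ≤ d) (hβ : 0 < β) (ha : 0 < a) (u : ℝ) :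
    idealFreeEnergy d β (statDensity d β a u) =
      statSlope d β a u * statDensity d β a u - idealPressure d β (statSlope d β a u) := by
  refine le_antisymm (csSup_le (Set.nonempty_Iic.image _) ?_)
    (le_idealFreeEnergy hβ (statDensity_pos hβ ha u).le (statSlope_nonpos hβ ha u))
  rintro _ ⟨s, hs, rfl⟩
  have := idealPressure_tangent_statSlope hd hβ ha u hs
  show s * _ - _ ≤ _
  linarith

/-- Bound f_0(x) from below by its affine minorant with the slope belonging to μ - a y, then
complete the square in `x`. The square is kept because it makes the minimising `x` unique. -/
lemma le_freeEnergyFunctional (hβ : 0 < β) (ha : 0 < a) (μ y : ℝ) {x : ℝ}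
    (hx : 0 ≤ x) :
    -meanFieldPressure d β a (μ - a * y) + a / 2 * (x - statDensity d β a (μ - a * y)) ^ 2 +
      (a - b) / 2 * y ^ 2 - μ * y ≤ freeEnergyFunctional d β a b μ (x, y) := by
  have h1 := le_idealFreeEnergy (d := d) hβ hx (statSlope_nonpos (d := d) hβ ha (μ - a * y))
  rw [freeEnergyFunctional, meanFieldPressure, statDensity]
  have h2 : ∀ T : ℝ, a / 2 * (x - (μ - a * y - T) / a) ^ 2 =
      a / 2 * x ^ 2 - x * (μ - a * y - T) + (μ - a * y - T) ^ 2 / (2 * a) := fun T => by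
    field_simp
    ring
  rw [h2]
  simp only
  nlinarith

lemma freeEnergyFunctional_statDensity (hd : 1 ≤ d) (hβ : 0 < β) (ha : 0 < a) (μ y : ℝ) :
    freeEnergyFunctional d β a b μ (statDensity d β a (μ - a * y), y) =
      -meanFieldPressure d β a (μ - a * y) + (a - b) / 2 * y ^ 2 - μ * y := by
  rw [freeEnergyFunctional, meanFieldPressure]
  simp only
  rw [idealFreeEnergy_statDensity hd hβ ha]
  have h := mul_statDensity (d := d) (β := β) ha (μ - a * y)
  set X := statDensity d β a (μ - a * y)
  have hT : statSlope d β a (μ - a * y) = μ - a * y - a * X := by linarith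
  rw [hT]
  field_simp
  ring

lemma meanFieldPressure_lower (hd : 1 ≤ d) (hβ : 0 < β) (ha : 0 < a) (u v : ℝ) :
    meanFieldPressure d β a u + statDensity d β a u * (v - u) ≤ meanFieldPressure d β a v := by
  have h := idealPressure_tangent_statSlope hd hβ ha u (statSlope_nonpos (d := d) hβ ha v)
  have hu := mul_statDensity (d := d) (β := β) ha u
  have hv := mul_statDensity (d := d) (β := β) ha v
  rw [meanFieldPressure, meanFieldPressure, ← hu, ← hv]
  have e : ∀ x : ℝ, (a * x) ^ 2 / (2 * a) = a / 2 * x ^ 2 := fun x => by field_simp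
  rw [e, e]
  have h5 : statDensity d β a u * (statSlope d β a v - statSlope d β a u) =
      statDensity d β a u * (v - u) - a * statDensity d β a u * statDensity d β a v +
        a * statDensity d β a u ^ 2 := by
    rw [show statSlope d β a v = v - a * statDensity d β a v by linarith,
      show statSlope d β a u = u - a * statDensity d β a u by linarith]
    ring
  have := mul_nonneg ha.le (sq_nonneg (statDensity d β a u - statDensity d β a v))
  nlinarith

lemma meanFieldPressure_upper (hd : 1 ≤ d) (hβ : 0 < β) (ha : 0 < a) (u v : ℝ) :
    meanFieldPressure d β a v ≤
      meanFieldPressure d β a u + statDensity d β a u * (v - u) + (v - u) ^ 2 / (2 * a) := by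
  have h := idealPressure_tangent_statSlope hd hβ ha v (statSlope_nonpos (d := d) hβ ha u)
  have hu := mul_statDensity (d := d) (β := β) ha u
  have hv := mul_statDensity (d := d) (β := β) ha v
  have hTu : statSlope d β a u = u - a * statDensity d β a u := by linarith
  have hTv : statSlope d β a v = v - a * statDensity d β a v := by linarith
  rw [meanFieldPressure, meanFieldPressure, ← hu, ← hv]
  have e : ∀ x : ℝ, (a * x) ^ 2 / (2 * a) = a / 2 * x ^ 2 := fun x => by field_simp
  rw [e, e]
  set X := statDensity d β a u
  set Y := statDensity d β a v
  have h5 : Y * (statSlope d β a u - statSlope d β a v) = Y * (u - v) - a * X * Y + a * Y ^ 2 := by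
    rw [hTu, hTv]; ring
  -- The quantity being squared is the difference of the slopes at `v` and at `u`; discarding it is
  -- the only loss besides convexity.
  have key : 0 ≤ (v - u - a * (Y - X)) ^ 2 / (2 * a) := by positivity
  have e2 : (v - u - a * (Y - X)) ^ 2 / (2 * a) =
      (v - u) ^ 2 / (2 * a) - (v - u) * (Y - X) + a / 2 * (Y - X) ^ 2 := by
    field_simp
    ring
  rw [e2] at key
  nlinarith

/-- The convex lower bound and the quadratic upper bound trap the remainder between 0 and (v -
u)²/(2a). This gives differentiability also at u = aϱ_c, where the formula changes branch. -/
lemma hasDerivAt_meanFieldPressure (hd : 1 ≤ d) (hβ : 0 < β) (ha : 0 < a) (u : ℝ) :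
    HasDerivAt (meanFieldPressure d β a) (statDensity d β a u) u := by
  rw [hasDerivAt_iff_isLittleO]
  refine Asymptotics.IsBigO.trans_isLittleO (g := fun v => ‖v - u‖ ^ 2) ?_
    (Asymptotics.isLittleO_pow_sub_sub u one_lt_two)
  refine Asymptotics.IsBigO.of_bound (1 / (2 * a)) (Eventually.of_forall fun v => ?_)
  have h1 := meanFieldPressure_lower (d := d) hd hβ ha u v
  have h2 := meanFieldPressure_upper (d := d) hd hβ ha u v
  rw [smul_eq_mul, Real.norm_eq_abs, abs_of_nonneg (by linarith), norm_pow, norm_norm,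
    Real.norm_eq_abs, sq_abs]
  have : 1 / (2 * a) * (v - u) ^ 2 = (v - u) ^ 2 / (2 * a) := by ring
  linarith

end Stationary

/-! ### The reduced functional of the long-cycle density -/

section Reduced

variable {d : ℕ} {β a b : ℝ}

/-- `inf_x F_μ(x, y) - inf_x F_μ(x, 0)`. -/
noncomputable def energyGap (d : ℕ) (β a b μ y : ℝ) : ℝ :=
  meanFieldPressure d β a μ - meanFieldPressure d β a (μ - a * y) + (a - b) / 2 * y ^ 2 - μ * y

/-- `y` is a stationary point of `energyGap d β a b μ` if and only if this function takes the
value `μ` at `μ - a y`. -/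
noncomputable def statLevel (d : ℕ) (β a b u : ℝ) : ℝ := u - a / b * statSlope d β a u

@[simp] lemma energyGap_zero (μ : ℝ) : energyGap d β a b μ 0 = 0 := by
  simp [energyGap]

lemma le_freeEnergyFunctional_energyGap (hβ : 0 < β) (ha : 0 < a) (μ y : ℝ) {x : ℝ}
    (hx : 0 ≤ x) : energyGap d β a b μ y - meanFieldPressure d β a μ +
      a / 2 * (x - statDensity d β a (μ - a * y)) ^ 2 ≤ freeEnergyFunctional d β a b μ (x, y) := by
  have := le_freeEnergyFunctional (d := d) (b := b) hβ ha μ y hx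
  rw [energyGap]
  linarith

lemma freeEnergyFunctional_eq_energyGap (hd : 1 ≤ d) (hβ : 0 < β) (ha : 0 < a) (μ y : ℝ) :
    freeEnergyFunctional d β a b μ (statDensity d β a (μ - a * y), y) =
      energyGap d β a b μ y - meanFieldPressure d β a μ := by
  rw [freeEnergyFunctional_statDensity hd hβ ha, energyGap]
  ring

lemma continuous_meanFieldPressure (hd : 1 ≤ d) (hβ : 0 < β) (ha : 0 < a) :
    Continuous (meanFieldPressure d β a) :=
  continuous_iff_continuousAt.2 fun u => (hasDerivAt_meanFieldPressure hd hβ ha u).continuousAt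

lemma continuous_energyGap (hd : 1 ≤ d) (hβ : 0 < β) (ha : 0 < a) :
    Continuous fun p : ℝ × ℝ => energyGap d β a b p.1 p.2 := by
  have := continuous_meanFieldPressure (d := d) hd hβ ha
  unfold energyGap
  fun_prop

lemma continuous_energyGap_left (hd : 1 ≤ d) (hβ : 0 < β) (ha : 0 < a) (y : ℝ) :
    Continuous fun μ => energyGap d β a b μ y := by
  have := continuous_meanFieldPressure (d := d) hd hβ ha
  unfold energyGap
  fun_prop

lemma continuous_energyGap_right (hd : 1 ≤ d) (hβ : 0 < β) (ha : 0 < a) (μ : ℝ) :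
    Continuous (energyGap d β a b μ) := by
  have := continuous_meanFieldPressure (d := d) hd hβ ha
  unfold energyGap
  fun_prop

lemma hasDerivAt_energyGap_right (hd : 1 ≤ d) (hβ : 0 < β) (ha : 0 < a) (hb : 0 < b) (μ y : ℝ) :
    HasDerivAt (energyGap d β a b μ) (b / a * (statLevel d β a b (μ - a * y) - μ)) y := by
  have h1 : HasDerivAt (fun y : ℝ => μ - a * y) (-a) y := by
    simpa using ((hasDerivAt_id y).const_mul a).const_sub μ
  have h2 := (hasDerivAt_meanFieldPressure (d := d) hd hβ ha (μ - a * y)).comp y h1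
  have h3 : HasDerivAt (fun y : ℝ => (a - b) / 2 * y ^ 2) ((a - b) / 2 * (2 * y)) y := by
    simpa using ((hasDerivAt_id y).pow 2).const_mul ((a - b) / 2)
  have h4 : HasDerivAt (fun y : ℝ => μ * y) μ y := by
    simpa using (hasDerivAt_id y).const_mul μ
  have h5 := ((h2.const_sub (meanFieldPressure d β a μ)).add h3).sub h4
  convert! h5 using 1
  have := mul_statDensity (d := d) (β := β) ha (μ - a * y)
  rw [statLevel]
  have e : b / a * (μ - a * y - a / b * statSlope d β a (μ - a * y) - μ) =
      -b * y - statSlope d β a (μ - a * y) := by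
    field_simp
    ring
  rw [e]
  linarith

lemma hasDerivAt_energyGap_left (hd : 1 ≤ d) (hβ : 0 < β) (ha : 0 < a) (μ y : ℝ) :
    HasDerivAt (fun μ => energyGap d β a b μ y)
      ((statSlope d β a (μ - a * y) - statSlope d β a μ) / a) μ := by
  have h1 : HasDerivAt (fun μ : ℝ => μ - a * y) 1 μ := (hasDerivAt_id μ).sub_const _
  have h2 := (hasDerivAt_meanFieldPressure (d := d) hd hβ ha (μ - a * y)).comp μ h1
  have h3 := hasDerivAt_meanFieldPressure (d := d) hd hβ ha μ
  have h4 : HasDerivAt (fun μ : ℝ => μ * y) y μ := by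
    simpa using (hasDerivAt_id μ).mul_const y
  have h5 := ((h3.sub h2).add_const ((a - b) / 2 * y ^ 2)).sub h4
  convert! h5 using 1
  rw [statDensity, statDensity]
  field_simp
  ring

/-- The sign of the μ-derivative is that of the slope at μ - a y minus the slope at μ, and the slope
is nondecreasing. -/
lemma energyGap_anti (hd : 1 ≤ d) (hβ : 0 < β) (ha : 0 < a) {y : ℝ} (hy : 0 ≤ y) :
    Antitone fun μ => energyGap d β a b μ y := by
  refine antitone_of_hasDerivAt_nonpos (fun μ => hasDerivAt_energyGap_left hd hβ ha μ y)
    fun μ => ?_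
  have := statSlope_mono (d := d) (a := a) hβ ha (show μ - a * y ≤ μ by nlinarith)
  exact div_nonpos_of_nonpos_of_nonneg (by linarith) ha.le

/-- In the condensed regime the total density stays μ/a however it is split between x and y, so
moving y into long cycles costs nothing and gains (b/2)y². -/
lemma energyGap_of_statSlope_eq_zero (hβ : 0 < β) (ha : 0 < a) {μ y : ℝ} (hy : 0 ≤ y)
    (h : statSlope d β a (μ - a * y) = 0) : energyGap d β a b μ y = -(b / 2 * y ^ 2) := by
  have h2 : statSlope d β a μ = 0 := by
    have := statSlope_mono (d := d) (a := a) hβ ha (show μ - a * y ≤ μ by nlinarith)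
    exact le_antisymm (statSlope_nonpos hβ ha μ) (h ▸ this)
  rw [energyGap, meanFieldPressure, meanFieldPressure, h, h2]
  field_simp
  ring

/-- Raising `μ` strictly favours long cycles. -/
lemma energyGap_neg_of_lt (hd : 1 ≤ d) (hβ : 0 < β) (ha : 0 < a) (hb : 0 < b) {μ μ' y : ℝ}
    (hy : 0 < y) (h : energyGap d β a b μ y ≤ 0) (hμ : μ < μ') : energyGap d β a b μ' y < 0 := by
  -- As long as the slope at μ' - a y is negative, the gap decreases strictly in μ on the whole
  -- interval; otherwise its value at μ' is explicit and negative.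
  rcases (statSlope_nonpos (d := d) hβ ha (μ' - a * y)).lt_or_eq with h1 | h1
  · refine lt_of_lt_of_le ?_ h
    refine strictAntiOn_of_deriv_neg (convex_Icc μ μ')
      (continuous_energyGap_left hd hβ ha y).continuousOn (fun ν hν => ?_)
      (Set.left_mem_Icc.2 hμ.le) (Set.right_mem_Icc.2 hμ.le) hμ
    rw [interior_Icc] at hν
    rw [(hasDerivAt_energyGap_left hd hβ ha ν y).deriv]
    have h2 := statSlope_mono (d := d) (a := a) hβ ha (sub_le_sub_right hν.2.le (a * y))
    have h3 := statSlope_lt (d := d) (a := a) hβ ha (show ν - a * y < ν by nlinarith)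
      (h2.trans_lt h1)
    exact div_neg_of_neg_of_pos (by linarith) ha
  · rw [energyGap_of_statSlope_eq_zero hβ ha hy.le h1]
    have : 0 < b / 2 * y ^ 2 := by positivity
    linarith

/-- The mean-field pressure increases, its derivative being a positive density; dropping its
increment leaves a quadratic bound, coercive in `y` since a > b. -/
lemma le_energyGap (hd : 1 ≤ d) (hβ : 0 < β) (ha : 0 < a) {μ y : ℝ} (hy : 0 ≤ y) :
    (a - b) / 2 * y ^ 2 - μ * y ≤ energyGap d β a b μ y := by
  have h := meanFieldPressure_lower (d := d) hd hβ ha (μ - a * y) μ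
  have h2 := statDensity_pos (d := d) hβ ha (μ - a * y)
  have h3 : 0 ≤ statDensity d β a (μ - a * y) * (μ - (μ - a * y)) := by
    have : 0 ≤ a * y := by positivity
    apply mul_nonneg h2.le
    linarith
  rw [energyGap]
  linarith

/-- Test with y = μ/(a - b), the minimiser of the quadratic part: the gap is then at most p_0(0) -
μ²(1/(2(a-b)) - 1/(2a)), which tends to -∞ as μ → ∞. -/
lemma exists_energyGap_neg (hd : 1 ≤ d) (hβ : 0 < β) (hb : 0 < b) (hab : b < a) {r : ℝ}
    (hr : 0 ≤ r) : ∃ μ y : ℝ, 0 < y ∧ r ≤ y ∧ energyGap d β a b μ y < 0 := by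
  have ha : 0 < a := hb.trans hab
  have hab' : 0 < a - b := by linarith
  have hup : ∀ μ : ℝ, 0 < μ →
      energyGap d β a b μ (μ / (a - b)) ≤
        idealPressure d β 0 + μ ^ 2 / (2 * a) - μ ^ 2 / (2 * (a - b)) := fun μ hμ => by
    have h1 : meanFieldPressure d β a μ ≤ μ ^ 2 / (2 * a) + idealPressure d β 0 := by
      have h := idealPressure_tangent_statSlope hd hβ ha μ (le_refl (0 : ℝ))
      have hT := mul_statDensity (d := d) (β := β) ha μ
      have hT' : statSlope d β a μ = μ - a * statDensity d β a μ := by linarith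
      rw [meanFieldPressure, ← hT]
      set X := statDensity d β a μ
      have e : μ ^ 2 / (2 * a) = a / 2 * X ^ 2 + X * (μ - a * X) + (μ - a * X) ^ 2 / (2 * a) := by
        field_simp
        ring
      have e2 : (a * X) ^ 2 / (2 * a) = a / 2 * X ^ 2 := by field_simp
      have e3 : 0 ≤ (μ - a * X) ^ 2 / (2 * a) := by positivity
      rw [hT'] at h ⊢
      rw [e, e2]
      linarith
    have h2 : 0 ≤ meanFieldPressure d β a (μ - a * (μ / (a - b))) := by
      have := idealPressure_nonneg (d := d) hβ
        (statSlope d β a (μ - a * (μ / (a - b))))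
      rw [meanFieldPressure]
      positivity
    have e : (a - b) / 2 * (μ / (a - b)) ^ 2 - μ * (μ / (a - b)) = -(μ ^ 2 / (2 * (a - b))) := by
      field_simp
      ring
    rw [energyGap]
    linarith
  have hc : 0 < 1 / (2 * (a - b)) - 1 / (2 * a) := by
    rw [sub_pos]
    exact one_div_lt_one_div_of_lt (by linarith) (by linarith)
  set c := 1 / (2 * (a - b)) - 1 / (2 * a)
  have hp := idealPressure_nonneg (d := d) hβ 0
  have hr' : 0 ≤ (a - b) * r := by positivity
  set q := idealPressure d β 0 / c
  have hq : 0 ≤ q := by positivity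
  -- The last summand makes ν/(a - b) ≥ r, and the first two give ν² > q.
  set ν := 1 + q + (a - b) * r
  have hν : 0 < ν := by positivity
  refine ⟨ν, ν / (a - b), by positivity, ?_, (hup ν hν).trans_lt ?_⟩
  · rw [le_div_iff₀ hab']
    simp only [ν]
    linarith
  have e : idealPressure d β 0 = q * c := (div_mul_cancel₀ _ hc.ne').symm
  have e2 : ν ^ 2 / (2 * a) - ν ^ 2 / (2 * (a - b)) = -(c * ν ^ 2) := by
    simp only [c]
    ring
  have h1 : 1 + q ≤ ν := by simp only [ν]; linarith
  have h2 : q < ν ^ 2 := by nlinarith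
  have h3 := mul_lt_mul_of_pos_left h2 hc
  rw [add_sub_assoc, e2, e]
  linarith

/-! ### The level function -/

lemma continuous_statLevel (hβ : 0 < β) (ha : 0 < a) : Continuous (statLevel d β a b) :=
  continuous_id.sub (continuous_const.mul (continuous_statSlope hβ ha))

lemma le_statLevel (hβ : 0 < β) (hb : 0 < b) (ha : 0 < a) (u : ℝ) : u ≤ statLevel d β a b u := by
  have h1 := statSlope_nonpos (d := d) hβ ha u
  have h2 : 0 < a / b := by positivity
  rw [statLevel]
  nlinarith

/-- A positive density means that the slope is at most `u`. With `le_statLevel` this makes the level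
tend to +∞ at both ends. -/
lemma neg_mul_le_statLevel (hβ : 0 < β) (hb : 0 < b) (ha : 0 < a) (u : ℝ) :
    -((a - b) / b * u) ≤ statLevel d β a b u := by
  have h1 := statDensity_pos (d := d) hβ ha u
  have h3 := mul_statDensity (d := d) (β := β) ha u
  have h4 : statSlope d β a u ≤ u := by nlinarith
  have h2 : a / b * statSlope d β a u ≤ a / b * u := by gcongr
  have e : (a - b) / b * u = a / b * u - u := by field_simp
  rw [statLevel]
  linarith

/-- As a function of the slope, the level is exactly the function whose infimum defines `muT`. -/
lemma statLevel_of_neg (hβ : 0 < β) (hb : 0 < b) (ha : 0 < a) {u : ℝ}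
    (h : statSlope d β a u < 0) :
    statLevel d β a b u = a * cycleMoment d β 1 (statSlope d β a u) -
      (a - b) / b * statSlope d β a u := by
  have h1 := mul_statDensity (d := d) (β := β) ha u
  rw [← statDensity_of_neg hβ ha h, h1, statLevel]
  field_simp
  ring

lemma strictConvexOn_level (hβ : 0 < β) (ha : 0 < a) (c : ℝ) :
    StrictConvexOn ℝ (Set.Iio 0) fun s => a * cycleMoment d β 1 s - c * s := by
  refine ⟨convex_Iio 0, fun s hs t ht hst p q hp hq hpq => ?_⟩
  have := (strictConvexOn_cycleMoment (d := d) hβ 1).2 hs ht hst hp hq hpq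
  simp only [smul_eq_mul] at this ⊢
  have := mul_lt_mul_of_pos_left this ha
  nlinarith

/-- Strict quasiconvexity. Where the slope is negative, the level is a strictly convex function of
the slope, itself a strictly increasing parameter; where the slope vanishes, the level is the
identity. The two regimes are glued at the first zero of the slope. -/
lemma statLevel_lt_max (hβ : 0 < β) (hb : 0 < b) (ha : 0 < a) {u₁ u u₂ : ℝ}
    (h1 : u₁ < u) (h2 : u < u₂) :
    statLevel d β a b u < max (statLevel d β a b u₁) (statLevel d β a b u₂) := by
  have key : ∀ v₁ v v₂ : ℝ, v₁ < v → v < v₂ → statSlope d β a v₂ < 0 →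
      statLevel d β a b v < max (statLevel d β a b v₁) (statLevel d β a b v₂) := by
    intro v₁ v v₂ hv1 hv2 hneg
    have hv : statSlope d β a v < 0 := (statSlope_mono hβ ha hv2.le).trans_lt hneg
    have hv' : statSlope d β a v₁ < 0 := (statSlope_mono hβ ha hv1.le).trans_lt hv
    have hl := statSlope_lt (d := d) hβ ha hv1 hv'
    have hr := statSlope_lt (d := d) hβ ha hv2 hv
    rw [statLevel_of_neg hβ hb ha hv, statLevel_of_neg hβ hb ha hv', statLevel_of_neg hβ hb ha hneg]
    refine (strictConvexOn_level (d := d) hβ ha ((a - b) / b)).lt_on_openSegment hv' hneg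
      (hl.trans hr).ne ?_
    rw [openSegment_eq_Ioo (hl.trans hr)]
    exact ⟨hl, hr⟩
  rcases (statSlope_nonpos (d := d) hβ ha u).lt_or_eq with hu | hu
  · rcases (statSlope_nonpos (d := d) hβ ha u₂).lt_or_eq with hu2 | hu2
    · exact key _ _ _ h1 h2 hu2
    · -- the first point `w` at which the slope vanishes
      by_contra! hcon
      rw [max_le_iff] at hcon
      set w := sInf {v | statSlope d β a v = 0 ∧ u ≤ v} with hw
      have hbdd : BddBelow {v | statSlope d β a v = 0 ∧ u ≤ v} := ⟨u, fun v hv => hv.2⟩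
      have hmem : w ∈ {v | statSlope d β a v = 0 ∧ u ≤ v} :=
        IsClosed.csInf_mem ((isClosed_eq (continuous_statSlope hβ ha) continuous_const).inter
          isClosed_Ici) ⟨u₂, hu2, h2.le⟩ hbdd
      have hwu2 : w ≤ u₂ := csInf_le hbdd ⟨hu2, h2.le⟩
      have huw : u < w := lt_of_le_of_ne hmem.2 (by rintro h; rw [h, hmem.1] at hu; exact hu.false)
      have hlt : ∀ v, v < w → statSlope d β a v < 0 := fun v hv => by
        rcases le_or_gt u v with h | h
        · refine lt_of_le_of_ne (statSlope_nonpos hβ ha v) fun h0 => ?_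
          exact (csInf_le hbdd ⟨h0, h⟩).not_gt hv
        · exact (statSlope_mono hβ ha h.le).trans_lt hu
      -- If the claim failed, the level would rise from `u` to `v` and stay above its value at `v`
      -- up to `w`. Then level(u) < level(w) = w ≤ u₂ = level(u₂), a contradiction.
      obtain ⟨v, hv1, hv2⟩ := exists_between huw
      have huv : statLevel d β a b u < statLevel d β a b v := by
        have := key _ _ _ h1 hv1 (hlt v hv2)
        rcases lt_max_iff.1 this with h | h
        · exact absurd h hcon.1.not_gt
        · exact h
      have hle : statLevel d β a b v ≤ statLevel d β a b w := by
        refine ge_of_tendsto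
          (((continuous_statLevel (b := b) hβ ha).tendsto w).mono_left nhdsWithin_le_nhds :
            Tendsto _ (𝓝[<] w) _) ?_
        filter_upwards [Ioo_mem_nhdsLT hv2] with v' hv'
        have := key _ _ _ hv1 hv'.1 (hlt v' hv'.2)
        rcases lt_max_iff.1 this with h | h
        · exact absurd h huv.not_gt
        · exact h.le
      have e1 : statLevel d β a b w = w := by rw [statLevel, hmem.1, mul_zero, sub_zero]
      have e2 : statLevel d β a b u₂ = u₂ := by rw [statLevel, hu2, mul_zero, sub_zero]
      linarith [hcon.2]
  · have hu2 : statSlope d β a u₂ = 0 :=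
      le_antisymm (statSlope_nonpos hβ ha u₂) (hu ▸ statSlope_mono hβ ha h2.le)
    refine lt_max_of_lt_right ?_
    rw [statLevel, statLevel, hu, hu2]
    linarith

/-- The infimum over s < 0 need not be attained, but the parameter `u` includes the condensed
branch, and there a coercive continuous level has a minimiser. -/
lemma exists_statLevel_eq_muT (hβ : 0 < β) (hb : 0 < b) (hab : b < a) :
    ∃ u, statLevel d β a b u = muT d β a b ∧ ∀ v, muT d β a b ≤ statLevel d β a b v := by
  have ha : 0 < a := hb.trans hab
  have hc : 0 < (a - b) / b := div_pos (by linarith) hb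
  have hlim : Tendsto (statLevel d β a b) (cocompact ℝ) atTop := by
    rw [cocompact_eq_atBot_atTop]
    refine Tendsto.sup ?_ (tendsto_atTop_mono (le_statLevel hβ hb ha) tendsto_id)
    refine tendsto_atTop_mono (neg_mul_le_statLevel hβ hb ha) ?_
    exact tendsto_neg_atBot_atTop.comp (tendsto_id.const_mul_atBot hc)
  obtain ⟨u, hu⟩ := (continuous_statLevel (d := d) (b := b) hβ ha).exists_forall_le hlim
  have hval : ∀ s : ℝ, s < 0 → a * deriv (idealPressure d β) s - (a - b) / b * s =
      statLevel d β a b (s + a * cycleMoment d β 1 s) := fun s hs => by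
    have h1 := statSlope_eq (d := d) hβ ha hs rfl
    rw [statLevel_of_neg hβ hb ha (h1.symm ▸ hs), h1, deriv_idealPressure hβ hs]
  have hlow : ∀ s : ℝ, s < 0 → statLevel d β a b u ≤
      a * deriv (idealPressure d β) s - (a - b) / b * s := fun s hs => hval s hs ▸ hu _
  have hbdd : BddBelow ((fun s : ℝ => a * deriv (idealPressure d β) s - (a - b) / b * s) ''
      Set.Iio 0) := by
    refine ⟨statLevel d β a b u, ?_⟩
    rintro _ ⟨s, hs, rfl⟩
    exact hlow s hs
  have heq : statLevel d β a b u = muT d β a b := by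
    refine le_antisymm (le_csInf (Set.nonempty_Iio.image _) ?_) ?_
    · rintro _ ⟨s, hs, rfl⟩
      exact hlow s hs
    · rcases (statSlope_nonpos (d := d) hβ ha u).lt_or_eq with h | h
      · refine csInf_le hbdd ⟨statSlope d β a u, h, ?_⟩
        simp only
        rw [deriv_idealPressure hβ h, statLevel_of_neg hβ hb ha h]
      -- For a minimiser on the condensed branch, a p_0'(s) < aϱ_c ≤ u for every s < 0, so letting s
      -- increase to 0 shows that the infimum is at most `u`.
      · have hcr : criticalDensity d β ≤ ((u / a : ℝ) : EReal) := by
          by_contra! h1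
          exact ((statSlope_neg_iff hβ ha).2 h1).ne h
        have hlim2 : Tendsto (fun s : ℝ => u - (a - b) / b * s) (𝓝[<] 0) (𝓝 u) := by
          have : Continuous fun s : ℝ => u - (a - b) / b * s := by fun_prop
          simpa using (this.tendsto 0).mono_left nhdsWithin_le_nhds
        have e : statLevel d β a b u = u := by rw [statLevel, h, mul_zero, sub_zero]
        rw [e]
        refine ge_of_tendsto hlim2 ?_
        filter_upwards [self_mem_nhdsWithin] with s hs
        have hs : s < 0 := hs
        refine (csInf_le hbdd ⟨s, hs, rfl⟩).trans ?_
        have h2 := (cycleMoment_one_lt_criticalDensity (d := d) hβ hs).trans_le hcr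
        rw [EReal.coe_lt_coe_iff, lt_div_iff₀ ha] at h2
        simp only
        rw [deriv_idealPressure hβ hs]
        linarith
  exact ⟨u, heq, fun v => heq ▸ hu v⟩

lemma muT_le_statLevel (hβ : 0 < β) (hb : 0 < b) (hab : b < a) (v : ℝ) :
    muT d β a b ≤ statLevel d β a b v := by
  obtain ⟨u, -, hu⟩ := exists_statLevel_eq_muT (d := d) hβ hb hab
  exact hu v

/-! ### The minimal stationary point -/

/-- The minimal solution `u` of `statLevel d β a b u = μ`, for `μ ≥ μ_t`. -/
noncomputable def minStat (d : ℕ) (β a b μ : ℝ) : ℝ := sInf {u | statLevel d β a b u ≤ μ}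

lemma bddBelow_level (hβ : 0 < β) (hb : 0 < b) (hab : b < a) (μ : ℝ) :
    BddBelow {u | statLevel d β a b u ≤ μ} := by
  have ha : 0 < a := hb.trans hab
  have hc : 0 < (a - b) / b := div_pos (by linarith) hb
  refine ⟨-μ / ((a - b) / b), fun u hu => ?_⟩
  have h1 := (neg_mul_le_statLevel (d := d) hβ hb ha u).trans hu
  rw [div_le_iff₀ hc]
  linarith

lemma minStat_le (hβ : 0 < β) (hb : 0 < b) (hab : b < a) {μ u : ℝ}
    (h : statLevel d β a b u ≤ μ) : minStat d β a b μ ≤ u :=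
  csInf_le (bddBelow_level hβ hb hab μ) h

lemma lt_statLevel_of_lt_minStat (hβ : 0 < β) (hb : 0 < b) (hab : b < a) {μ u : ℝ}
    (h : u < minStat d β a b μ) : μ < statLevel d β a b u := by
  by_contra! hcon
  exact (minStat_le hβ hb hab hcon).not_gt h

/-- The sublevel set is closed, which gives one inequality; the other is continuity from the left,
where the level exceeds `μ`. -/
lemma statLevel_minStat (hβ : 0 < β) (hb : 0 < b) (hab : b < a) {μ : ℝ}
    (hμ : muT d β a b ≤ μ) : statLevel d β a b (minStat d β a b μ) = μ := by
  have ha : 0 < a := hb.trans hab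
  obtain ⟨u, hu, -⟩ := exists_statLevel_eq_muT (d := d) hβ hb hab
  have hc := continuous_statLevel (d := d) (b := b) hβ ha
  have hmem : minStat d β a b μ ∈ {u | statLevel d β a b u ≤ μ} :=
    IsClosed.csInf_mem (isClosed_le hc continuous_const) ⟨u, hu.trans_le hμ⟩
      (bddBelow_level hβ hb hab μ)
  refine le_antisymm hmem ?_
  refine ge_of_tendsto ((hc.tendsto (minStat d β a b μ)).mono_left nhdsWithin_le_nhds :
    Tendsto _ (𝓝[<] (minStat d β a b μ)) _) ?_
  filter_upwards [self_mem_nhdsWithin] with v hv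
  exact (lt_statLevel_of_lt_minStat hβ hb hab hv).le

lemma minStat_anti (hβ : 0 < β) (hb : 0 < b) (hab : b < a) {μ μ' : ℝ}
    (hμ : muT d β a b ≤ μ) (h : μ ≤ μ') : minStat d β a b μ' ≤ minStat d β a b μ :=
  minStat_le hβ hb hab ((statLevel_minStat hβ hb hab hμ).trans_le h)

/-- Substituting `statDensity u` for `x` turns the defining equation into `statLevel u = μ`. The
density increases with `u`, so the minimal `x` belongs to the minimal `u`. -/
lemma xTwo_eq (hβ : 0 < β) (hb : 0 < b) (hab : b < a) {μ : ℝ} (hμ : muT d β a b ≤ μ) :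
    xTwo d β a b μ = statDensity d β a (minStat d β a b μ) := by
  have ha : 0 < a := hb.trans hab
  have hab' : a - b ≠ 0 := by linarith
  have hiff : ∀ u : ℝ, statSlope d β a u = -(b / (a - b)) * (μ - a * statDensity d β a u) ↔
      statLevel d β a b u = μ := fun u => by
    rw [mul_statDensity ha, statLevel]
    constructor
    · intro h
      field_simp at h ⊢
      linarith
    · intro h
      rw [← h]
      field_simp
      ring
  refine IsLeast.csInf_eq ⟨⟨statDensity_pos hβ ha _, ?_⟩, ?_⟩
  · rw [sBeta_statDensity hβ ha, hiff, statLevel_minStat hβ hb hab hμ]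
  · rintro x ⟨hx, hx2⟩
    obtain ⟨u, rfl⟩ := exists_statDensity_eq (d := d) hβ ha hx
    rw [sBeta_statDensity hβ ha, hiff] at hx2
    exact (statDensity_strictMono hβ ha).monotone (minStat_le hβ hb hab hx2.le)

lemma yTwo_eq (hβ : 0 < β) (hb : 0 < b) (hab : b < a) {μ : ℝ} (hμ : muT d β a b ≤ μ) :
    yTwo d β a b μ = (μ - minStat d β a b μ) / a := by
  have ha : 0 < a := hb.trans hab
  have hab' : a - b ≠ 0 := by linarith
  have h := statLevel_minStat hβ hb hab hμ
  rw [yTwo, xTwo_eq hβ hb hab hμ, mul_statDensity ha]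
  rw [statLevel] at h
  set u := minStat d β a b μ
  have hT : statSlope d β a u = b / a * (u - μ) := by
    field_simp at h ⊢
    linarith
  rw [hT]
  field_simp
  ring

lemma sub_mul_yTwo (hβ : 0 < β) (hb : 0 < b) (hab : b < a) {μ : ℝ} (hμ : muT d β a b ≤ μ) :
    μ - a * yTwo d β a b μ = minStat d β a b μ := by
  rw [yTwo_eq hβ hb hab hμ, mul_div_cancel₀ _ (hb.trans hab).ne']
  ring

lemma yTwo_nonneg (hβ : 0 < β) (hb : 0 < b) (hab : b < a) {μ : ℝ} (hμ : muT d β a b ≤ μ) :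
    0 ≤ yTwo d β a b μ := by
  rw [yTwo_eq hβ hb hab hμ]
  have := le_statLevel (d := d) hβ hb (hb.trans hab) (minStat d β a b μ)
  rw [statLevel_minStat hβ hb hab hμ] at this
  exact div_nonneg (by linarith) (hb.trans hab).le

lemma yTwo_mono (hβ : 0 < β) (hb : 0 < b) (hab : b < a) {μ μ' : ℝ}
    (hμ : muT d β a b ≤ μ) (h : μ ≤ μ') : yTwo d β a b μ ≤ yTwo d β a b μ' := by
  rw [yTwo_eq hβ hb hab hμ, yTwo_eq hβ hb hab (hμ.trans h)]
  have := minStat_anti hβ hb hab hμ h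
  have := hb.trans hab
  gcongr

/-- To the left of the minimal stationary point the level function is strictly decreasing. -/
lemma statLevel_lt_of_lt_minStat (hβ : 0 < β) (hb : 0 < b) (hab : b < a) {μ u v : ℝ}
    (hμ : muT d β a b ≤ μ) (huv : u < v) (hv : v < minStat d β a b μ) :
    statLevel d β a b v < statLevel d β a b u := by
  have h := statLevel_lt_max (d := d) hβ hb (hb.trans hab) huv hv
  rw [statLevel_minStat hβ hb hab hμ] at h
  rcases lt_max_iff.1 h with h | h
  · exact h
  · exact absurd (lt_statLevel_of_lt_minStat hβ hb hab hv) h.not_gt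

/-- For u < `minStat μ` the level at `u` is above `μ`. By strict decrease, no ν slightly above μ can
have its minimal stationary point at or left of `u`. -/
lemma tendsto_yTwo_nhdsGE (hβ : 0 < β) (hb : 0 < b) (hab : b < a) {μ : ℝ}
    (hμ : muT d β a b ≤ μ) :
    Tendsto (yTwo d β a b) (𝓝[≥] μ) (𝓝 (yTwo d β a b μ)) := by
  have ha : 0 < a := hb.trans hab
  have hlim : Tendsto (minStat d β a b) (𝓝[≥] μ) (𝓝 (minStat d β a b μ)) := by
    rw [tendsto_order]
    constructor
    · intro u hu
      filter_upwards [self_mem_nhdsWithin, nhdsWithin_le_nhds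
        (gt_mem_nhds (lt_statLevel_of_lt_minStat hβ hb hab hu))] with ν hν1 hν2
      by_contra! hcon
      have hν1 : μ ≤ ν := hν1
      have h1 := statLevel_minStat hβ hb hab (hμ.trans hν1)
      rcases hcon.lt_or_eq with h | h
      · have := statLevel_lt_of_lt_minStat hβ hb hab hμ h hu
        linarith
      · rw [h] at h1
        linarith
    · intro u hu
      filter_upwards [self_mem_nhdsWithin] with ν hν
      exact (minStat_anti hβ hb hab hμ hν).trans_lt hu
  have h2 : Tendsto (fun ν => (ν - minStat d β a b ν) / a) (𝓝[≥] μ)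
      (𝓝 ((μ - minStat d β a b μ) / a)) :=
    ((tendsto_id.mono_left nhdsWithin_le_nhds).sub hlim).div_const a
  rw [yTwo_eq hβ hb hab hμ]
  refine h2.congr' ?_
  filter_upwards [self_mem_nhdsWithin] with ν hν
  exact (yTwo_eq hβ hb hab (hμ.trans hν)).symm

/-! ### Monotonicity of the gap in the long-cycle density -/

lemma energyGap_lt_of_level_gt (hd : 1 ≤ d) (hβ : 0 < β) (hb : 0 < b) (hab : b < a) {μ y₁ y₂ : ℝ}
    (hy : y₁ < y₂) (h : ∀ y ∈ Set.Ioo y₁ y₂, μ < statLevel d β a b (μ - a * y)) :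
    energyGap d β a b μ y₁ < energyGap d β a b μ y₂ := by
  have ha : 0 < a := hb.trans hab
  refine strictMonoOn_of_deriv_pos (convex_Icc y₁ y₂)
    (continuous_energyGap_right hd hβ ha μ).continuousOn (fun y hy' => ?_)
    (Set.left_mem_Icc.2 hy.le) (Set.right_mem_Icc.2 hy.le) hy
  rw [interior_Icc] at hy'
  rw [(hasDerivAt_energyGap_right hd hβ ha hb μ y).deriv]
  have := h y hy'
  exact mul_pos (div_pos hb ha) (by linarith)

lemma energyGap_lt_of_level_lt (hd : 1 ≤ d) (hβ : 0 < β) (hb : 0 < b) (hab : b < a) {μ y₁ y₂ : ℝ}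
    (hy : y₁ < y₂) (h : ∀ y ∈ Set.Ioo y₁ y₂, statLevel d β a b (μ - a * y) < μ) :
    energyGap d β a b μ y₂ < energyGap d β a b μ y₁ := by
  have ha : 0 < a := hb.trans hab
  refine strictAntiOn_of_deriv_neg (convex_Icc y₁ y₂)
    (continuous_energyGap_right hd hβ ha μ).continuousOn (fun y hy' => ?_)
    (Set.left_mem_Icc.2 hy.le) (Set.right_mem_Icc.2 hy.le) hy
  rw [interior_Icc] at hy'
  rw [(hasDerivAt_energyGap_right hd hβ ha hb μ y).deriv]
  have := h y hy'
  exact mul_neg_of_pos_of_neg (div_pos hb ha) (by linarith)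

lemma energyGap_lt_of_yTwo_le (hd : 1 ≤ d) (hβ : 0 < β) (hb : 0 < b) (hab : b < a) {μ y₁ y₂ : ℝ}
    (hμ : muT d β a b ≤ μ) (h1 : yTwo d β a b μ ≤ y₁) (h2 : y₁ < y₂) :
    energyGap d β a b μ y₁ < energyGap d β a b μ y₂ := by
  have ha : 0 < a := hb.trans hab
  refine energyGap_lt_of_level_gt hd hβ hb hab h2 fun y hy => ?_
  refine lt_statLevel_of_lt_minStat hβ hb hab ?_
  rw [← sub_mul_yTwo hβ hb hab hμ]
  have := mul_lt_mul_of_pos_left (h1.trans_lt hy.1) ha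
  linarith

/-- Only 0 and ỹ₂ can minimise. To the left of ỹ₂, look at the sign of the derivative at `y`: if it
is nonpositive, quasiconvexity makes the gap fall from `y` to ỹ₂; if positive, the gap has been
rising since 0. To the right of ỹ₂ the gap rises. -/
lemma energyGap_trichotomy (hd : 1 ≤ d) (hβ : 0 < β) (hb : 0 < b) (hab : b < a) {μ y : ℝ}
    (hμ : muT d β a b ≤ μ) (hy : 0 ≤ y) (hne : y ≠ yTwo d β a b μ) :
    y = 0 ∨ 0 < energyGap d β a b μ y ∨
      energyGap d β a b μ (yTwo d β a b μ) < energyGap d β a b μ y := by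
  have ha : 0 < a := hb.trans hab
  rcases hne.lt_or_gt with h | h
  · have hu : minStat d β a b μ < μ - a * y := by
      rw [← sub_mul_yTwo hβ hb hab hμ]
      have := mul_lt_mul_of_pos_left h ha
      linarith
    have hm := statLevel_minStat hβ hb hab hμ
    rcases le_or_gt (statLevel d β a b (μ - a * y)) μ with h1 | h1
    · right; right
      refine energyGap_lt_of_level_lt hd hβ hb hab h fun z hz => ?_
      have h2 : minStat d β a b μ < μ - a * z := by
        rw [← sub_mul_yTwo hβ hb hab hμ]
        have := mul_lt_mul_of_pos_left hz.2 ha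
        linarith
      have h3 : μ - a * z < μ - a * y := by
        have := mul_lt_mul_of_pos_left hz.1 ha
        linarith
      have := statLevel_lt_max (d := d) hβ hb ha h2 h3
      rwa [hm, max_eq_left h1] at this
    · rcases hy.eq_or_lt with h0 | h0
      · exact Or.inl h0.symm
      · right; left
        rw [← energyGap_zero (d := d) (β := β) (a := a) (b := b) μ]
        refine energyGap_lt_of_level_gt hd hβ hb hab h0 fun z hz => ?_
        have h3 : μ - a * y < μ - a * z := by
          have := mul_lt_mul_of_pos_left hz.2 ha
          linarith
        have := statLevel_lt_max (d := d) hβ hb ha hu h3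
        rw [hm] at this
        rcases lt_max_iff.1 this with h | h
        · exact absurd h1 h.not_gt
        · exact h1.trans h
  · exact Or.inr (Or.inr (energyGap_lt_of_yTwo_le hd hβ hb hab hμ le_rfl h))

end Reduced

/-! ### Zeroes of the rate function and the transition -/

section Transition

variable {d : ℕ} {β a b : ℝ}

/-- `y` is a possible value of the long-cycle density for the parameter `κ`. -/
def IsLongDensity (κ : ℝ≥0∞) (y : ℝ) : Prop := 0 ≤ y ∧ (y = 0 ∨ κ ≤ ENNReal.ofReal y)

/-- `y` is the long-cycle density of the unique zero of the rate function. -/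
def IsEquilibrium (d : ℕ) (β a b : ℝ) (κ : ℝ≥0∞) (μ y : ℝ) : Prop :=
  IsLongDensity κ y ∧
    ∀ z, IsLongDensity κ z → z ≠ y → energyGap d β a b μ y < energyGap d β a b μ z

lemma isLongDensity_zero (κ : ℝ≥0∞) : IsLongDensity κ 0 := ⟨le_rfl, Or.inl rfl⟩

lemma isLongDensity_zero_iff {y : ℝ} : IsLongDensity 0 y ↔ 0 ≤ y := by simp [IsLongDensity]

lemma isLongDensity_top_iff {y : ℝ} : IsLongDensity ⊤ y ↔ y = 0 := by
  constructor
  · rintro ⟨-, h | h⟩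
    · exact h
    · exact absurd h (by simp)
  · rintro rfl
    exact isLongDensity_zero _

lemma isLongDensity_ofReal_iff {κ y : ℝ} (hκ : 0 < κ) :
    IsLongDensity (ENNReal.ofReal κ) y ↔ y = 0 ∨ κ ≤ y := by
  constructor
  · rintro ⟨h0, h | h⟩
    · exact Or.inl h
    · exact Or.inr ((ENNReal.ofReal_le_ofReal_iff h0).1 h)
  · rintro (rfl | h)
    · exact isLongDensity_zero _
    · exact ⟨hκ.le.trans h, Or.inr (ENNReal.ofReal_le_ofReal h)⟩

/-! ### Zeroes of the rate function as minimisers of the gap -/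

lemma mem_rateDomain {κ : ℝ≥0∞} {x y : ℝ} :
    (x, y) ∈ rateDomain κ ↔ 0 ≤ x ∧ IsLongDensity κ y := Iff.rfl

/-- The leftover square in x forces `x = statDensity (μ - a * y)` at a zero, so the zero set is a
graph over the set `Y` of minimising long densities. -/
lemma rateZeroes_eq_image (hd : 1 ≤ d) (hβ : 0 < β) (ha : 0 < a) {κ : ℝ≥0∞} {μ c : ℝ} {Y : Set ℝ}
    (hne : Y.Nonempty) (hY : ∀ y ∈ Y, IsLongDensity κ y ∧ energyGap d β a b μ y = c)
    (hlt : ∀ y, IsLongDensity κ y → y ∉ Y → c < energyGap d β a b μ y) :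
    rateZeroes d β a b κ μ = (fun y => (statDensity d β a (μ - a * y), y)) '' Y := by
  have hle : ∀ y, IsLongDensity κ y → c ≤ energyGap d β a b μ y := fun y hy => by
    by_cases h : y ∈ Y
    · exact (hY y h).2.ge
    · exact (hlt y hy h).le
  have hp : pressure d β a b κ μ = meanFieldPressure d β a μ - c := by
    obtain ⟨y, hy⟩ := hne
    refine IsGreatest.csSup_eq ⟨⟨(statDensity d β a (μ - a * y), y),
      mem_rateDomain.2 ⟨(statDensity_pos hβ ha _).le, (hY y hy).1⟩, ?_⟩, ?_⟩
    · simp only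
      rw [freeEnergyFunctional_eq_energyGap hd hβ ha, (hY y hy).2]
      ring
    · rintro _ ⟨⟨x, y⟩, hz, rfl⟩
      rw [mem_rateDomain] at hz
      have h1 := le_freeEnergyFunctional_energyGap (d := d) (b := b) hβ ha μ y hz.1
      have h2 := hle y hz.2
      have h3 : 0 ≤ a / 2 * (x - statDensity d β a (μ - a * y)) ^ 2 := by positivity
      simp only
      linarith
  ext ⟨x, y⟩
  rw [rateZeroes, Set.mem_ofPred_eq, rateFunction]
  constructor
  · intro h
    split_ifs at h with hz
    · rw [mem_rateDomain] at hz
      rw [EReal.coe_eq_zero, hp] at h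
      have h1 := le_freeEnergyFunctional_energyGap (d := d) (b := b) hβ ha μ y hz.1
      have h2 := hle y hz.2
      have h3 : 0 ≤ a / 2 * (x - statDensity d β a (μ - a * y)) ^ 2 := by positivity
      have hyY : y ∈ Y := by
        by_contra hcon
        linarith [hlt y hz.2 hcon]
      have h4 : a / 2 * (x - statDensity d β a (μ - a * y)) ^ 2 = 0 := by linarith
      have h5 : x - statDensity d β a (μ - a * y) = 0 := by
        rcases mul_eq_zero.1 h4 with h | h
        · linarith
        · exact pow_eq_zero_iff two_ne_zero |>.1 h
      exact ⟨y, hyY, by simp only [Prod.mk.injEq, and_true]; linarith⟩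
    · exact absurd h (by simp)
  · rintro ⟨z, hz, heq⟩
    obtain ⟨rfl, rfl⟩ := Prod.mk.inj heq
    rw [if_pos (mem_rateDomain.2 ⟨(statDensity_pos hβ ha _).le, (hY z hz).1⟩),
      freeEnergyFunctional_eq_energyGap hd hβ ha, hp, (hY z hz).2]
    simp

lemma IsEquilibrium.rateZeroes_eq (hd : 1 ≤ d) (hβ : 0 < β) (ha : 0 < a) {κ : ℝ≥0∞} {μ y : ℝ}
    (h : IsEquilibrium d β a b κ μ y) :
    rateZeroes d β a b κ μ = {(statDensity d β a (μ - a * y), y)} := by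
  rw [rateZeroes_eq_image hd hβ ha (Y := {y}) (c := energyGap d β a b μ y)
    (Set.singleton_nonempty y) (by rintro z rfl; exact ⟨h.1, rfl⟩) (fun z hz hne => h.2 z hz hne),
    Set.image_singleton]

lemma isEquilibrium_top (d : ℕ) (β a b μ : ℝ) : IsEquilibrium d β a b ⊤ μ 0 :=
  ⟨isLongDensity_zero _, fun _ hz hne => absurd (isLongDensity_top_iff.1 hz) hne⟩

/-! ### The transition potential -/

/-- The infimum of the `μ` at which some long-cycle density `y ≥ κ` beats `0`. -/
noncomputable def transitionPotential (d : ℕ) (β a b κ : ℝ) : ℝ :=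
  sInf {μ | ∃ y, 0 < y ∧ κ ≤ y ∧ energyGap d β a b μ y < 0}

/-- Below μ_t the level exceeds μ everywhere, so the gap increases strictly from its value 0 at y =
0. -/
lemma bddBelow_transition (hd : 1 ≤ d) (hβ : 0 < β) (hb : 0 < b) (hab : b < a) (κ : ℝ) :
    muT d β a b ∈ lowerBounds {μ | ∃ y, 0 < y ∧ κ ≤ y ∧ energyGap d β a b μ y < 0} := by
  rintro μ ⟨y, hy, -, h⟩
  by_contra! hcon
  have := energyGap_lt_of_level_gt (d := d) (μ := μ) hd hβ hb hab hy fun z _ =>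
    hcon.trans_le (muT_le_statLevel hβ hb hab _)
  rw [energyGap_zero] at this
  exact h.not_gt this

lemma nonempty_transition (hd : 1 ≤ d) (hβ : 0 < β) (hb : 0 < b) (hab : b < a) {κ : ℝ}
    (hκ : 0 ≤ κ) : {μ | ∃ y, 0 < y ∧ κ ≤ y ∧ energyGap d β a b μ y < 0}.Nonempty := by
  obtain ⟨μ, y, h⟩ := exists_energyGap_neg (d := d) hd hβ hb hab hκ
  exact ⟨μ, y, h⟩

lemma muT_le_transitionPotential (hd : 1 ≤ d) (hβ : 0 < β) (hb : 0 < b) (hab : b < a) {κ : ℝ}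
    (hκ : 0 ≤ κ) : muT d β a b ≤ transitionPotential d β a b κ :=
  le_csInf (nonempty_transition hd hβ hb hab hκ) (bddBelow_transition hd hβ hb hab κ)

lemma transitionPotential_le (hd : 1 ≤ d) (hβ : 0 < β) (hb : 0 < b) (hab : b < a) {κ μ y : ℝ}
    (hy : 0 < y) (hκ : κ ≤ y) (h : energyGap d β a b μ y < 0) :
    transitionPotential d β a b κ ≤ μ :=
  csInf_le ⟨_, bddBelow_transition hd hβ hb hab κ⟩ ⟨y, hy, hκ, h⟩

/-- A nonpositive gap at μ would become strictly negative at some ν still below the transition,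
contradicting the infimum. -/
lemma energyGap_pos_of_lt_transition (hd : 1 ≤ d) (hβ : 0 < β) (hb : 0 < b) (hab : b < a)
    {κ μ y : ℝ} (hμ : μ < transitionPotential d β a b κ) (hy : 0 < y) (hκ : κ ≤ y) :
    0 < energyGap d β a b μ y := by
  by_contra! hcon
  obtain ⟨ν, h1, h2⟩ := exists_between hμ
  exact (transitionPotential_le hd hβ hb hab hy hκ
    (energyGap_neg_of_lt hd hβ (hb.trans hab) hb hy hcon h1)).not_gt h2

lemma energyGap_nonneg_transition (hd : 1 ≤ d) (hβ : 0 < β) (hb : 0 < b) (hab : b < a)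
    {κ y : ℝ} (hy : 0 < y) (hκ : κ ≤ y) :
    0 ≤ energyGap d β a b (transitionPotential d β a b κ) y := by
  refine ge_of_tendsto (((continuous_energyGap_left hd hβ (hb.trans hab) y).tendsto
    (transitionPotential d β a b κ)).mono_left nhdsWithin_le_nhds :
    Tendsto _ (𝓝[<] (transitionPotential d β a b κ)) _) ?_
  filter_upwards [self_mem_nhdsWithin] with ν hν
  exact (energyGap_pos_of_lt_transition hd hβ hb hab hν hy hκ).le

lemma exists_energyGap_neg_of_transition_lt (hd : 1 ≤ d) (hβ : 0 < β) (hb : 0 < b) (hab : b < a)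
    {κ μ : ℝ} (hκ : 0 ≤ κ) (hμ : transitionPotential d β a b κ < μ) :
    ∃ y, 0 < y ∧ κ ≤ y ∧ energyGap d β a b μ y < 0 := by
  obtain ⟨ν, ⟨y, hy, hκy, h⟩, hν⟩ :=
    exists_lt_of_csInf_lt (nonempty_transition hd hβ hb hab hκ) hμ
  exact ⟨y, hy, hκy, (energyGap_anti hd hβ (hb.trans hab) hy.le hν.le).trans_lt h⟩

/-! ### The case `κ = 0` -/

lemma isEquilibrium_zero_of_lt (hd : 1 ≤ d) (hβ : 0 < β) (hb : 0 < b) (hab : b < a) {μ : ℝ}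
    (hμ : μ < transitionPotential d β a b 0) : IsEquilibrium d β a b 0 μ 0 := by
  refine ⟨isLongDensity_zero _, fun z hz hne => ?_⟩
  rw [energyGap_zero]
  exact energyGap_pos_of_lt_transition hd hβ hb hab hμ (lt_of_le_of_ne hz.1 hne.symm) hz.1

lemma energyGap_yTwo_neg (hd : 1 ≤ d) (hβ : 0 < β) (hb : 0 < b) (hab : b < a) {μ : ℝ}
    (hμ : transitionPotential d β a b 0 < μ) :
    energyGap d β a b μ (yTwo d β a b μ) < 0 := by
  obtain ⟨y, hy, -, h⟩ := exists_energyGap_neg_of_transition_lt hd hβ hb hab le_rfl hμ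
  by_cases hne : y = yTwo d β a b μ
  · rwa [← hne]
  · have hμt := (muT_le_transitionPotential (d := d) hd hβ hb hab le_rfl).trans hμ.le
    rcases energyGap_trichotomy hd hβ hb hab hμt hy.le hne with h1 | h1 | h1
    · exact absurd h1 hy.ne'
    · exact absurd h h1.not_gt
    · exact h1.trans h

lemma energyGap_yTwo_lt (hd : 1 ≤ d) (hβ : 0 < β) (hb : 0 < b) (hab : b < a) {μ y : ℝ}
    (hμ : transitionPotential d β a b 0 < μ) (hy : 0 ≤ y) (hne : y ≠ yTwo d β a b μ) :
    energyGap d β a b μ (yTwo d β a b μ) < energyGap d β a b μ y := by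
  have hμt := (muT_le_transitionPotential (d := d) hd hβ hb hab le_rfl).trans hμ.le
  have hneg := energyGap_yTwo_neg hd hβ hb hab hμ
  rcases energyGap_trichotomy hd hβ hb hab hμt hy hne with h1 | h1 | h1
  · rwa [h1, energyGap_zero]
  · exact hneg.trans h1
  · exact h1

lemma isEquilibrium_zero_of_gt (hd : 1 ≤ d) (hβ : 0 < β) (hb : 0 < b) (hab : b < a) {μ : ℝ}
    (hμ : transitionPotential d β a b 0 < μ) : IsEquilibrium d β a b 0 μ (yTwo d β a b μ) := by
  have hμt := (muT_le_transitionPotential (d := d) hd hβ hb hab le_rfl).trans hμ.le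
  exact ⟨isLongDensity_zero_iff.2 (yTwo_nonneg hβ hb hab hμt),
    fun z hz hne => energyGap_yTwo_lt hd hβ hb hab hμ hz.1 hne⟩

/-- Nonpositive as a limit from the right, by right-continuity of ỹ₂, and nonnegative as a limit
from the left at fixed `y`. -/
lemma energyGap_yTwo_transition (hd : 1 ≤ d) (hβ : 0 < β) (hb : 0 < b) (hab : b < a) :
    energyGap d β a b (transitionPotential d β a b 0)
      (yTwo d β a b (transitionPotential d β a b 0)) = 0 := by
  set μs := transitionPotential d β a b 0 with hμs
  have hμt := muT_le_transitionPotential (d := d) hd hβ hb hab le_rfl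
  refine le_antisymm ?_ ?_
  · have h1 := (tendsto_yTwo_nhdsGE (d := d) hβ hb hab hμt).mono_left
      (nhdsWithin_mono _ Set.Ioi_subset_Ici_self : 𝓝[>] μs ≤ _)
    have h2 : Tendsto (fun μ : ℝ => (μ, yTwo d β a b μ)) (𝓝[>] μs) (𝓝 (μs, yTwo d β a b μs)) :=
      (tendsto_id.mono_left nhdsWithin_le_nhds).prodMk_nhds h1
    have h3 := ((continuous_energyGap (d := d) (b := b) hd hβ (hb.trans hab)).tendsto _).comp h2
    refine le_of_tendsto h3 ?_
    filter_upwards [self_mem_nhdsWithin] with μ hμ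
    exact (energyGap_yTwo_neg hd hβ hb hab hμ).le
  · rcases (yTwo_nonneg (d := d) hβ hb hab hμt).eq_or_lt with h | h
    · rw [← h, energyGap_zero]
    · exact energyGap_nonneg_transition hd hβ hb hab h h.le

lemma energyGap_pos_transition (hd : 1 ≤ d) (hβ : 0 < β) (hb : 0 < b) (hab : b < a) {y : ℝ}
    (hy : 0 < y) (hne : y ≠ yTwo d β a b (transitionPotential d β a b 0)) :
    0 < energyGap d β a b (transitionPotential d β a b 0) y := by
  have hμt := muT_le_transitionPotential (d := d) hd hβ hb hab le_rfl
  rcases energyGap_trichotomy hd hβ hb hab hμt hy.le hne with h1 | h1 | h1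
  · exact absurd h1 hy.ne'
  · exact h1
  · rwa [energyGap_yTwo_transition hd hβ hb hab] at h1

lemma isEquilibrium_zero_transition (hd : 1 ≤ d) (hβ : 0 < β) (hb : 0 < b) (hab : b < a)
    (h0 : yTwo d β a b (transitionPotential d β a b 0) = 0) :
    IsEquilibrium d β a b 0 (transitionPotential d β a b 0) 0 := by
  refine ⟨isLongDensity_zero _, fun z hz hne => ?_⟩
  rw [energyGap_zero]
  exact energyGap_pos_transition hd hβ hb hab (lt_of_le_of_ne hz.1 hne.symm) (by rwa [h0])

/-! ### The bound by μ_c and the degenerate transition -/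

lemma muC_le_iff (hβ : 0 < β) (ha : 0 < a) {u : ℝ} :
    muC d β a ≤ (u : EReal) ↔ statSlope d β a u = 0 := by
  have h1 : muC d β a ≤ (u : EReal) ↔ criticalDensity d β ≤ ((u / a : ℝ) : EReal) := by
    rw [muC]
    by_cases hd : 3 ≤ d
    · rw [criticalDensity_of_three_le hd, ← EReal.coe_mul, EReal.coe_le_coe_iff,
        EReal.coe_le_coe_iff, le_div_iff₀ ha, mul_comm]
    · rw [criticalDensity_of_not_three_le hd, EReal.coe_mul_top_of_pos ha, top_le_iff, top_le_iff]
      simp only [EReal.coe_ne_top]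
  rw [h1]
  refine ⟨statSlope_of_le, fun h => ?_⟩
  by_contra! h2
  exact ((statSlope_neg_iff hβ ha).2 h2).ne h

lemma transitionPotential_le_muC (hd : 1 ≤ d) (hβ : 0 < β) (hb : 0 < b) (hab : b < a) :
    ((transitionPotential d β a b 0 : ℝ) : EReal) ≤ muC d β a := by
  have ha : 0 < a := hb.trans hab
  by_contra! hcon
  obtain ⟨u, h1, h2⟩ := EReal.lt_iff_exists_real_btwn.1 hcon
  rw [EReal.coe_lt_coe_iff] at h2
  obtain ⟨ν, h3, h4⟩ := exists_between h2
  have hT := (muC_le_iff (d := d) hβ ha).1 h1.le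
  -- This `y` moves ν down to `u`, which is still condensed, so the gap equals -(b/2)y² although ν
  -- lies below the transition.
  have hy : 0 < (ν - u) / a := div_pos (by linarith) ha
  have e : ν - a * ((ν - u) / a) = u := by rw [mul_div_cancel₀ _ ha.ne']; ring
  have h5 := energyGap_of_statSlope_eq_zero (d := d) (b := b) hβ ha hy.le (e.symm ▸ hT)
  have h6 := energyGap_pos_of_lt_transition hd hβ hb hab h4 hy hy.le
  have : 0 < b / 2 * ((ν - u) / a) ^ 2 := by positivity
  linarith

lemma transitionPotential_eq_muC_iff (hd : 1 ≤ d) (hβ : 0 < β) (hb : 0 < b) (hab : b < a) :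
    ((transitionPotential d β a b 0 : ℝ) : EReal) = muC d β a ↔
      statSlope d β a (transitionPotential d β a b 0) = 0 := by
  rw [← muC_le_iff hβ (hb.trans hab)]
  exact ⟨fun h => h.ge, fun h => le_antisymm (transitionPotential_le_muC hd hβ hb hab) h⟩

lemma statSlope_eq_zero_of_yTwo (hβ : 0 < β) (hb : 0 < b) (hab : b < a) {μ : ℝ}
    (hμ : muT d β a b ≤ μ) (h : yTwo d β a b μ = 0) : statSlope d β a μ = 0 := by
  have h1 := sub_mul_yTwo hβ hb hab hμ
  have h2 := statLevel_minStat hβ hb hab hμ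
  rw [h, mul_zero, sub_zero] at h1
  rw [← h1, statLevel] at h2
  have h3 : a / b * statSlope d β a μ = 0 := by linarith
  rcases mul_eq_zero.1 h3 with h | h
  · exact absurd h (div_pos (hb.trans hab) hb).ne'
  · exact h

/-- If the slope vanishes at μ^* then the level equals μ^* there as well as at `minStat`.
Quasiconvexity makes the gap strictly decrease between 0 and a positive ỹ₂, although it is 0 at both
ends. -/
lemma yTwo_transition_eq_zero_iff (hd : 1 ≤ d) (hβ : 0 < β) (hb : 0 < b) (hab : b < a) :
    yTwo d β a b (transitionPotential d β a b 0) = 0 ↔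
      statSlope d β a (transitionPotential d β a b 0) = 0 := by
  have hμt := muT_le_transitionPotential (d := d) hd hβ hb hab le_rfl
  refine ⟨statSlope_eq_zero_of_yTwo hβ hb hab hμt, fun h => ?_⟩
  by_contra hne
  set μs := transitionPotential d β a b 0
  have ha : 0 < a := hb.trans hab
  have hpos := lt_of_le_of_ne (yTwo_nonneg (d := d) hβ hb hab hμt) (Ne.symm hne)
  have h0 := energyGap_yTwo_transition (d := d) hd hβ hb hab
  have h1 : energyGap d β a b μs (yTwo d β a b μs) < energyGap d β a b μs 0 := by
    refine energyGap_lt_of_level_lt hd hβ hb hab hpos fun z hz => ?_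
    have e1 : minStat d β a b μs < μs - a * z := by
      rw [← sub_mul_yTwo hβ hb hab hμt]
      have := mul_lt_mul_of_pos_left hz.2 ha
      linarith
    have e2 : μs - a * z < μs := by
      have := mul_pos ha hz.1
      linarith
    have := statLevel_lt_max (d := d) hβ hb ha e1 e2
    have e3 : statLevel d β a b μs = μs := by rw [statLevel, h, mul_zero, sub_zero]
    rwa [statLevel_minStat hβ hb hab hμt, e3, max_self] at this
  rw [h0, energyGap_zero] at h1
  exact h1.false

theorem isTransitionZero_transitionPotential (hd : 1 ≤ d) (hβ : 0 < β) (hb : 0 < b)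
    (hab : b < a) : IsTransitionZero d β a b (transitionPotential d β a b 0) := by
  have ha : 0 < a := hb.trans hab
  have hμt := muT_le_transitionPotential (d := d) hd hβ hb hab le_rfl
  refine ⟨hμt, transitionPotential_le_muC hd hβ hb hab, fun μ => ⟨fun h => ?_, ?_, fun h => ?_⟩⟩
  · rw [(isEquilibrium_zero_of_lt hd hβ hb hab h).rateZeroes_eq hd hβ ha, xOne_eq hβ ha, mul_zero,
      sub_zero]
  · rintro rfl
    set μs := transitionPotential d β a b 0
    rw [rateZeroes_eq_image hd hβ ha (Y := {0, yTwo d β a b μs}) (c := 0)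
      (Set.insert_nonempty _ _), Set.image_pair, sub_mul_yTwo hβ hb hab hμt, xOne_eq hβ ha,
      xTwo_eq hβ hb hab hμt, mul_zero, sub_zero]
    · rintro y (rfl | rfl)
      · exact ⟨isLongDensity_zero _, energyGap_zero _⟩
      · exact ⟨isLongDensity_zero_iff.2 (yTwo_nonneg hβ hb hab hμt),
          energyGap_yTwo_transition hd hβ hb hab⟩
    · intro y hy hne
      simp only [Set.mem_insert_iff, Set.mem_singleton_iff, not_or] at hne
      exact energyGap_pos_transition hd hβ hb hab (lt_of_le_of_ne hy.1 (Ne.symm hne.1)) hne.2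
  · have hμt' := hμt.trans h.le
    rw [(isEquilibrium_zero_of_gt hd hβ hb hab h).rateZeroes_eq hd hβ ha,
      sub_mul_yTwo hβ hb hab hμt', xTwo_eq hβ hb hab hμt']

/-! ### The second derivative of the pressure at zero -/

/-- The second derivative increases on s < 0, so its limit at 0 is its supremum. -/
lemma idealPressureSecondAtZero_le_iff (hβ : 0 < β) {c : ℝ} :
    idealPressureSecondAtZero d β ≤ (c : EReal) ↔ ∀ s < 0, β * cycleMoment d β 2 s ≤ c := by
  rw [idealPressureSecondAtZero]
  constructor
  · intro h s hs
    refine le_of_forall_gt_imp_ge_of_dense fun c' hc' => ?_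
    have h1 := eventually_lt_of_limsup_lt (h.trans_lt (EReal.coe_lt_coe_iff.2 hc'))
    obtain ⟨t, h2, h3⟩ := (h1.and (Ioo_mem_nhdsLT hs)).exists
    rw [iteratedDeriv_two_idealPressure hβ h3.2, EReal.coe_lt_coe_iff] at h2
    have h4 := strictMonoOn_cycleMoment (d := d) hβ 2 hs h3.2 h3.1
    have := mul_lt_mul_of_pos_left h4 hβ
    linarith
  · intro h
    refine limsup_le_of_le (by isBoundedDefault) ?_
    filter_upwards [self_mem_nhdsWithin] with s hs
    rw [iteratedDeriv_two_idealPressure hβ hs]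
    exact EReal.coe_le_coe_iff.2 (h s hs)

lemma hasDerivAt_level (hβ : 0 < β) (c : ℝ) {s : ℝ} (hs : s < 0) :
    HasDerivAt (fun s => a * cycleMoment d β 1 s - c * s)
      (a * (β * cycleMoment d β 2 s) - c) s := by
  have h : HasDerivAt (fun s : ℝ => c * s) c s := by
    simpa using (hasDerivAt_id s).const_mul c
  exact ((hasDerivAt_cycleMoment (d := d) hβ 1 hs).const_mul a).sub h

/-- The condition says that the level, as a function of the slope, is nonincreasing up to s = 0. If
it fails, the level dips just before condensation and a small y > 0 beats 0 at μ_c. If it holds and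
the slope at μ^* were negative, the level would be at most μ^* there, contradicting level = μ^* -
(a/b)·slope. -/
theorem transitionPotential_eq_muC_iff_second (hd : 1 ≤ d) (hβ : 0 < β) (hb : 0 < b)
    (hab : b < a) : ((transitionPotential d β a b 0 : ℝ) : EReal) = muC d β a ↔
      idealPressureSecondAtZero d β ≤ (((a - b) / (a * b) : ℝ) : EReal) := by
  have ha : 0 < a := hb.trans hab
  have hμt := muT_le_transitionPotential (d := d) hd hβ hb hab le_rfl
  rw [idealPressureSecondAtZero_le_iff hβ, transitionPotential_eq_muC_iff hd hβ hb hab]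
  have hconv : ∀ x : ℝ, x ≤ (a - b) / (a * b) ↔ a * x - (a - b) / b ≤ 0 := fun x => by
    rw [sub_nonpos, le_div_iff₀ (mul_pos ha hb), le_div_iff₀ hb]
    constructor <;> intro h <;> linarith
  simp only [hconv]
  constructor
  · intro h0
    by_contra! hcon
    obtain ⟨s₀, hs0, hs1⟩ := hcon
    have heq := (transitionPotential_eq_muC_iff hd hβ hb hab).2 h0
    have hnonneg : ∀ y, 0 < y → 0 ≤ energyGap d β a b (transitionPotential d β a b 0) y :=
      fun y hy => energyGap_nonneg_transition hd hβ hb hab hy hy.le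
    set μs := transitionPotential d β a b 0
    have hneg : ∀ u, u < μs → statSlope d β a u < 0 := fun u hu => by
      refine lt_of_le_of_ne (statSlope_nonpos hβ ha u) fun h => ?_
      rw [← muC_le_iff hβ ha, ← heq, EReal.coe_le_coe_iff] at h
      exact h.not_gt hu
    set u₀ := s₀ + a * cycleMoment d β 1 s₀ with hu0
    have hT0 : statSlope d β a u₀ = s₀ := statSlope_eq hβ ha hs0 rfl
    have huμ : u₀ < μs := by
      by_contra! hc
      have := statSlope_mono (d := d) hβ ha hc
      rw [h0, hT0] at this
      linarith
    have hmono : StrictMonoOn (fun s => a * cycleMoment d β 1 s - (a - b) / b * s)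
        (Set.Ico s₀ 0) := by
      refine strictMonoOn_of_deriv_pos (convex_Ico _ _)
        (fun s hs => (hasDerivAt_level hβ _ hs.2).continuousAt.continuousWithinAt) fun s hs => ?_
      rw [interior_Ico] at hs
      rw [(hasDerivAt_level hβ _ hs.2).deriv]
      have := strictMonoOn_cycleMoment (d := d) hβ 2 hs0 hs.2 hs.1
      have := mul_lt_mul_of_pos_left (mul_lt_mul_of_pos_left this hβ) ha
      linarith
    have hμlev : statLevel d β a b μs = μs := by rw [statLevel, h0, mul_zero, sub_zero]
    -- The level increases along slopes in [s₀, 0); let the parameter tend to μ^* from below, where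
    -- the level takes the value μ^*.
    have hle : statLevel d β a b u₀ ≤ μs := by
      rw [← hμlev]
      refine ge_of_tendsto
        (((continuous_statLevel (b := b) hβ ha).tendsto μs).mono_left nhdsWithin_le_nhds :
          Tendsto _ (𝓝[<] μs) _) ?_
      filter_upwards [Ioo_mem_nhdsLT huμ] with v hv
      have h1 := hneg v hv.2
      have h2 := statSlope_lt (d := d) hβ ha hv.1 (hT0.symm ▸ hs0)
      rw [statLevel_of_neg hβ hb ha h1, statLevel_of_neg hβ hb ha (hneg _ huμ)]
      rw [hT0] at h2 ⊢
      exact (hmono ⟨le_rfl, hs0⟩ ⟨h2.le, h1⟩ h2).le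
    have hy : 0 < (μs - u₀) / a := div_pos (by linarith) ha
    have hlt : energyGap d β a b μs ((μs - u₀) / a) < energyGap d β a b μs 0 := by
      refine energyGap_lt_of_level_lt hd hβ hb hab hy fun z hz => ?_
      have e1 : u₀ < μs - a * z := by
        have := (lt_div_iff₀ ha).1 hz.2
        linarith
      have e2 : μs - a * z < μs := by
        have := mul_pos ha hz.1
        linarith
      have := statLevel_lt_max (d := d) hβ hb ha e1 e2
      rwa [hμlev, max_eq_right hle] at this
    rw [energyGap_zero] at hlt
    exact (hnonneg _ hy).not_gt hlt
  · intro h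
    set μs := transitionPotential d β a b 0
    by_contra hne
    have hneg := lt_of_le_of_ne (statSlope_nonpos (d := d) hβ ha μs) hne
    have hanti : AntitoneOn (fun s => a * cycleMoment d β 1 s - (a - b) / b * s) (Set.Iio 0) := by
      refine antitoneOn_of_deriv_nonpos (convex_Iio 0)
        (fun s hs => (hasDerivAt_level hβ _ hs).continuousAt.continuousWithinAt)
        (fun s hs => ?_) fun s hs => ?_
      · rw [interior_Iio] at hs
        exact (hasDerivAt_level hβ _ hs).differentiableAt.differentiableWithinAt
      · rw [interior_Iio] at hs
        rw [(hasDerivAt_level hβ _ hs).deriv]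
        exact h s hs
    have h1 := statLevel_minStat hβ hb hab hμt
    have h2 : minStat d β a b μs ≤ μs := by
      have := le_statLevel (d := d) hβ hb ha (minStat d β a b μs)
      rwa [h1] at this
    have h3 := statSlope_mono (d := d) hβ ha h2
    have h4 := hanti (h3.trans_lt hneg) hneg h3
    simp only at h4
    rw [← statLevel_of_neg hβ hb ha hneg, ← statLevel_of_neg hβ hb ha (h3.trans_lt hneg), h1,
      statLevel] at h4
    have : 0 < a / b := div_pos ha hb
    nlinarith

/-! ### The case `0 < κ < ∞` -/

lemma muR_eq_sInf (hab : b < a) (ha : 0 < a) (κ : ℝ) :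
    muR d β a b κ = sInf {s | muT d β a b ≤ s ∧ κ ≤ yTwo d β a b s} := by
  have hab' : 0 < a - b := by linarith
  rw [muR]
  congr 1
  ext s
  simp only [Set.mem_ofPred_eq]
  refine and_congr_right fun _ => ?_
  rw [yTwo, le_div_iff₀ hab', one_div, ← div_eq_inv_mul, le_div_iff₀ ha]
  constructor <;> intro h <;> linarith

lemma exists_le_yTwo (hβ : 0 < β) (hb : 0 < b) (hab : b < a) {κ : ℝ} (hκ : 0 < κ) :
    ∃ μ, muT d β a b ≤ μ ∧ κ ≤ yTwo d β a b μ := by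
  have ha : 0 < a := hb.trans hab
  -- At this `u` the slope is at least -bκ, so the level is at most u + aκ. The witness μ = u + aκ
  -- then gives (μ - u)/a = κ.
  set u := a * cycleMoment d β 1 (-(b * κ)) with hu
  have hbκ : -(b * κ) < 0 := by
    have := mul_pos hb hκ
    linarith
  have hT : -(b * κ) ≤ statSlope d β a u := by
    by_contra! hcon
    have hneg := hcon.trans hbκ
    have h1 := mul_statDensity (d := d) (β := β) ha u
    rw [statDensity_of_neg hβ ha hneg] at h1
    have h2 := mul_lt_mul_of_pos_left
      (strictMonoOn_cycleMoment (d := d) hβ 1 hneg hbκ hcon) ha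
    linarith
  have hle : statLevel d β a b u ≤ u + a * κ := by
    have h1 : a / b * -(b * κ) ≤ a / b * statSlope d β a u := by
      have := div_pos ha hb
      gcongr
    have e : a / b * -(b * κ) = -(a * κ) := by field_simp
    rw [statLevel]
    linarith
  have hμ := (muT_le_statLevel (d := d) hβ hb hab u).trans hle
  refine ⟨u + a * κ, hμ, ?_⟩
  rw [yTwo_eq hβ hb hab hμ, le_div_iff₀ ha]
  have := minStat_le hβ hb hab hle
  linarith

/-- Monotonicity and right-continuity of ỹ₂ make the infimum defining μ_r attained. -/
lemma muT_le_muR_and (hβ : 0 < β) (hb : 0 < b) (hab : b < a) {κ : ℝ} (hκ : 0 < κ) :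
    muT d β a b ≤ muR d β a b κ ∧ κ ≤ yTwo d β a b (muR d β a b κ) := by
  have ha : 0 < a := hb.trans hab
  rw [muR_eq_sInf hab ha]
  set R := {s | muT d β a b ≤ s ∧ κ ≤ yTwo d β a b s}
  have hne : R.Nonempty := exists_le_yTwo hβ hb hab hκ
  have hbdd : BddBelow R := ⟨muT d β a b, fun s hs => hs.1⟩
  have h1 : muT d β a b ≤ sInf R := le_csInf hne fun s hs => hs.1
  refine ⟨h1, ?_⟩
  refine ge_of_tendsto ((tendsto_yTwo_nhdsGE (d := d) hβ hb hab h1).mono_left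
    (nhdsWithin_mono _ Set.Ioi_subset_Ici_self : 𝓝[>] (sInf R) ≤ _)) ?_
  filter_upwards [self_mem_nhdsWithin] with ν hν
  obtain ⟨s, hs, hsν⟩ := exists_lt_of_csInf_lt hne hν
  exact hs.2.trans (yTwo_mono hβ hb hab hs.1 hsν.le)

lemma le_yTwo_of_muR_le (hβ : 0 < β) (hb : 0 < b) (hab : b < a) {κ μ : ℝ} (hκ : 0 < κ)
    (hμ : muR d β a b κ ≤ μ) : κ ≤ yTwo d β a b μ :=
  have h := muT_le_muR_and (d := d) hβ hb hab hκ
  h.2.trans (yTwo_mono hβ hb hab h.1 hμ)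

lemma yTwo_lt_of_lt_muR (hb : 0 < b) (hab : b < a) {κ μ : ℝ}
    (hμ : muT d β a b ≤ μ) (h : μ < muR d β a b κ) : yTwo d β a b μ < κ := by
  by_contra! hcon
  rw [muR_eq_sInf hab (hb.trans hab)] at h
  have hbdd : BddBelow {s | muT d β a b ≤ s ∧ κ ≤ yTwo d β a b s} :=
    ⟨muT d β a b, fun s hs => hs.1⟩
  exact (csInf_le hbdd ⟨hμ, hcon⟩).not_gt h

/-- There is no jump from the left: if ỹ₂(μ_r) > κ, some `v` slightly right of the minimal
stationary point has level below μ_r, so ỹ₂ exceeds κ already for some μ < μ_r. This needs room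
below μ_r, hence μ_t < μ_r. -/
lemma yTwo_muR (hβ : 0 < β) (hb : 0 < b) (hab : b < a) {κ : ℝ} (hκ : 0 < κ)
    (h : muT d β a b < muR d β a b κ) : yTwo d β a b (muR d β a b κ) = κ := by
  have ha : 0 < a := hb.trans hab
  obtain ⟨h1, h2⟩ := muT_le_muR_and (d := d) hβ hb hab hκ
  refine le_antisymm ?_ h2
  by_contra! hcon
  set r := muR d β a b κ with hr
  have hu : minStat d β a b r < r - a * κ := by
    rw [← sub_mul_yTwo hβ hb hab h1]
    have := mul_lt_mul_of_pos_left hcon ha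
    linarith
  obtain ⟨ut, hut, -⟩ := exists_statLevel_eq_muT (d := d) hβ hb hab
  have hut' : minStat d β a b r < ut := by
    refine lt_of_le_of_ne (minStat_le hβ hb hab (hut.trans_le h1)) fun hc => ?_
    rw [← hc, statLevel_minStat hβ hb hab h1] at hut
    exact h.ne' hut
  obtain ⟨v, hv1, hv2⟩ := exists_between (lt_min hu hut')
  have hv3 : statLevel d β a b v < r := by
    have := statLevel_lt_max (d := d) hβ hb ha hv1 (hv2.trans_le (min_le_right _ _))
    rwa [statLevel_minStat hβ hb hab h1, hut, max_eq_left h1] at this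
  have hv4 : v + a * κ < r := by linarith [hv2.trans_le (min_le_left _ _)]
  obtain ⟨μ, hμ1, hμ2⟩ := exists_between (max_lt (max_lt hv3 h) hv4)
  have hm1 : statLevel d β a b v < μ := (le_max_left _ _).trans_lt ((le_max_left _ _).trans_lt hμ1)
  have hm2 : muT d β a b < μ := (le_max_right _ _).trans_lt ((le_max_left _ _).trans_lt hμ1)
  have hm3 : v + a * κ < μ := (le_max_right _ _).trans_lt hμ1
  have h3 := yTwo_lt_of_lt_muR hb hab hm2.le hμ2
  rw [yTwo_eq hβ hb hab hm2.le, div_lt_iff₀ ha] at h3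
  have h4 := minStat_le hβ hb hab hm1.le
  linarith

/-- For `μ_t ≤ μ ≤ μ_r` the best admissible density of long cycles is `κ`. -/
lemma energyGap_kappa_lt (hd : 1 ≤ d) (hβ : 0 < β) (hb : 0 < b) (hab : b < a) {κ μ y : ℝ}
    (hκ : 0 < κ) (hμ : muT d β a b ≤ μ) (htr : muT d β a b < muR d β a b κ)
    (hμr : μ ≤ muR d β a b κ) (hy : κ < y) :
    energyGap d β a b μ κ < energyGap d β a b μ y := by
  refine energyGap_lt_of_yTwo_le hd hβ hb hab hμ ?_ hy
  rcases hμr.lt_or_eq with h | h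
  · exact (yTwo_lt_of_lt_muR hb hab hμ h).le
  · rw [h, yTwo_muR hβ hb hab hκ htr]

lemma transition_zero_le (hd : 1 ≤ d) (hβ : 0 < β) (hb : 0 < b) (hab : b < a) {κ : ℝ}
    (hκ : 0 < κ) : transitionPotential d β a b 0 ≤ transitionPotential d β a b κ :=
  le_csInf (nonempty_transition hd hβ hb hab hκ.le) fun _ ⟨_, hy, _, h⟩ =>
    transitionPotential_le hd hβ hb hab hy hy.le h

lemma transition_eq_of_muR_le (hd : 1 ≤ d) (hβ : 0 < β) (hb : 0 < b) (hab : b < a) {κ : ℝ}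
    (hκ : 0 < κ) (h : muR d β a b κ ≤ transitionPotential d β a b 0) :
    transitionPotential d β a b κ = transitionPotential d β a b 0 := by
  refine le_antisymm (le_of_forall_gt_imp_ge_of_dense fun μ hμ => ?_)
    (transition_zero_le hd hβ hb hab hκ)
  have h1 := le_yTwo_of_muR_le (d := d) hβ hb hab hκ (h.trans hμ.le)
  exact transitionPotential_le hd hβ hb hab (hκ.trans_le h1) h1
    (energyGap_yTwo_neg hd hβ hb hab hμ)

/-- Both inequalities are openness in μ. At μ^* the density κ is strictly unfavourable, since ỹ₂ <
κ, and it remains so just above, where κ is the best admissible choice. At μ_r > μ^* one has ỹ₂ = κ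
with negative gap, and this persists just below. -/
lemma transition_bounds_of_lt_muR (hd : 1 ≤ d) (hβ : 0 < β) (hb : 0 < b) (hab : b < a) {κ : ℝ}
    (hκ : 0 < κ) (h : transitionPotential d β a b 0 < muR d β a b κ) :
    transitionPotential d β a b 0 < transitionPotential d β a b κ ∧
      transitionPotential d β a b κ < muR d β a b κ := by
  have ha : 0 < a := hb.trans hab
  have hμt := muT_le_transitionPotential (d := d) hd hβ hb hab le_rfl
  have htr := hμt.trans_lt h
  have hc := continuous_energyGap_left (d := d) (b := b) hd hβ ha κ
  constructor
  · have h1 : 0 < energyGap d β a b (transitionPotential d β a b 0) κ :=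
      energyGap_pos_transition hd hβ hb hab hκ (yTwo_lt_of_lt_muR hb hab hμt h).ne'
    have h2 := ((hc.tendsto _).eventually (lt_mem_nhds h1)).filter_mono
      (nhdsWithin_le_nhds (s := Set.Ioi (transitionPotential d β a b 0)))
    obtain ⟨ν, hν1, hν2⟩ := (h2.and (Ioo_mem_nhdsGT h)).exists
    refine lt_of_lt_of_le hν2.1 ?_
    refine le_csInf (nonempty_transition hd hβ hb hab hκ.le) ?_
    rintro μ ⟨y, hy, hκy, hneg⟩
    by_contra! hcon
    have h3 := (energyGap_anti (b := b) hd hβ ha hy.le hcon.le).trans_lt hneg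
    have h4 : energyGap d β a b ν κ ≤ energyGap d β a b ν y := by
      rcases hκy.lt_or_eq with hlt | rfl
      · exact (energyGap_kappa_lt hd hβ hb hab hκ (hμt.trans hν2.1.le) htr hν2.2.le hlt).le
      · rfl
    linarith
  · have h1 := energyGap_yTwo_neg hd hβ hb hab h
    rw [yTwo_muR hβ hb hab hκ htr] at h1
    have h2 := ((hc.tendsto _).eventually (gt_mem_nhds h1)).filter_mono
      (nhdsWithin_le_nhds (s := Set.Iio (muR d β a b κ)))
    obtain ⟨ν, hν1, hν2⟩ := (h2.and self_mem_nhdsWithin).exists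
    have hν2 : ν < muR d β a b κ := hν2
    exact (transitionPotential_le hd hβ hb hab hκ le_rfl hν1).trans_lt hν2

lemma isEquilibrium_pos_of_lt (hd : 1 ≤ d) (hβ : 0 < β) (hb : 0 < b) (hab : b < a) {κ μ : ℝ}
    (hκ : 0 < κ) (hμ : μ < transitionPotential d β a b κ) :
    IsEquilibrium d β a b (ENNReal.ofReal κ) μ 0 := by
  refine ⟨isLongDensity_zero _, fun z hz hne => ?_⟩
  have hκz := ((isLongDensity_ofReal_iff hκ).1 hz).resolve_left hne
  rw [energyGap_zero]
  exact energyGap_pos_of_lt_transition hd hβ hb hab hμ (hκ.trans_le hκz) hκz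

lemma lt_muR_of_mem (hd : 1 ≤ d) (hβ : 0 < β) (hb : 0 < b) (hab : b < a) {κ μ : ℝ}
    (hκ : 0 < κ) (hμ : transitionPotential d β a b κ < μ) (hμr : μ ≤ muR d β a b κ) :
    transitionPotential d β a b 0 < muR d β a b κ :=
  (transition_zero_le hd hβ hb hab hκ).trans_lt (hμ.trans_le hμr)

lemma isEquilibrium_pos_kappa (hd : 1 ≤ d) (hβ : 0 < β) (hb : 0 < b) (hab : b < a) {κ μ : ℝ}
    (hκ : 0 < κ) (hμ : transitionPotential d β a b κ < μ) (hμr : μ ≤ muR d β a b κ) :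
    IsEquilibrium d β a b (ENNReal.ofReal κ) μ κ := by
  have hμt := muT_le_transitionPotential (d := d) hd hβ hb hab le_rfl
  have hs := lt_muR_of_mem hd hβ hb hab hκ hμ hμr
  have hμt' := (hμt.trans (transition_zero_le hd hβ hb hab hκ)).trans hμ.le
  have hlt : ∀ y, κ < y → energyGap d β a b μ κ < energyGap d β a b μ y := fun y hy =>
    energyGap_kappa_lt hd hβ hb hab hκ hμt' (hμt.trans_lt hs) hμr hy
  refine ⟨(isLongDensity_ofReal_iff hκ).2 (Or.inr le_rfl), fun z hz hne => ?_⟩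
  rcases (isLongDensity_ofReal_iff hκ).1 hz with rfl | h
  · obtain ⟨y, hy, hκy, hneg⟩ := exists_energyGap_neg_of_transition_lt hd hβ hb hab hκ.le hμ
    rw [energyGap_zero]
    rcases hκy.lt_or_eq with h | rfl
    · exact (hlt y h).trans hneg
    · exact hneg
  · exact hlt z (lt_of_le_of_ne h hne.symm)

lemma isEquilibrium_pos_of_gt (hd : 1 ≤ d) (hβ : 0 < β) (hb : 0 < b) (hab : b < a) {κ μ : ℝ}
    (hκ : 0 < κ) (hμ : transitionPotential d β a b κ < μ) (hμr : muR d β a b κ ≤ μ) :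
    IsEquilibrium d β a b (ENNReal.ofReal κ) μ (yTwo d β a b μ) := by
  have hs := (transition_zero_le hd hβ hb hab hκ).trans_lt hμ
  refine ⟨(isLongDensity_ofReal_iff hκ).2 (Or.inr (le_yTwo_of_muR_le hβ hb hab hκ hμr)),
    fun z hz hne => energyGap_yTwo_lt hd hβ hb hab hs hz.1 hne⟩

theorem isTransitionPos_transitionPotential (hd : 1 ≤ d) (hβ : 0 < β) (hb : 0 < b)
    (hab : b < a) {κ : ℝ} (hκ : 0 < κ) :
    IsTransitionPos d β a b κ (transitionPotential d β a b 0) (transitionPotential d β a b κ) := by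
  have ha : 0 < a := hb.trans hab
  have hμt := muT_le_transitionPotential (d := d) hd hβ hb hab le_rfl
  have hle := transition_zero_le (d := d) hd hβ hb hab hκ
  refine ⟨transition_eq_of_muR_le hd hβ hb hab hκ, transition_bounds_of_lt_muR hd hβ hb hab hκ,
    fun μ => ⟨fun h => ?_, ?_, ?_, fun h hr => ?_, fun h hr => ?_⟩⟩
  · rw [(isEquilibrium_pos_of_lt hd hβ hb hab hκ h).rateZeroes_eq hd hβ ha, xOne_eq hβ ha, mul_zero,
      sub_zero]
  · rintro rfl hr
    have hb2 := transition_bounds_of_lt_muR hd hβ hb hab hκ hr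
    have hlt : ∀ y, κ < y → energyGap d β a b (transitionPotential d β a b κ) κ <
        energyGap d β a b (transitionPotential d β a b κ) y := fun y hy =>
      energyGap_kappa_lt hd hβ hb hab hκ (hμt.trans hle) (hμt.trans_lt hr) hb2.2.le hy
    -- Nonnegative at the transition by definition of the infimum, and nonpositive as a limit from
    -- the right, where κ is the equilibrium.
    have hzero : energyGap d β a b (transitionPotential d β a b κ) κ = 0 := by
      refine le_antisymm ?_ (energyGap_nonneg_transition hd hβ hb hab hκ le_rfl)
      refine le_of_tendsto (((continuous_energyGap_left hd hβ ha κ).tendsto _).mono_left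
        nhdsWithin_le_nhds : Tendsto _ (𝓝[>] (transitionPotential d β a b κ)) _) ?_
      filter_upwards [Ioo_mem_nhdsGT hb2.2] with ν hν
      have := (isEquilibrium_pos_kappa hd hβ hb hab hκ hν.1 hν.2.le).2 0 (isLongDensity_zero _)
        hκ.ne
      rw [energyGap_zero] at this
      exact this.le
    rw [rateZeroes_eq_image hd hβ ha (Y := {0, κ}) (c := 0) (Set.insert_nonempty _ _),
      Set.image_pair, xOne_eq hβ ha, xThree, xOne_eq hβ ha, mul_zero, sub_zero]
    · rintro y (rfl | rfl)
      · exact ⟨isLongDensity_zero _, energyGap_zero _⟩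
      · exact ⟨(isLongDensity_ofReal_iff hκ).2 (Or.inr le_rfl), hzero⟩
    · intro y hy hne
      simp only [Set.mem_insert_iff, Set.mem_singleton_iff, not_or] at hne
      have := ((isLongDensity_ofReal_iff hκ).1 hy).resolve_left hne.1
      exact hzero ▸ hlt y (lt_of_le_of_ne this (Ne.symm hne.2))
  · rintro rfl hr
    rw [transition_eq_of_muR_le hd hβ hb hab hκ hr]
    set μs := transitionPotential d β a b 0
    rw [rateZeroes_eq_image hd hβ ha (Y := {0, yTwo d β a b μs}) (c := 0)
      (Set.insert_nonempty _ _), Set.image_pair, sub_mul_yTwo hβ hb hab hμt, xOne_eq hβ ha,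
      xTwo_eq hβ hb hab hμt, mul_zero, sub_zero]
    · rintro y (rfl | rfl)
      · exact ⟨isLongDensity_zero _, energyGap_zero _⟩
      · exact ⟨(isLongDensity_ofReal_iff hκ).2 (Or.inr (le_yTwo_of_muR_le hβ hb hab hκ hr)),
          energyGap_yTwo_transition hd hβ hb hab⟩
    · intro y hy hne
      simp only [Set.mem_insert_iff, Set.mem_singleton_iff, not_or] at hne
      exact energyGap_pos_transition hd hβ hb hab (lt_of_le_of_ne hy.1 (Ne.symm hne.1)) hne.2
  · rw [(isEquilibrium_pos_kappa hd hβ hb hab hκ h hr).rateZeroes_eq hd hβ ha, xThree,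
      xOne_eq hβ ha]
  · have hμt' := (hμt.trans hle).trans h.le
    rw [(isEquilibrium_pos_of_gt hd hβ hb hab hκ h hr).rateZeroes_eq hd hβ ha,
      sub_mul_yTwo hβ hb hab hμt', xTwo_eq hβ hb hab hμt']

end Transition

/-! ### Sums over cycle counts -/

section Counts

/-- The unnormalised weight `∏_k w_k^{n_k} / n_k!`. -/
noncomputable def poissonProd (w : ℕ+ → ℝ) (n : CycleCounts) : ℝ :=
  n.prod fun k j => w k ^ j / (j.factorial : ℝ)

lemma poissonProd_pos {w : ℕ+ → ℝ} (hw : ∀ k, 0 < w k) (n : CycleCounts) :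
    0 < poissonProd w n := by
  refine Finset.prod_pos fun k _ => ?_
  have := hw k
  positivity

lemma poissonProd_mul_exp (w x : ℕ+ → ℝ) (n : CycleCounts) :
    poissonProd (fun k => w k * Real.exp (x k)) n =
      poissonProd w n * Real.exp (n.sum fun k j => x k * j) := by
  rw [poissonProd, poissonProd, Finsupp.prod, Finsupp.prod, Finsupp.sum, Real.exp_sum,
    ← Finset.prod_mul_distrib]
  refine Finset.prod_congr rfl fun k _ => ?_
  rw [mul_pow, ← Real.exp_nat_mul, mul_comm ((n k : ℕ) : ℝ) (x k)]
  ring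

/-- Independence of the cycle counts: distributing a product over sums bounds any finite family of
configurations by a product of truncated exponential series. -/
lemma sum_poissonProd_le {w : ℕ+ → ℝ} (hw : ∀ k, 0 ≤ w k) (hs : Summable w)
    (S : Finset CycleCounts) : ∑ n ∈ S, poissonProd w n ≤ Real.exp (∑' k, w k) := by
  classical
  set A : Finset ℕ+ := S.biUnion fun n => n.support with hA
  set N : ℕ := S.sup fun n => n.support.sup fun k => n k with hN
  have hsub : ∀ n ∈ S, n.support ⊆ A := fun n hn => Finset.subset_biUnion_of_mem _ hn
  have hle : ∀ n ∈ S, ∀ k, n k ≤ N := fun n hn k => by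
    by_cases hk : k ∈ n.support
    · exact (Finset.le_sup (f := fun k => n k) hk).trans
        (Finset.le_sup (f := fun n : CycleCounts => n.support.sup fun k => n k) hn)
    · rw [Finsupp.notMem_support_iff.1 hk]
      exact Nat.zero_le _
  have key : ∑ n ∈ S, poissonProd w n ≤
      ∑ p ∈ A.pi fun _ => Finset.range (N + 1), ∏ k ∈ A.attach,
        w k.1 ^ (p k.1 k.2) / ((p k.1 k.2).factorial : ℝ) := by
    have hinj : Set.InjOn (fun (n : CycleCounts) (k : ℕ+) (_ : k ∈ A) => n k) S := by
      intro n hn n' hn' h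
      ext k
      by_cases hk : k ∈ A
      · exact congrFun (congrFun h k) hk
      · rw [Finsupp.notMem_support_iff.1 fun h => hk (hsub n hn h),
          Finsupp.notMem_support_iff.1 fun h => hk (hsub n' hn' h)]
    calc ∑ n ∈ S, poissonProd w n
        = ∑ n ∈ S, ∏ k ∈ A.attach, w k.1 ^ (n k.1) / ((n k.1).factorial : ℝ) := by
          refine Finset.sum_congr rfl fun n hn => ?_
          rw [poissonProd, Finsupp.prod_of_support_subset n (hsub n hn) _ (by simp),
            ← Finset.prod_attach]
      _ = ∑ p ∈ S.image fun (n : CycleCounts) (k : ℕ+) (_ : k ∈ A) => n k, ∏ k ∈ A.attach,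
            w k.1 ^ (p k.1 k.2) / ((p k.1 k.2).factorial : ℝ) := by
          rw [Finset.sum_image hinj]
      _ ≤ _ := by
          refine Finset.sum_le_sum_of_subset_of_nonneg ?_ fun p _ _ => ?_
          · intro p hp
            obtain ⟨n, hn, rfl⟩ := Finset.mem_image.1 hp
            simp only [Finset.mem_pi, Finset.mem_range]
            exact fun k _ => Nat.lt_succ_of_le (hle n hn k)
          · refine Finset.prod_nonneg fun k _ => ?_
            have := hw k
            positivity
  rw [← Finset.prod_sum A (fun _ => Finset.range (N + 1))
    fun k j => w k ^ j / (j.factorial : ℝ)] at key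
  refine key.trans ?_
  calc ∏ k ∈ A, ∑ j ∈ Finset.range (N + 1), w k ^ j / (j.factorial : ℝ)
      ≤ ∏ k ∈ A, Real.exp (w k) := by
        refine Finset.prod_le_prod (fun k _ => Finset.sum_nonneg fun j _ => ?_)
          fun k _ => Real.sum_le_exp_of_nonneg (hw k) _
        have := hw k
        positivity
    _ = Real.exp (∑ k ∈ A, w k) := (Real.exp_sum _ _).symm
    _ ≤ _ := Real.exp_le_exp.2 (hs.sum_le_tsum A fun k _ => hw k)

/-! ### Long cycles of a configuration -/

/-- The number of particles in cycles of length at least `m`. -/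
noncomputable def longCount (m : ℕ) (n : CycleCounts) : ℕ :=
  n.sum fun k j => if m ≤ (k : ℕ) then (k : ℕ) * j else 0

/-- `∑_{k ≥ m} k² λ_k²`. -/
noncomputable def longSquare (V : ℝ) (m : ℕ) (n : CycleCounts) : ℝ :=
  n.sum fun k j => if m ≤ (k : ℕ) then (k : ℝ) ^ 2 * ((j : ℝ) / V) ^ 2 else 0

lemma longCycleDensity_eq (V : ℝ) (m : ℕ) (n : CycleCounts) :
    longCycleDensity V m n = longCount m n / V := by
  rw [longCycleDensity, longCount, Finsupp.sum, Finsupp.sum, Nat.cast_sum, Finset.sum_div]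
  refine Finset.sum_congr rfl fun k _ => ?_
  split_ifs
  · push_cast
    ring
  · simp

/-- One long cycle already carries `m` particles. After division by the volume, this is the origin
of the hole (0, κ) in `rateDomain`. -/
lemma longCount_eq_zero_or (m : ℕ) (n : CycleCounts) : longCount m n = 0 ∨ m ≤ longCount m n := by
  by_cases h : ∃ k ∈ n.support, m ≤ (k : ℕ)
  · obtain ⟨k, hk, hmk⟩ := h
    right
    have h1 : (if m ≤ (k : ℕ) then (k : ℕ) * n k else 0) ≤ longCount m n :=
      Finset.single_le_sum (f := fun k : ℕ+ => if m ≤ (k : ℕ) then (k : ℕ) * n k else 0)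
        (fun _ _ => Nat.zero_le _) hk
    rw [if_pos hmk] at h1
    have h2 : 1 ≤ n k := Nat.one_le_iff_ne_zero.2 (Finsupp.mem_support_iff.1 hk)
    nlinarith
  · left
    push Not at h
    exact Finset.sum_eq_zero fun k hk => if_neg (h k hk).not_ge

/-- Equality holds when all long cycles have the same length, which is why a single long cycle
suffices for the matching lower bound. -/
lemma longSquare_le {V : ℝ} (hV : 0 < V) (m : ℕ) (n : CycleCounts) :
    longSquare V m n ≤ longCycleDensity V m n ^ 2 := by
  rw [longSquare, longCycleDensity, Finsupp.sum, Finsupp.sum]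
  have h : ∀ k ∈ n.support, 0 ≤ if m ≤ (k : ℕ) then (k : ℝ) * ((n k : ℝ) / V) else 0 :=
    fun k _ => by split_ifs <;> positivity
  refine le_trans (le_of_eq ?_) (Finset.sum_sq_le_sq_sum_of_nonneg h)
  refine Finset.sum_congr rfl fun k _ => ?_
  split_ifs <;> ring

/-- The density of particles in cycles of length less than `m`. -/
lemma shortDensity_eq (V : ℝ) (m : ℕ) (n : CycleCounts) :
    particleDensity V n - longCycleDensity V m n =
      n.sum fun k j => if m ≤ (k : ℕ) then 0 else (k : ℝ) * ((j : ℝ) / V) := by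
  rw [particleDensity, longCycleDensity, Finsupp.sum, Finsupp.sum, Finsupp.sum,
    ← Finset.sum_sub_distrib]
  refine Finset.sum_congr rfl fun k _ => ?_
  split_ifs <;> ring

end Counts

/-! ### The Gibbs weights -/

section Gibbs

variable {d : ℕ} {β a b : ℝ}

/-- The density of the Gibbs measure with respect to the counting measure, up to normalisation. -/
noncomputable def gibbsWeight (d : ℕ) (β μ a b V : ℝ) (m : ℕ) (n : CycleCounts) : ℝ :=
  poissonProd (fun k => V * cycleWeight d β k) n *
    Real.exp (β * V * (μ * particleDensity V n - a / 2 * particleDensity V n ^ 2 +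
      b / 2 * longSquare V m n))

lemma gibbsWeight_pos (hβ : 0 < β) {V : ℝ} (hV : 0 < V) (μ : ℝ) (m : ℕ) (n : CycleCounts) :
    0 < gibbsWeight d β μ a b V m n :=
  mul_pos (poissonProd_pos (fun k => mul_pos hV (cycleWeight_pos hβ k)) n) (Real.exp_pos _)

lemma referenceMass_eq {V : ℝ} (hV : 0 < V) (α : ℝ) (n : CycleCounts) :
    referenceMass d β α V n = Real.exp (-(V * totalCycleWeight d β α)) *
      (poissonProd (fun k => V * cycleWeight d β k) n *
        Real.exp (β * V * (α * particleDensity V n))) := by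
  have h := poissonProd_mul_exp (fun k => V * cycleWeight d β k) (fun k : ℕ+ => β * α * k) n
  rw [referenceMass]
  congr 1
  refine Eq.trans h ?_
  congr 2
  rw [particleDensity, Finsupp.sum, Finsupp.sum, Finset.mul_sum, Finset.mul_sum]
  refine Finset.sum_congr rfl fun k _ => ?_
  field_simp

lemma referenceMass_nonneg (hβ : 0 < β) {V : ℝ} (hV : 0 < V) (α : ℝ) (n : CycleCounts) :
    0 ≤ referenceMass d β α V n := by
  rw [referenceMass_eq hV]
  have := poissonProd_pos (fun k => mul_pos hV (cycleWeight_pos (d := d) hβ k)) n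
  positivity

/-- The α in the Hamiltonian cancels the factors e^{βαk} of the reference law; α survives only in a
constant that normalisation removes. -/
lemma referenceMass_mul_exp {V : ℝ} (hV : 0 < V) (α μ : ℝ) (m : ℕ) (n : CycleCounts) :
    referenceMass d β α V n * Real.exp (-(β * hamiltonian α μ a b V m n)) =
      Real.exp (-(V * totalCycleWeight d β α)) * gibbsWeight d β μ a b V m n := by
  rw [referenceMass_eq hV, gibbsWeight, mul_assoc, mul_assoc, ← Real.exp_add]
  congr 3
  rw [hamiltonian, longSquare]
  ring

/-! ### Integrals as sums over configurations -/

instance : DiscreteMeasurableSpace CycleCounts := ⟨fun _ => MeasurableSpace.measurableSet_top⟩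

lemma integrable_referenceMeasure (hβ : 0 < β) {V : ℝ} (hV : 0 < V) (α : ℝ) {f : CycleCounts → ℝ}
    (hf : Summable fun n => referenceMass d β α V n * |f n|) :
    Integrable f (referenceMeasure d β α V) := by
  refine ⟨(measurable_of_countable f).aestronglyMeasurable, ?_⟩
  rw [HasFiniteIntegral, referenceMeasure, lintegral_sum_measure]
  have h : ∀ n, ∫⁻ x, ‖f x‖ₑ ∂(ENNReal.ofReal (referenceMass d β α V n) • Measure.dirac n) =
      ENNReal.ofReal (referenceMass d β α V n * |f n|) := fun n => by
    rw [lintegral_smul_measure, lintegral_dirac, ENNReal.ofReal_mul (referenceMass_nonneg hβ hV α n),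
      smul_eq_mul, Real.enorm_eq_ofReal_abs]
  simp_rw [h]
  exact hf.tsum_ofReal_lt_top

lemma integral_referenceMeasure (hβ : 0 < β) {V : ℝ} (hV : 0 < V) (α : ℝ) {f : CycleCounts → ℝ}
    (hf : Summable fun n => referenceMass d β α V n * |f n|) :
    ∫ n, f n ∂(referenceMeasure d β α V) = ∑' n, referenceMass d β α V n * f n := by
  rw [referenceMeasure, integral_sum_measure (integrable_referenceMeasure hβ hV α hf)]
  refine tsum_congr fun n => ?_
  rw [integral_smul_measure, integral_dirac, ENNReal.toReal_ofReal (referenceMass_nonneg hβ hV α n),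
    smul_eq_mul]

lemma integrable_exp_hamiltonian (hβ : 0 < β) {V : ℝ} (hV : 0 < V) (α μ : ℝ) {m : ℕ}
    (hW : Summable (gibbsWeight d β μ a b V m)) :
    Integrable (fun n => Real.exp (-(β * hamiltonian α μ a b V m n)))
      (referenceMeasure d β α V) := by
  refine integrable_referenceMeasure hβ hV α ?_
  simp_rw [abs_of_pos (Real.exp_pos _), referenceMass_mul_exp hV]
  exact hW.mul_left _

lemma integral_exp_hamiltonian (hβ : 0 < β) {V : ℝ} (hV : 0 < V) (α μ : ℝ) {m : ℕ}
    (hW : Summable (gibbsWeight d β μ a b V m)) :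
    ∫ n, Real.exp (-(β * hamiltonian α μ a b V m n)) ∂(referenceMeasure d β α V) =
      Real.exp (-(V * totalCycleWeight d β α)) * ∑' n, gibbsWeight d β μ a b V m n := by
  rw [integral_referenceMeasure hβ hV α, ← tsum_mul_left]
  · simp_rw [referenceMass_mul_exp hV]
  · simp_rw [abs_of_pos (Real.exp_pos _), referenceMass_mul_exp hV]
    exact hW.mul_left _

lemma tsum_gibbsWeight_pos (hβ : 0 < β) {V : ℝ} (hV : 0 < V) (μ : ℝ) {m : ℕ}
    (hW : Summable (gibbsWeight d β μ a b V m)) : 0 < ∑' n, gibbsWeight d β μ a b V m n :=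
  hW.tsum_pos (fun n => (gibbsWeight_pos hβ hV μ m n).le) 0 (gibbsWeight_pos hβ hV μ m 0)

lemma isProbabilityMeasure_gibbsMeasure (hβ : 0 < β) {V : ℝ} (hV : 0 < V) (α μ : ℝ) {m : ℕ}
    (hW : Summable (gibbsWeight d β μ a b V m)) :
    IsProbabilityMeasure (gibbsMeasure d β α μ a b V m) := by
  have : NeZero (referenceMeasure d β α V) := ⟨fun h => by
    have h1 := integral_exp_hamiltonian (a := a) (b := b) hβ hV α μ hW
    rw [h, integral_zero_measure] at h1
    have := mul_pos (Real.exp_pos (-(V * totalCycleWeight d β α)))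
      (tsum_gibbsWeight_pos hβ hV μ hW)
    linarith⟩
  exact isProbabilityMeasure_tilted (integrable_exp_hamiltonian hβ hV α μ hW)

lemma summable_gibbs_mul {V : ℝ} (hV : 0 < V) (α μ : ℝ) {m : ℕ}
    {f : CycleCounts → ℝ} (hf : Summable fun n => gibbsWeight d β μ a b V m n * |f n|) :
    Summable fun n => referenceMass d β α V n *
      |Real.exp (-(β * hamiltonian α μ a b V m n)) * f n| := by
  refine (hf.mul_left (Real.exp (-(V * totalCycleWeight d β α)))).congr fun n => ?_
  rw [abs_mul, abs_of_pos (Real.exp_pos _), ← mul_assoc, ← mul_assoc, referenceMass_mul_exp hV]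

lemma integrable_gibbsMeasure (hβ : 0 < β) {V : ℝ} (hV : 0 < V) (α μ : ℝ) {m : ℕ}
    (hW : Summable (gibbsWeight d β μ a b V m)) {f : CycleCounts → ℝ}
    (hf : Summable fun n => gibbsWeight d β μ a b V m n * |f n|) :
    Integrable f (gibbsMeasure d β α μ a b V m) := by
  rw [gibbsMeasure, integrable_tilted_iff (integrable_exp_hamiltonian hβ hV α μ hW)]
  exact integrable_referenceMeasure hβ hV α (summable_gibbs_mul hV α μ hf)

lemma integral_gibbsMeasure (hβ : 0 < β) {V : ℝ} (hV : 0 < V) (α μ : ℝ) {m : ℕ}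
    (hW : Summable (gibbsWeight d β μ a b V m)) {f : CycleCounts → ℝ}
    (hf : Summable fun n => gibbsWeight d β μ a b V m n * |f n|) :
    ∫ n, f n ∂(gibbsMeasure d β α μ a b V m) =
      (∑' n, gibbsWeight d β μ a b V m n * f n) / ∑' n, gibbsWeight d β μ a b V m n := by
  rw [gibbsMeasure, integral_tilted, integral_exp_hamiltonian hβ hV α μ hW]
  have h : ∀ n, (Real.exp (-(β * hamiltonian α μ a b V m n)) /
      (Real.exp (-(V * totalCycleWeight d β α)) * ∑' n, gibbsWeight d β μ a b V m n)) • f n =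
      Real.exp (-(β * hamiltonian α μ a b V m n)) * f n /
        (Real.exp (-(V * totalCycleWeight d β α)) * ∑' n, gibbsWeight d β μ a b V m n) :=
    fun n => by rw [smul_eq_mul]; ring
  simp_rw [h]
  rw [integral_div, integral_referenceMeasure hβ hV α (summable_gibbs_mul hV α μ hf)]
  simp_rw [← mul_assoc, referenceMass_mul_exp hV, mul_assoc]
  rw [tsum_mul_left, mul_div_mul_left _ _ (Real.exp_pos _).ne']

/-! ### Upper bounds -/

/-- `∑_{k ≥ m} q_k`. -/
noncomputable def longWeight (d : ℕ) (β : ℝ) (m : ℕ) : ℝ :=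
  ∑' k : ℕ+, if m ≤ (k : ℕ) then cycleWeight d β k else 0

lemma summable_longWeight (hd : 1 ≤ d) (hβ : 0 < β) (m : ℕ) :
    Summable fun k : ℕ+ => if m ≤ (k : ℕ) then cycleWeight d β k else 0 := by
  refine Summable.of_nonneg_of_le (fun k => ?_) (fun k => ?_) (summable_cycleWeight (β := β) hd)
  · split_ifs
    · exact (cycleWeight_pos hβ k).le
    · exact le_rfl
  · split_ifs
    · exact le_rfl
    · exact (cycleWeight_pos hβ k).le

lemma tendsto_longWeight (hd : 1 ≤ d) (hβ : 0 < β) :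
    Tendsto (longWeight d β) atTop (𝓝 0) := by
  have h := tendsto_tsum_of_dominated_convergence (𝓕 := atTop)
    (f := fun (m : ℕ) (k : ℕ+) => if m ≤ (k : ℕ) then cycleWeight d β k else 0)
    (g := fun _ => 0) (summable_cycleWeight (β := β) hd) (fun k => ?_) (Eventually.of_forall fun m k => ?_)
  · rw [tsum_zero] at h
    exact h
  · refine tendsto_const_nhds.congr' ?_
    filter_upwards [eventually_gt_atTop (k : ℕ)] with m hm
    rw [if_neg hm.not_ge]
  · have := (cycleWeight_pos (d := d) hβ k).le
    split_ifs
    · rw [Real.norm_of_nonneg this]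
    · rwa [norm_zero]

/-- The Poisson weights tilted by `e^{βsk}` on the cycles shorter than `m`. -/
noncomputable def tiltedWeight (d : ℕ) (β V : ℝ) (m : ℕ) (s : ℝ) (k : ℕ+) : ℝ :=
  V * cycleWeight d β k * Real.exp (if m ≤ (k : ℕ) then 0 else β * s * k)

lemma tiltedWeight_nonneg (hβ : 0 < β) {V : ℝ} (hV : 0 < V) (m : ℕ) (s : ℝ) (k : ℕ+) :
    0 ≤ tiltedWeight d β V m s k := by
  have := cycleWeight_pos (d := d) hβ k
  unfold tiltedWeight
  positivity

lemma tiltedWeight_le (hβ : 0 < β) {V : ℝ} (hV : 0 < V) (m : ℕ) (s : ℝ) (k : ℕ+) :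
    tiltedWeight d β V m s k ≤ V * (cycleWeight d β k * Real.exp (β * s * k) +
      if m ≤ (k : ℕ) then cycleWeight d β k else 0) := by
  have := cycleWeight_pos (d := d) hβ k
  have h2 : 0 ≤ V * (cycleWeight d β k * Real.exp (β * s * k)) := by positivity
  unfold tiltedWeight
  split_ifs
  · rw [Real.exp_zero]
    linarith
  · rw [add_zero, mul_assoc]

lemma summable_tiltedWeight (hd : 1 ≤ d) (hβ : 0 < β) {V : ℝ} (hV : 0 < V) (m : ℕ) {s : ℝ}
    (hs : s ≤ 0) : Summable (tiltedWeight d β V m s) :=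
  Summable.of_nonneg_of_le (tiltedWeight_nonneg hβ hV m s) (tiltedWeight_le hβ hV m s)
    (((summable_cycleWeight_mul_exp hd hβ hs).add (summable_longWeight hd hβ m)).mul_left V)

lemma tsum_tiltedWeight_le (hd : 1 ≤ d) (hβ : 0 < β) {V : ℝ} (hV : 0 < V) (m : ℕ) {s : ℝ}
    (hs : s ≤ 0) : ∑' k, tiltedWeight d β V m s k ≤
      V * (β * idealPressure d β s + longWeight d β m) := by
  have S1 := summable_cycleWeight_mul_exp hd hβ hs
  have S2 := summable_longWeight hd hβ m
  refine ((summable_tiltedWeight hd hβ hV m hs).tsum_le_tsum (tiltedWeight_le hβ hV m s)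
    ((S1.add S2).mul_left V)).trans (le_of_eq ?_)
  rw [tsum_mul_left, S1.tsum_add S2, idealPressure_eq, mul_inv_cancel_left₀ hβ.ne', longWeight]

/-- With long density y, the exponent is a concave quadratic in the short density. Splitting off a
linear term with slope `s` and completing the square bounds the rest by a constant, and the linear
term becomes the tilt of the short cycles. -/
lemma gibbsWeight_le (hβ : 0 < β) (ha : 0 < a) (hb : 0 < b) {V : ℝ} (hV : 0 < V) (μ s : ℝ)
    (m : ℕ) (n : CycleCounts) :
    gibbsWeight d β μ a b V m n ≤ poissonProd (tiltedWeight d β V m s) n *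
      Real.exp (β * V * ((μ - a * longCycleDensity V m n - s) ^ 2 / (2 * a) -
        (a - b) / 2 * longCycleDensity V m n ^ 2 + μ * longCycleDensity V m n)) := by
  have h1 : poissonProd (tiltedWeight d β V m s) n =
      poissonProd (fun k => V * cycleWeight d β k) n *
        Real.exp (β * V * (s * (particleDensity V n - longCycleDensity V m n))) := by
    refine (poissonProd_mul_exp (fun k => V * cycleWeight d β k)
      (fun k : ℕ+ => if m ≤ (k : ℕ) then 0 else β * s * k) n).trans ?_
    congr 2
    rw [shortDensity_eq, Finsupp.sum, Finsupp.sum, Finset.mul_sum, Finset.mul_sum]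
    refine Finset.sum_congr rfl fun k _ => ?_
    split_ifs
    · simp
    · field_simp
  rw [gibbsWeight, h1, mul_assoc (poissonProd (fun k => V * cycleWeight d β k) n), ← Real.exp_add]
  refine mul_le_mul_of_nonneg_left (Real.exp_le_exp.2 ?_)
    (poissonProd_pos (fun k => mul_pos hV (cycleWeight_pos hβ k)) n).le
  rw [← mul_add]
  refine mul_le_mul_of_nonneg_left ?_ (mul_pos hβ hV).le
  have h2 := longSquare_le hV m n
  set ρ := particleDensity V n
  set y := longCycleDensity V m n
  have h3 : b / 2 * longSquare V m n ≤ b / 2 * y ^ 2 := by gcongr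
  have h4 : 0 ≤ (μ - a * y - s - a * (ρ - y)) ^ 2 / (2 * a) := by positivity
  have h5 : (μ - a * y - s - a * (ρ - y)) ^ 2 / (2 * a) = (μ - a * y - s) ^ 2 / (2 * a) -
      (μ - a * y - s) * (ρ - y) + a / 2 * (ρ - y) ^ 2 := by
    field_simp
    ring
  rw [h5] at h4
  nlinarith

/-- The slope belonging to μ - a y turns the tilted bound into the variational expression. All ways
of arranging the `j` particles in long cycles cost only exp(V·`longWeight`), which is e^{o(V)} as m
→ ∞. -/
lemma sum_gibbsWeight_fibre_le (hd : 1 ≤ d) (hβ : 0 < β) (ha : 0 < a) (hb : 0 < b) {V : ℝ}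
    (hV : 0 < V) (μ : ℝ) (m j : ℕ) (S : Finset CycleCounts) (hS : ∀ n ∈ S, longCount m n = j) :
    ∑ n ∈ S, gibbsWeight d β μ a b V m n ≤ Real.exp (V * longWeight d β m +
      β * V * (meanFieldPressure d β a μ - energyGap d β a b μ (j / V))) := by
  set y : ℝ := j / V with hy
  set s := statSlope d β a (μ - a * y) with hs
  have hs0 : s ≤ 0 := statSlope_nonpos hβ ha _
  calc ∑ n ∈ S, gibbsWeight d β μ a b V m n
      ≤ ∑ n ∈ S, poissonProd (tiltedWeight d β V m s) n *
          Real.exp (β * V * ((μ - a * y - s) ^ 2 / (2 * a) - (a - b) / 2 * y ^ 2 + μ * y)) := by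
        refine Finset.sum_le_sum fun n hn => ?_
        have := gibbsWeight_le (d := d) hβ ha hb hV μ s m n
        rwa [longCycleDensity_eq, hS n hn, ← hy] at this
    _ ≤ Real.exp (V * (β * idealPressure d β s + longWeight d β m)) *
          Real.exp (β * V * ((μ - a * y - s) ^ 2 / (2 * a) - (a - b) / 2 * y ^ 2 + μ * y)) := by
        rw [← Finset.sum_mul]
        refine mul_le_mul_of_nonneg_right ?_ (Real.exp_pos _).le
        exact (sum_poissonProd_le (tiltedWeight_nonneg hβ hV m s)
          (summable_tiltedWeight hd hβ hV m hs0) S).trans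
          (Real.exp_le_exp.2 (tsum_tiltedWeight_le hd hβ hV m hs0))
    _ = _ := by
        rw [← Real.exp_add, energyGap, meanFieldPressure, meanFieldPressure, ← hs]
        congr 1
        ring

/-- Sums of functions of the number of particles in long cycles. -/
lemma gibbs_sum_le (hd : 1 ≤ d) (hβ : 0 < β) (ha : 0 < a) (hb : 0 < b) {V : ℝ}
    (hV : 0 < V) (μ : ℝ) (m : ℕ) {g u : ℕ → ℝ} (hg : ∀ j, 0 ≤ g j) (hu : Summable u)
    (hu0 : ∀ j, 0 ≤ u j)
    (hgu : ∀ j, (j = 0 ∨ m ≤ j) → g j * Real.exp (V * longWeight d β m +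
      β * V * (meanFieldPressure d β a μ - energyGap d β a b μ (j / V))) ≤ u j) :
    (Summable fun n => gibbsWeight d β μ a b V m n * g (longCount m n)) ∧
      ∑' n, gibbsWeight d β μ a b V m n * g (longCount m n) ≤ ∑' j, u j := by
  classical
  have h0 : ∀ n, 0 ≤ gibbsWeight d β μ a b V m n * g (longCount m n) := fun n =>
    mul_nonneg (gibbsWeight_pos hβ hV μ m n).le (hg _)
  have key : ∀ S : Finset CycleCounts,
      ∑ n ∈ S, gibbsWeight d β μ a b V m n * g (longCount m n) ≤ ∑' j, u j := fun S => by
    rw [← Finset.sum_fiberwise_of_maps_to (t := S.image (longCount m))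
      (g := longCount m) fun n hn => Finset.mem_image_of_mem _ hn]
    refine le_trans (Finset.sum_le_sum fun j hj => ?_)
      (hu.sum_le_tsum (S.image (longCount m)) fun j _ => hu0 j)
    have hj' : j = 0 ∨ m ≤ j := by
      obtain ⟨n, -, rfl⟩ := Finset.mem_image.1 hj
      exact longCount_eq_zero_or m n
    refine le_trans ?_ (hgu j hj')
    calc ∑ n ∈ S with longCount m n = j, gibbsWeight d β μ a b V m n * g (longCount m n)
        = g j * ∑ n ∈ S with longCount m n = j, gibbsWeight d β μ a b V m n := by
          rw [Finset.mul_sum]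
          refine Finset.sum_congr rfl fun n hn => ?_
          rw [(Finset.mem_filter.1 hn).2, mul_comm]
      _ ≤ _ := mul_le_mul_of_nonneg_left (sum_gibbsWeight_fibre_le hd hβ ha hb hV μ m j _
          fun n hn => (Finset.mem_filter.1 hn).2) (hg j)
  exact ⟨summable_of_sum_le h0 key, Real.tsum_le_of_sum_le h0 key⟩

lemma summable_natCast_add_mul_exp (C : ℝ) {r : ℝ} (hr : 0 < r) :
    Summable fun j : ℕ => ((j : ℝ) + C) * Real.exp (-(r * j)) := by
  have h1 := Real.summable_pow_mul_exp_neg_nat_mul 1 hr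
  have h2 := (Real.summable_pow_mul_exp_neg_nat_mul 0 hr).mul_left C
  refine (h1.add h2).congr fun j => ?_
  rw [neg_mul]
  ring

lemma summable_gibbs_longCount (hd : 1 ≤ d) (hβ : 0 < β) (hb : 0 < b) (hab : b < a) {V : ℝ}
    (hV : 0 < V) (μ : ℝ) (m : ℕ) :
    Summable fun n => gibbsWeight d β μ a b V m n * ((longCount m n : ℝ) + 1) := by
  have ha : 0 < a := hb.trans hab
  have hab' : 0 < a - b := by linarith
  set C := Real.exp (V * longWeight d β m + β * V * (meanFieldPressure d β a μ +
    (μ + 1) ^ 2 / (2 * (a - b))))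
  refine (gibbs_sum_le hd hβ ha hb hV μ m (g := fun j => (j : ℝ) + 1)
    (u := fun j => C * (((j : ℝ) + 1) * Real.exp (-(β * j)))) (fun j => by positivity)
    ((summable_natCast_add_mul_exp 1 hβ).mul_left C) (fun j => by positivity) fun j _ => ?_).1
  have hy : (0 : ℝ) ≤ j / V := by positivity
  have h1 := le_energyGap (d := d) (b := b) hd hβ ha (μ := μ) hy
  -- Completing the square bounds the gap below by j/V minus a constant, which yields the summable
  -- factor e^{-βj}.
  have h2 : 0 ≤ ((a - b) * (j / V) - (μ + 1)) ^ 2 / (2 * (a - b)) := by positivity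
  have h3 : ((a - b) * (j / V) - (μ + 1)) ^ 2 / (2 * (a - b)) =
      (a - b) / 2 * (j / V) ^ 2 - (μ + 1) * (j / V) + (μ + 1) ^ 2 / (2 * (a - b)) := by
    field_simp
    ring
  rw [mul_left_comm, ← Real.exp_add]
  refine mul_le_mul_of_nonneg_left (Real.exp_le_exp.2 ?_) (by positivity)
  have h4 : β * V * (meanFieldPressure d β a μ - energyGap d β a b μ (j / V)) ≤
      β * V * (meanFieldPressure d β a μ + (μ + 1) ^ 2 / (2 * (a - b)) - j / V) := by
    refine mul_le_mul_of_nonneg_left ?_ (by positivity)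
    linarith
  have h5 : β * V * (j / V) = β * j := by field_simp
  linarith

lemma summable_gibbsWeight (hd : 1 ≤ d) (hβ : 0 < β) (hb : 0 < b) (hab : b < a) {V : ℝ}
    (hV : 0 < V) (μ : ℝ) (m : ℕ) : Summable (gibbsWeight d β μ a b V m) := by
  refine Summable.of_nonneg_of_le (fun n => (gibbsWeight_pos hβ hV μ m n).le) (fun n => ?_)
    (summable_gibbs_longCount hd hβ hb hab hV μ m)
  have := gibbsWeight_pos (d := d) (a := a) (b := b) hβ hV μ m n
  have : (0 : ℝ) ≤ longCount m n := by positivity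
  nlinarith

lemma summable_gibbs_longCycleDensity (hd : 1 ≤ d) (hβ : 0 < β) (hb : 0 < b) (hab : b < a)
    {V : ℝ} (hV : 0 < V) (μ : ℝ) (m : ℕ) :
    Summable fun n => gibbsWeight d β μ a b V m n * |longCycleDensity V m n| := by
  refine Summable.of_nonneg_of_le (fun n => ?_) (fun n => ?_)
    ((summable_gibbs_longCount hd hβ hb hab hV μ m).mul_left V⁻¹)
  · have := gibbsWeight_pos (d := d) (a := a) (b := b) hβ hV μ m n
    positivity
  · have := gibbsWeight_pos (d := d) (a := a) (b := b) hβ hV μ m n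
    rw [longCycleDensity_eq, abs_of_nonneg (by positivity), div_eq_inv_mul, mul_left_comm]
    gcongr
    linarith

end Gibbs

/-! ### Lower bound for the partition function -/

section LowerBound

variable {d : ℕ} {β a b : ℝ}

/-- A crude Stirling bound, with n + 1 in the logarithm so that n = 0 needs no separate treatment;
the extra logarithm vanishes on the scale V. -/
lemma log_factorial_le (n : ℕ) :
    Real.log (n.factorial : ℝ) ≤ ((n : ℝ) + 1) * Real.log ((n : ℝ) + 1) - n := by
  induction n with
  | zero => simp
  | succ n ih =>
    have h1 : (0 : ℝ) < (n : ℝ) + 1 := by positivity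
    have h2 : (0 : ℝ) < (n : ℝ) + 2 := by positivity
    have hf : (0 : ℝ) < (n.factorial : ℝ) := by exact_mod_cast n.factorial_pos
    rw [Nat.factorial_succ, Nat.cast_mul, Nat.cast_succ, Real.log_mul h1.ne' hf.ne']
    have h3 := Real.one_sub_inv_le_log_of_pos (div_pos h2 h1)
    rw [Real.log_div h2.ne' h1.ne', inv_div] at h3
    have h4 : ((n : ℝ) + 2) * (1 - ((n : ℝ) + 1) / ((n : ℝ) + 2)) = 1 := by
      field_simp
      ring
    have h5 := mul_le_mul_of_nonneg_left h3 h2.le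
    rw [h4] at h5
    rw [show (n : ℝ) + 1 + 1 = n + 2 by ring]
    linarith

/-- Asymptotics of a Poisson weight at a density `t`. -/
lemma eventually_exp_le_poisson {q t ε : ℝ} (hq : 0 < q) (ht : 0 < t) (hε : 0 < ε) :
    ∀ᶠ V : ℝ in atTop, Real.exp (V * (t * (1 - Real.log (t / q)) - ε)) ≤
      (V * q) ^ ⌊V * t⌋₊ / (⌊V * t⌋₊.factorial : ℝ) := by
  have hn : Tendsto (fun V : ℝ => (⌊V * t⌋₊ : ℝ) / V) atTop (𝓝 t) := by
    have := tendsto_nat_floor_mul_div_atTop (R := ℝ) ht.le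
    refine this.congr fun V => ?_
    rw [mul_comm]
  have hn1 : Tendsto (fun V : ℝ => ((⌊V * t⌋₊ : ℝ) + 1) / V) atTop (𝓝 t) := by
    have := hn.add (tendsto_inv_atTop_zero (𝕜 := ℝ))
    rw [add_zero] at this
    refine this.congr fun V => ?_
    rw [add_div, one_div]
  have hlog : Tendsto (fun V : ℝ => Real.log V / V) atTop (𝓝 0) :=
    Real.isLittleO_log_id_atTop.tendsto_div_nhds_zero
  have hlim : Tendsto (fun V : ℝ => (⌊V * t⌋₊ : ℝ) / V * (Real.log q + 1) -
      ((⌊V * t⌋₊ : ℝ) + 1) / V * Real.log (((⌊V * t⌋₊ : ℝ) + 1) / V) - Real.log V / V) atTop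
      (𝓝 (t * (Real.log q + 1) - t * Real.log t - 0)) :=
    ((hn.mul_const _).sub (hn1.mul (hn1.log ht.ne'))).sub hlog
  have hval : t * (1 - Real.log (t / q)) - ε < t * (Real.log q + 1) - t * Real.log t - 0 := by
    rw [Real.log_div ht.ne' hq.ne']
    linarith
  filter_upwards [hlim.eventually (lt_mem_nhds hval), eventually_gt_atTop 0] with V hV hV0
  set n := ⌊V * t⌋₊
  have hpos : 0 < (V * q) ^ n / (n.factorial : ℝ) := by positivity
  rw [← Real.le_log_iff_exp_le hpos, Real.log_div (x := (V * q) ^ n) (by positivity) (by positivity),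
    Real.log_pow, Real.log_mul hV0.ne' hq.ne']
  have h1 := log_factorial_le n
  have h2 : Real.log ((n : ℝ) + 1) = Real.log (((n : ℝ) + 1) / V) + Real.log V := by
    rw [Real.log_div (by positivity) hV0.ne']
    ring
  have h3 := (mul_lt_mul_of_pos_left hV hV0).le
  refine h3.trans ?_
  rw [h2] at h1
  have e : V * ((n : ℝ) / V * (Real.log q + 1) - ((n : ℝ) + 1) / V *
      Real.log (((n : ℝ) + 1) / V) - Real.log V / V) =
      n * (Real.log q + 1) - (n + 1) * Real.log (((n : ℝ) + 1) / V) - Real.log V := by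
    field_simp
  rw [e]
  linarith

/-- Finitely many cycle lengths fall short of the target density at the exact slope, so the slope is
raised by at most ε. -/
lemma exists_finset_le_sum_tilted (hβ : 0 < β) (ha : 0 < a) (u : ℝ) {ε : ℝ} (hε : 0 < ε) :
    ∃ s₁ : ℝ, statSlope d β a u ≤ s₁ ∧ s₁ ≤ statSlope d β a u + ε ∧ ∃ A : Finset ℕ+,
      statDensity d β a u ≤ ∑ k ∈ A, (k : ℝ) * cycleWeight d β k * Real.exp (β * s₁ * k) := by
  rcases (statSlope_nonpos (d := d) hβ ha u).lt_or_eq with hu | hu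
  · obtain ⟨s₁, h1, h2⟩ := exists_between (lt_min hu (show statSlope d β a u <
      statSlope d β a u + ε by linarith))
    have h3 : s₁ < 0 := h2.trans_le (min_le_left _ _)
    refine ⟨s₁, h1.le, (h2.trans_le (min_le_right _ _)).le, ?_⟩
    have h4 := strictMonoOn_cycleMoment (d := d) hβ 1 hu h3 h1
    rw [← statDensity_of_neg hβ ha hu] at h4
    obtain ⟨A, hA⟩ := ((tendsto_order.1 (summable_cycleMoment (d := d) hβ 1 h3).hasSum).1 _
      h4).exists
    refine ⟨A, hA.le.trans (le_of_eq ?_)⟩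
    simp only [pow_one]
  -- In the condensed case the slope becomes positive, which is harmless for finite sums: a single
  -- large `k` has exponentially large weight and carries the whole density.
  · refine ⟨ε, by rw [hu]; exact hε.le, by rw [hu, zero_add], ?_⟩
    have h1 := (tendsto_exp_mul_div_rpow_atTop ((d : ℝ) / 2) (β * ε) (mul_pos hβ hε)).comp
      tendsto_natCast_atTop_atTop
    have hc := cycleWeight_const_pos (d := d) hβ
    obtain ⟨k, hk1, hk2⟩ := ((h1.eventually_ge_atTop
      (statDensity d β a u * (4 * Real.pi * β) ^ ((d : ℝ) / 2))).and
      (eventually_gt_atTop 0)).exists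
    lift k to ℕ+ using hk2
    refine ⟨{k}, ?_⟩
    rw [Finset.sum_singleton, natCast_mul_cycleWeight]
    simp only [Function.comp_apply] at hk1
    rw [mul_assoc, one_div, ← div_eq_inv_mul, le_div_iff₀ hc, ← div_eq_inv_mul]
    exact hk1

/-- The free energy `f_0(β, x)` is approached by tilted weights on finitely many cycle lengths. -/
lemma exists_finite_tilt (hd : 1 ≤ d) (hβ : 0 < β) (ha : 0 < a) (u : ℝ) {ε : ℝ} (hε : 0 < ε) :
    ∃ (A : Finset ℕ+) (s : ℝ),
      ∑ k ∈ A, (k : ℝ) * cycleWeight d β k * Real.exp (β * s * k) = statDensity d β a u ∧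
      s * statDensity d β a u - β⁻¹ * ∑ k ∈ A, cycleWeight d β k * Real.exp (β * s * k) ≤
        statSlope d β a u * statDensity d β a u - idealPressure d β (statSlope d β a u) + ε := by
  classical
  set x := statDensity d β a u
  set t := statSlope d β a u
  have hx : 0 < x := statDensity_pos hβ ha u
  have ht : t ≤ 0 := statSlope_nonpos hβ ha u
  -- The tolerance ε/(2x) makes the change of slope cost at most ε/2 in s x; the other half pays for
  -- truncating the pressure.
  obtain ⟨s₁, h1, h2, A₀, hA₀⟩ := exists_finset_le_sum_tilted (d := d) hβ ha u
    (ε := ε / (2 * x)) (by positivity)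
  have h3 : β * (idealPressure d β t - ε / 2) <
      ∑' k : ℕ+, cycleWeight d β k * Real.exp (β * t * k) := by
    rw [idealPressure_eq]
    have : 0 < β * (ε / 2) := by positivity
    rw [mul_sub, mul_inv_cancel_left₀ hβ.ne']
    linarith
  obtain ⟨A₁, hA₁⟩ := ((tendsto_order.1 (summable_cycleWeight_mul_exp hd hβ ht).hasSum).1 _
    h3).exists
  set A := A₀ ∪ A₁
  have hw : ∀ (k : ℕ+) (s : ℝ), 0 ≤ cycleWeight d β k * Real.exp (β * s * k) := fun k s =>
    mul_nonneg (cycleWeight_pos hβ k).le (Real.exp_pos _).le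
  have hlow : ∑ k ∈ A, (k : ℝ) * cycleWeight d β k * Real.exp (β * t * k) ≤ x := by
    rcases ht.lt_or_eq with h | h
    · rw [show x = cycleMoment d β 1 t from statDensity_of_neg hβ ha h]
      exact sum_le_cycleMoment_one hβ h A
    · have hcr : criticalDensity d β ≤ (x : EReal) := by
        have hx' : x = u / a := by simp only [x, statDensity]; rw [show statSlope d β a u = 0 from h, sub_zero]
        rw [hx']
        by_contra! hc
        exact ((statSlope_neg_iff hβ ha).2 hc).ne h
      rw [h]
      simp only [mul_zero, zero_mul, Real.exp_zero, mul_one]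
      by_contra! hc
      have hd3 : 3 ≤ d := by
        by_contra hd3
        rw [criticalDensity_of_not_three_le hd3, top_le_iff] at hcr
        exact EReal.coe_ne_top x hcr
      rw [criticalDensity_of_three_le hd3, EReal.coe_le_coe_iff] at hcr
      have := (summable_natCast_mul_cycleWeight (β := β) hd3).sum_le_tsum A fun k _ =>
        mul_nonneg (pnat_pos k).le (cycleWeight_pos hβ k).le
      linarith
  have hup : x ≤ ∑ k ∈ A, (k : ℝ) * cycleWeight d β k * Real.exp (β * s₁ * k) := by
    refine hA₀.trans (Finset.sum_le_sum_of_subset_of_nonneg Finset.subset_union_left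
      fun k _ _ => ?_)
    rw [mul_assoc]
    exact mul_nonneg (pnat_pos k).le (hw k s₁)
  have hc : Continuous fun s : ℝ =>
      ∑ k ∈ A, (k : ℝ) * cycleWeight d β k * Real.exp (β * s * k) := by fun_prop
  obtain ⟨s, hs, hsx⟩ := intermediate_value_Icc h1 hc.continuousOn (Set.mem_Icc.2 ⟨hlow, hup⟩)
  refine ⟨A, s, hsx, ?_⟩
  have h4 : s * x ≤ t * x + ε / 2 := by
    have : s * x ≤ (t + ε / (2 * x)) * x := by
      refine mul_le_mul_of_nonneg_right (hs.2.trans h2) hx.le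
    refine this.trans (le_of_eq ?_)
    field_simp
  have h5 : β * (idealPressure d β t - ε / 2) ≤
      ∑ k ∈ A, cycleWeight d β k * Real.exp (β * s * k) := by
    refine hA₁.le.trans ?_
    refine (Finset.sum_le_sum_of_subset_of_nonneg Finset.subset_union_right
      fun k _ _ => hw k t).trans (Finset.sum_le_sum fun k _ => ?_)
    have := (cycleWeight_pos (d := d) hβ k).le
    have := hs.1
    gcongr
  have h6 : idealPressure d β t - ε / 2 ≤
      β⁻¹ * ∑ k ∈ A, cycleWeight d β k * Real.exp (β * s * k) := by
    rw [← div_eq_inv_mul, le_div_iff₀ hβ, mul_comm]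
    exact h5
  linarith

/-- The trial configuration of the lower bound, described only through its products and sums: short
counts on `A` and `e` cycles of one further length `K`. -/
lemma exists_cycleCounts (A : Finset ℕ+) (K : ℕ+) (c : ℕ+ → ℕ) (e : ℕ) (hK : K ∉ A) :
    ∃ n : CycleCounts,
      (∀ f : ℕ+ → ℕ → ℝ, (∀ k, f k 0 = 1) → n.prod f = f K e * ∏ k ∈ A, f k (c k)) ∧
      ∀ f : ℕ+ → ℕ → ℝ, (∀ k, f k 0 = 0) → n.sum f = f K e + ∑ k ∈ A, f k (c k) := by
  classical
  set n : CycleCounts := Finsupp.indicator (insert K A) fun k _ => if k ∈ A then c k else e with hn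
  have hsub : n.support ⊆ insert K A := Finsupp.support_indicator_subset _ _
  have hnK : n K = e := by
    rw [hn, Finsupp.indicator_of_mem (Finset.mem_insert_self K A), if_neg hK]
  have hnA : ∀ k ∈ A, n k = c k := fun k hk => by
    rw [hn, Finsupp.indicator_of_mem (Finset.mem_insert_of_mem hk), if_pos hk]
  refine ⟨n, fun f hf => ?_, fun f hf => ?_⟩
  · rw [Finsupp.prod_of_support_subset n hsub f fun k _ => hf k, Finset.prod_insert hK, hnK]
    congr 1
    exact Finset.prod_congr rfl fun k hk => by rw [hnA k hk]
  · rw [Finsupp.sum_of_support_subset n hsub f fun k _ => hf k, Finset.sum_insert hK, hnK]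
    congr 1
    exact Finset.sum_congr rfl fun k hk => by rw [hnA k hk]

/-- The weight of a single long cycle is not exponentially small. -/
lemma eventually_exp_le_cycleWeight (hβ : 0 < β) (R : ℝ) {ε : ℝ} (hε : 0 < ε) :
    ∀ᶠ V : ℝ in atTop, ∀ K : ℕ+, (K : ℝ) ≤ R * V →
      Real.exp (-(ε * V)) ≤ V * cycleWeight d β K := by
  set p : ℝ := 1 + (d : ℝ) / 2
  have hp : 0 < p := by positivity
  have hc := cycleWeight_const_pos (d := d) hβ
  set c := (4 * Real.pi * β) ^ ((d : ℝ) / 2)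
  have hlim := (tendsto_rpow_mul_exp_neg_mul_atTop_nhds_zero p ε hε).const_mul (c * |R| ^ p)
  rw [mul_zero] at hlim
  filter_upwards [hlim.eventually (gt_mem_nhds one_pos), eventually_ge_atTop 1] with V h1 h2 K hK
  have hV : 0 < V := by linarith
  have hKp : 0 < (K : ℝ) ^ p := Real.rpow_pos_of_pos (pnat_pos K) p
  have h3 : (K : ℝ) ^ p ≤ |R| ^ p * V ^ p := by
    rw [← Real.mul_rpow (abs_nonneg R) hV.le]
    refine Real.rpow_le_rpow (pnat_pos K).le (hK.trans ?_) hp.le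
    exact mul_le_mul_of_nonneg_right (le_abs_self R) hV.le
  have h4 : Real.exp (-(ε * V)) * (c * (K : ℝ) ^ p) ≤ 1 := by
    calc Real.exp (-(ε * V)) * (c * (K : ℝ) ^ p)
        ≤ Real.exp (-(ε * V)) * (c * (|R| ^ p * V ^ p)) := by gcongr
      _ = c * |R| ^ p * (V ^ p * Real.exp (-ε * V)) := by rw [neg_mul]; ring
      _ ≤ 1 := h1.le
  have h5 : cycleWeight d β K = 1 / (c * (K : ℝ) ^ p) := rfl
  rw [h5, mul_one_div, le_div_iff₀ (by positivity)]
  linarith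

/-- The partition function is at least `exp (-βV (inf F + ε))`. -/
lemma eventually_exp_le_tsum_gibbsWeight (hd : 1 ≤ d) (hβ : 0 < β) (hb : 0 < b) (hab : b < a)
    {κ : ℝ≥0∞} {μ y ε : ℝ} (hy : IsLongDensity κ y) (hε : 0 < ε) {V : ℕ → ℝ} {m : ℕ → ℕ}
    (hV : Tendsto V atTop atTop) (hm : Tendsto m atTop atTop)
    (hκ : Tendsto (fun i => ENNReal.ofReal (m i / V i)) atTop (𝓝 κ)) :
    ∀ᶠ i in atTop, Real.exp (β * V i * (meanFieldPressure d β a μ - energyGap d β a b μ y - ε)) ≤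
      ∑' n, gibbsWeight d β μ a b (V i) (m i) n := by
  have ha : 0 < a := hb.trans hab
  -- one cycle of length about `V y`
  obtain ⟨K, e, he, hKm, hKy, hKq⟩ : ∃ (K : ℕ → ℕ+) (e : ℕ), (e = 0 ∨ e = 1) ∧
      (∀ᶠ i in atTop, m i ≤ (K i : ℕ)) ∧
      Tendsto (fun i => (K i : ℝ) * ((e : ℝ) / V i)) atTop (𝓝 y) ∧
      (e = 1 → ∀ᶠ i in atTop, (K i : ℝ) ≤ (y + 1) * V i) := by
    have hmpos : ∀ i, 0 < max (m i) 1 := fun i => by positivity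
    rcases hy.1.eq_or_lt with h0 | h0
    · refine ⟨fun i => ⟨max (m i) 1, hmpos i⟩, 0, Or.inl rfl,
        Eventually.of_forall fun i => le_max_left _ _, ?_, fun h => by simp at h⟩
      rw [← h0]
      simp
    · have hκy : κ ≤ ENNReal.ofReal y := hy.2.resolve_left h0.ne'
      have hκt : κ ≠ ⊤ := ne_top_of_le_ne_top ENNReal.ofReal_ne_top hκy
      have hmV : Tendsto (fun i => (m i : ℝ) / V i) atTop (𝓝 κ.toReal) := by
        refine ((ENNReal.tendsto_toReal hκt).comp hκ).congr' ?_
        filter_upwards [hV.eventually_ge_atTop 0] with i hi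
        exact ENNReal.toReal_ofReal (by positivity)
      have hκy' : κ.toReal ≤ y := ENNReal.toReal_le_of_le_ofReal h0.le hκy
      have hceil : Tendsto (fun i => (⌈y * V i⌉₊ : ℝ) / V i) atTop (𝓝 y) :=
        (tendsto_nat_ceil_mul_div_atTop (R := ℝ) h0.le).comp hV
      -- The length must reach the cut-off, yet m/V → κ ≤ y, so taking the maximum with `m` does not
      -- change the limit y.
      have hK : ∀ i, 0 < max (max (m i) 1) ⌈y * V i⌉₊ := fun i => lt_max_of_lt_left (hmpos i)
      have hlim : Tendsto (fun i => ((max (max (m i) 1) ⌈y * V i⌉₊ : ℕ) : ℝ) / V i) atTop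
          (𝓝 y) := by
        have h1 := (hmV.max (tendsto_inv_atTop_zero.comp hV)).max hceil
        have h2 : max (max κ.toReal 0) y = y :=
          max_eq_right (max_le hκy' h0.le)
        rw [h2] at h1
        refine h1.congr' ?_
        filter_upwards [hV.eventually_gt_atTop 0] with i hi
        simp only [Function.comp_apply, Nat.cast_max, Nat.cast_one]
        rw [← one_div, max_div_div_right hi.le, max_div_div_right hi.le]
      refine ⟨fun i => ⟨_, hK i⟩, 1, Or.inr rfl,
        Eventually.of_forall fun i => (le_max_left _ _).trans (le_max_left _ _), ?_, fun _ => ?_⟩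
      · refine hlim.congr fun i => ?_
        simp only [PNat.mk_coe, Nat.cast_one]
        rw [mul_one_div]
      · filter_upwards [hlim.eventually (gt_mem_nhds (show y < y + 1 by linarith)),
          hV.eventually_gt_atTop 0] with i h1 h2
        simp only [PNat.mk_coe]
        exact ((div_lt_iff₀ h2).1 h1).le
  set ν := μ - a * y with hν
  set x := statDensity d β a ν with hx
  obtain ⟨A, s, hAx, hAs⟩ := exists_finite_tilt (d := d) hd hβ ha ν (show 0 < ε / 4 by positivity)
  rw [← hx] at hAx hAs
  set t : ℕ+ → ℝ := fun k => cycleWeight d β k * Real.exp (β * s * k) with ht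
  have htpos : ∀ k, 0 < t k := fun k => mul_pos (cycleWeight_pos hβ k) (Real.exp_pos _)
  have hlogt : ∀ k, Real.log (t k / cycleWeight d β k) = β * s * k := fun k => by
    rw [ht]
    simp only
    rw [mul_div_cancel_left₀ _ (cycleWeight_pos hβ k).ne', Real.log_exp]
  -- The error ε is split into quarters: the finite tilt, the long cycle, the Poisson asymptotics
  -- over all of `A`, and the limit of the energy.
  set δ := β * ε / (4 * ((A.card : ℝ) + 1)) with hδ
  have hδpos : 0 < δ := by positivity
  have hP : ∀ᶠ i in atTop, ∀ k ∈ A, Real.exp (V i * (t k * (1 - β * s * k) - δ)) ≤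
      (V i * cycleWeight d β k) ^ ⌊V i * t k⌋₊ / (⌊V i * t k⌋₊.factorial : ℝ) := by
    rw [Filter.eventually_all_finset]
    intro k _
    have := hV.eventually (eventually_exp_le_poisson (cycleWeight_pos (d := d) hβ k) (htpos k) hδpos)
    simpa only [hlogt] using this
  have hQ : ∀ᶠ i in atTop, Real.exp (-(β * ε / 4 * V i)) ≤
      (V i * cycleWeight d β (K i)) ^ e / (e.factorial : ℝ) := by
    rcases he with rfl | rfl
    · filter_upwards [hV.eventually_ge_atTop 0] with i hi
      have h : 0 ≤ β * ε / 4 * V i := by positivity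
      simpa using h
    · filter_upwards [hKq rfl, hV.eventually (eventually_exp_le_cycleWeight (d := d) hβ (y + 1)
        (show 0 < β * ε / 4 by positivity))] with i h1 h2
      simpa using h2 (K i) h1
  have hKA : ∀ᶠ i in atTop, ∀ k ∈ A, (k : ℕ) < m i := by
    rw [Filter.eventually_all_finset]
    intro k _
    exact hm.eventually_gt_atTop _
  have hshort : Tendsto (fun i => ∑ k ∈ A, (k : ℝ) * ((⌊V i * t k⌋₊ : ℝ) / V i)) atTop (𝓝 x) := by
    rw [← hAx]
    refine tendsto_finsetSum _ fun k _ => ?_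
    rw [mul_assoc]
    refine Tendsto.const_mul _ ?_
    refine ((tendsto_nat_floor_mul_div_atTop (R := ℝ) (htpos k).le).comp hV).congr fun i => ?_
    simp only [Function.comp_apply]
    rw [mul_comm]
  have hG : Tendsto (fun i => μ * ((K i : ℝ) * ((e : ℝ) / V i) +
      ∑ k ∈ A, (k : ℝ) * ((⌊V i * t k⌋₊ : ℝ) / V i)) - a / 2 * ((K i : ℝ) * ((e : ℝ) / V i) +
      ∑ k ∈ A, (k : ℝ) * ((⌊V i * t k⌋₊ : ℝ) / V i)) ^ 2 +
      b / 2 * ((K i : ℝ) * ((e : ℝ) / V i)) ^ 2) atTop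
      (𝓝 (μ * (y + x) - a / 2 * (y + x) ^ 2 + b / 2 * y ^ 2)) :=
    (((hKy.add hshort).const_mul μ).sub (((hKy.add hshort).pow 2).const_mul (a / 2))).add
      ((hKy.pow 2).const_mul (b / 2))
  have hG' := hG.eventually (lt_mem_nhds (show μ * (y + x) - a / 2 * (y + x) ^ 2 + b / 2 * y ^ 2 -
    ε / 4 < _ by linarith))
  filter_upwards [hP, hQ, hKA, hKm, hG', hV.eventually_gt_atTop 0] with i hP hQ hKA hKm hG hVi
  have hKnA : K i ∉ A := fun h => (hKA _ h).not_ge hKm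
  obtain ⟨n, hnp, hns⟩ := exists_cycleCounts A (K i) (fun k => ⌊V i * t k⌋₊) e hKnA
  have hρ : particleDensity (V i) n = (K i : ℝ) * ((e : ℝ) / V i) +
      ∑ k ∈ A, (k : ℝ) * ((⌊V i * t k⌋₊ : ℝ) / V i) := hns _ (by simp)
  have hsq : longSquare (V i) (m i) n = ((K i : ℝ) * ((e : ℝ) / V i)) ^ 2 := by
    rw [longSquare, hns _ (by simp), if_pos hKm, Finset.sum_eq_zero fun k hk =>
      if_neg (hKA k hk).not_ge]
    ring
  have hprod : poissonProd (fun k => V i * cycleWeight d β k) n =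
      (V i * cycleWeight d β (K i)) ^ e / (e.factorial : ℝ) *
        ∏ k ∈ A, (V i * cycleWeight d β k) ^ ⌊V i * t k⌋₊ / (⌊V i * t k⌋₊.factorial : ℝ) :=
    hnp _ (by simp)
  have hW : gibbsWeight d β μ a b (V i) (m i) n ≤
      ∑' n, gibbsWeight d β μ a b (V i) (m i) n :=
    (summable_gibbsWeight hd hβ hb hab hVi μ (m i)).le_tsum n fun n' _ =>
      (gibbsWeight_pos hβ hVi μ (m i) n').le
  refine le_trans ?_ hW
  have hprod' : Real.exp (-(β * ε / 4 * V i) +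
      ∑ k ∈ A, V i * (t k * (1 - β * s * k) - δ)) ≤
      poissonProd (fun k => V i * cycleWeight d β k) n := by
    rw [hprod, Real.exp_add, Real.exp_sum]
    refine mul_le_mul hQ (Finset.prod_le_prod (fun k _ => (Real.exp_pos _).le) hP)
      (Finset.prod_nonneg fun k _ => (Real.exp_pos _).le) ((Real.exp_pos _).le.trans hQ)
  rw [gibbsWeight, hρ, hsq]
  refine le_trans ?_ (mul_le_mul hprod' (Real.exp_le_exp.2 (mul_le_mul_of_nonneg_left hG.le
    (mul_pos hβ hVi).le)) (Real.exp_pos _).le ((Real.exp_pos _).le.trans hprod'))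
  rw [← Real.exp_add]
  refine Real.exp_le_exp.2 ?_
  have hsum : ∑ k ∈ A, V i * (t k * (1 - β * s * k) - δ) =
      V i * (∑ k ∈ A, t k - β * s * x - A.card * δ) := by
    rw [← Finset.mul_sum, Finset.sum_sub_distrib, Finset.sum_const, nsmul_eq_mul, ← hAx,
      Finset.mul_sum, ← Finset.sum_sub_distrib]
    congr 2
    refine Finset.sum_congr rfl fun k _ => ?_
    simp only [ht]
    ring
  have hcard : (A.card : ℝ) * δ ≤ β * ε / 4 := by
    have : 0 < (A.card : ℝ) + 1 := by positivity
    rw [hδ, mul_div_assoc', div_le_div_iff₀ (by positivity) (by norm_num)]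
    have : 0 < β * ε := by positivity
    nlinarith
  have hent : β * (s * x) - β * (statSlope d β a ν * x - idealPressure d β (statSlope d β a ν) +
      ε / 4) ≤ ∑ k ∈ A, t k := by
    have := mul_le_mul_of_nonneg_left hAs hβ.le
    rw [mul_sub, mul_inv_cancel_left₀ hβ.ne'] at this
    linarith
  have hgap : meanFieldPressure d β a μ - energyGap d β a b μ y =
      -(statSlope d β a ν * x - idealPressure d β (statSlope d β a ν)) +
        (μ * (y + x) - a / 2 * (y + x) ^ 2 + b / 2 * y ^ 2) := by
    have h1 := mul_statDensity (d := d) (β := β) ha ν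
    rw [energyGap, ← hν, meanFieldPressure, meanFieldPressure]
    rw [← hx] at h1
    rw [← h1, show statSlope d β a ν = ν - a * x by linarith, hν]
    field_simp
    ring
  rw [hgap, hsum]
  have hfin : β * (-(statSlope d β a ν * x - idealPressure d β (statSlope d β a ν)) +
      (μ * (y + x) - a / 2 * (y + x) ^ 2 + b / 2 * y ^ 2) - ε) ≤
      -(β * ε / 4) + (∑ k ∈ A, t k - β * s * x - A.card * δ) +
        β * (μ * (y + x) - a / 2 * (y + x) ^ 2 + b / 2 * y ^ 2 - ε / 4) := by
    linarith
  have := mul_le_mul_of_nonneg_left hfin hVi.le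
  linarith

end LowerBound

/-! ### Concentration of the long-cycle density -/

section Concentration

variable {d : ℕ} {β a b : ℝ}

/-- Away from the equilibrium the gap exceeds its minimum, uniformly along the sequence. -/
lemma exists_energyGap_margin (hd : 1 ≤ d) (hβ : 0 < β) (hb : 0 < b) (hab : b < a)
    {κ : ℝ≥0∞} {μ y δ : ℝ} (hy : IsEquilibrium d β a b κ μ y) (hδ : 0 < δ) {V : ℕ → ℝ} {m : ℕ → ℕ}
    (hV : Tendsto V atTop atTop)
    (hκ : Tendsto (fun i => ENNReal.ofReal (m i / V i)) atTop (𝓝 κ)) :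
    ∃ η > 0, ∀ᶠ i in atTop, ∀ j : ℕ, (j = 0 ∨ m i ≤ j) → δ ≤ |j / V i - y| →
      energyGap d β a b μ y + η * (1 + j / V i) ≤ energyGap d β a b μ (j / V i) := by
  have ha : 0 < a := hb.trans hab
  -- Compactness: failure for every η gives a sequence of admissible densities at distance at least
  -- δ from `y` with nearly minimal gap. Coercivity bounds it, and a limit point contradicts
  -- uniqueness of the equilibrium.
  by_contra! hcon
  have hex : ∀ n : ℕ, ∃ i, n ≤ i ∧ 0 < V i ∧ ∃ j : ℕ, (j = 0 ∨ m i ≤ j) ∧ δ ≤ |j / V i - y| ∧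
      energyGap d β a b μ (j / V i) < energyGap d β a b μ y + 1 / ((n : ℝ) + 1) * (1 + j / V i) :=
    fun n => by
      obtain ⟨i, ⟨j, h1, h2, h3⟩, h4, h5⟩ := ((hcon (1 / ((n : ℝ) + 1)) (by positivity)).and_eventually
        ((eventually_ge_atTop n).and (hV.eventually_gt_atTop 0))).exists
      exact ⟨i, h4, h5, j, h1, h2, h3⟩
  choose i hin hVi j hj hjδ hjE using hex
  set z : ℕ → ℝ := fun n => j n / V (i n) with hz
  have hz0 : ∀ n, 0 ≤ z n := fun n => div_nonneg (by positivity) (hVi n).le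
  have hn1 : ∀ n : ℕ, 1 / ((n : ℝ) + 1) ≤ 1 := fun n => by
    rw [div_le_one (by positivity)]
    linarith [(Nat.cast_nonneg n : (0 : ℝ) ≤ n)]
  set c := (a - b) / 2 with hc
  have hcpos : 0 < c := by simp only [hc]; linarith
  set E := energyGap d β a b μ y
  set R := 1 + (|E + 1| + |μ + 1|) / c with hR
  have hzR : ∀ n, z n ≤ R := fun n => by
    by_contra! h
    have h1 := le_energyGap (d := d) (b := b) hd hβ ha (μ := μ) (hz0 n)
    have h2 : energyGap d β a b μ (z n) < E + 1 / ((n : ℝ) + 1) * (1 + z n) := hjE n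
    rw [← hc] at h1
    have h3 : 1 / ((n : ℝ) + 1) * (1 + z n) ≤ 1 * (1 + z n) :=
      mul_le_mul_of_nonneg_right (hn1 n) (by linarith [hz0 n])
    have h4 : |E + 1| + |μ + 1| < c * (z n - 1) := by
      rw [hR] at h
      have : (|E + 1| + |μ + 1|) / c < z n - 1 := by linarith
      rwa [div_lt_iff₀' hcpos] at this
    have h5 : 1 ≤ z n := by
      have : 0 ≤ (|E + 1| + |μ + 1|) / c := by positivity
      linarith
    have h6 : c * z n ^ 2 ≤ E + 1 + (μ + 1) * z n := by linarith
    have h7 := le_abs_self (E + 1)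
    have h8 := le_abs_self (μ + 1)
    nlinarith [abs_nonneg (E + 1), mul_le_mul_of_nonneg_right h8 (hz0 n)]
  obtain ⟨z₀, -, φ, hφ, hlim⟩ := isCompact_Icc.tendsto_subseq
    (fun n => Set.mem_Icc.2 ⟨hz0 n, hzR n⟩)
  have hcont := continuous_energyGap_right (d := d) (b := b) hd hβ ha μ
  have hi : Tendsto i atTop atTop := tendsto_atTop_mono hin tendsto_id
  -- A nonzero limit forces j ≠ 0, hence j ≥ m, and m/V → κ passes the constraint to the limit.
  have hadm : IsLongDensity κ z₀ := by
    refine ⟨ge_of_tendsto' hlim fun n => hz0 _, ?_⟩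
    by_cases h0 : z₀ = 0
    · exact Or.inl h0
    · right
      have hz₀ : 0 < z₀ := lt_of_le_of_ne (ge_of_tendsto' hlim fun n => hz0 _) (Ne.symm h0)
      have h1 := hκ.comp (hi.comp hφ.tendsto_atTop)
      have h2 := (ENNReal.continuous_ofReal.tendsto z₀).comp hlim
      refine le_of_tendsto_of_tendsto h1 h2 ?_
      filter_upwards [hlim.eventually (lt_mem_nhds hz₀)] with n hn
      refine ENNReal.ofReal_le_ofReal ?_
      have hV' := hVi (φ n)
      have hjne : j (φ n) ≠ 0 := by
        intro h
        simp only [Function.comp_apply, hz, h, Nat.cast_zero, zero_div] at hn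
        exact hn.false
      have : (m (i (φ n)) : ℝ) ≤ j (φ n) := by
        exact_mod_cast (hj (φ n)).resolve_left hjne
      simp only [Function.comp_apply, hz]
      gcongr
  have hle : energyGap d β a b μ z₀ ≤ E := by
    have h1 : Tendsto (fun n => E + 1 / (((φ n : ℕ) : ℝ) + 1) * (1 + z (φ n))) atTop
        (𝓝 (E + 0 * (1 + z₀))) :=
      ((tendsto_one_div_add_atTop_nhds_zero_nat.comp hφ.tendsto_atTop).mul
        (hlim.const_add 1)).const_add E
    rw [zero_mul, add_zero] at h1
    exact le_of_tendsto_of_tendsto' ((hcont.tendsto z₀).comp hlim) h1 fun n => (hjE (φ n)).le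
  have hne : z₀ ≠ y := by
    rintro rfl
    have h1 : Tendsto (fun n => |z (φ n) - z₀|) atTop (𝓝 |z₀ - z₀|) := (hlim.sub_const z₀).abs
    have h2 := ge_of_tendsto' h1 fun n => hjδ (φ n)
    rw [sub_self, abs_zero] at h2
    linarith
  exact (hy.2 z₀ hadm hne).not_ge hle

/-- The expected distance of the long-cycle density from `y` is bounded by `δ` and the weight of
the configurations at distance at least `δ`. -/
lemma abs_integral_longCycleDensity_sub_le (hd : 1 ≤ d) (hβ : 0 < β) (hb : 0 < b) (hab : b < a)
    {V : ℝ} (hV : 0 < V) (α μ y : ℝ) {δ B : ℝ} (hδ : 0 ≤ δ) (m : ℕ) {u : ℕ → ℝ} (hu : Summable u)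
    (hu0 : ∀ j, 0 ≤ u j) (huB : ∑' j, u j ≤ B * ∑' n, gibbsWeight d β μ a b V m n)
    (hgu : ∀ j : ℕ, (j = 0 ∨ m ≤ j) → δ ≤ |j / V - y| →
      |j / V - y| * Real.exp (V * longWeight d β m +
        β * V * (meanFieldPressure d β a μ - energyGap d β a b μ (j / V))) ≤ u j) :
    |∫ n, longCycleDensity V m n ∂(gibbsMeasure d β α μ a b V m) - y| ≤ δ + B := by
  have ha : 0 < a := hb.trans hab
  have hW := summable_gibbsWeight (d := d) hd hβ hb hab hV μ m
  have hM := summable_gibbs_longCycleDensity (d := d) hd hβ hb hab hV μ m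
  have hZ := tsum_gibbsWeight_pos hβ hV μ hW
  have hM' : Summable fun n => gibbsWeight d β μ a b V m n * longCycleDensity V m n := by
    refine hM.congr fun n => ?_
    rw [longCycleDensity_eq, abs_of_nonneg (by positivity)]
  classical
  set g : ℕ → ℝ := fun j => if δ ≤ |j / V - y| then |j / V - y| else 0 with hg
  obtain ⟨hgs, hgle⟩ := gibbs_sum_le (d := d) (b := b) hd hβ ha hb hV μ m (g := g) (u := u)
    (fun j => by simp only [hg]; split_ifs <;> positivity) hu hu0 (fun j hj => by
      simp only [hg]
      split_ifs with h
      · exact hgu j hj h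
      · rw [zero_mul]
        exact hu0 j)
  rw [integral_gibbsMeasure hβ hV α μ hW hM]
  set Z := ∑' n, gibbsWeight d β μ a b V m n
  have hdiff : (∑' n, gibbsWeight d β μ a b V m n * longCycleDensity V m n) / Z - y =
      (∑' n, gibbsWeight d β μ a b V m n * (longCycleDensity V m n - y)) / Z := by
    simp_rw [mul_sub]
    rw [hM'.tsum_sub (hW.mul_right y), tsum_mul_right, sub_div, mul_div_cancel_left₀ _ hZ.ne']
  have hbound : ∀ n, |gibbsWeight d β μ a b V m n * (longCycleDensity V m n - y)| ≤
      δ * gibbsWeight d β μ a b V m n + gibbsWeight d β μ a b V m n * g (longCount m n) := by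
    intro n
    have hw := gibbsWeight_pos (d := d) (a := a) (b := b) hβ hV μ m n
    rw [abs_mul, abs_of_pos hw, mul_comm δ, ← mul_add]
    refine mul_le_mul_of_nonneg_left ?_ hw.le
    rw [longCycleDensity_eq]
    simp only [hg]
    split_ifs with h
    · linarith
    · linarith [not_le.1 h]
  have hS := (hW.mul_left δ).add hgs
  rw [hdiff, abs_div, abs_of_pos hZ, div_le_iff₀ hZ]
  have habs := Summable.of_nonneg_of_le (fun n => abs_nonneg _) hbound hS
  have hnorm : Summable fun n =>
      ‖gibbsWeight d β μ a b V m n * (longCycleDensity V m n - y)‖ := by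
    simpa only [Real.norm_eq_abs] using habs
  have htri := norm_tsum_le_tsum_norm hnorm
  simp only [Real.norm_eq_abs] at htri
  calc |∑' n, gibbsWeight d β μ a b V m n * (longCycleDensity V m n - y)|
      ≤ ∑' n, |gibbsWeight d β μ a b V m n * (longCycleDensity V m n - y)| := by
        exact htri
    _ ≤ ∑' n, (δ * gibbsWeight d β μ a b V m n +
          gibbsWeight d β μ a b V m n * g (longCount m n)) := habs.tsum_le_tsum hbound hS
    _ = δ * Z + ∑' n, gibbsWeight d β μ a b V m n * g (longCount m n) := by
        rw [(hW.mul_left δ).tsum_add hgs, tsum_mul_left]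
    _ ≤ (δ + B) * Z := by
        rw [add_mul]
        linarith

/-- Writing E for the mean-field pressure at μ minus the minimal gap, a far fibre has weight at most
e^{βV(E - 3η/4) - βηj}, while the partition function is at least e^{βV(E - η/4)}. The quotient is
e^{-βηV/2} times a series in j independent of V. -/
theorem tendsto_integral_longCycleDensity (hd : 1 ≤ d) (hβ : 0 < β) (hb : 0 < b) (hab : b < a)
    {κ : ℝ≥0∞} (α : ℝ) {μ y : ℝ} (hy : IsEquilibrium d β a b κ μ y) {V : ℕ → ℝ} {m : ℕ → ℕ}
    (hV : Tendsto V atTop atTop) (hm : Tendsto m atTop atTop)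
    (hκ : Tendsto (fun i => ENNReal.ofReal (m i / V i)) atTop (𝓝 κ)) :
    Tendsto (fun i => ∫ n, longCycleDensity (V i) (m i) n ∂(gibbsMeasure d β α μ a b (V i) (m i)))
      atTop (𝓝 y) := by
  rw [Metric.tendsto_atTop']
  intro ε hε
  obtain ⟨η, hη, hmargin⟩ := exists_energyGap_margin hd hβ hb hab hy (show 0 < ε / 2 by positivity)
    hV hκ
  have hlow := eventually_exp_le_tsum_gibbsWeight (d := d) (μ := μ) hd hβ hb hab hy.1
    (show 0 < η / 4 by positivity) hV hm hκ
  have hlong := ((tendsto_longWeight (d := d) hd hβ).comp hm).eventually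
    (gt_mem_nhds (show 0 < β * η / 4 by positivity))
  have hr : 0 < β * η := mul_pos hβ hη
  have hsum := summable_natCast_add_mul_exp |y| hr
  set C := ∑' j : ℕ, ((j : ℝ) + |y|) * Real.exp (-(β * η * j)) with hC
  have hsmall : Tendsto (fun i => C * Real.exp (-(β * η / 2 * V i))) atTop (𝓝 0) := by
    have h1 : Tendsto (fun i => β * η / 2 * V i) atTop atTop := hV.const_mul_atTop (by positivity)
    have := (Real.tendsto_exp_neg_atTop_nhds_zero.comp h1).const_mul C
    rwa [mul_zero] at this
  have hev : ∀ᶠ i in atTop, dist (∫ n, longCycleDensity (V i) (m i) n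
      ∂(gibbsMeasure d β α μ a b (V i) (m i))) y < ε := by
    filter_upwards [hmargin, hlow, hlong, hsmall.eventually (gt_mem_nhds (half_pos hε)),
      hV.eventually_ge_atTop 1] with i h1 h2 h3 h4 h5
    have hVi : 0 < V i := by linarith
    set E := meanFieldPressure d β a μ - energyGap d β a b μ y with hE
    set D := Real.exp (V i * (β * η / 4) + β * V i * (E - η)) with hD
    rw [Real.dist_eq]
    refine (abs_integral_longCycleDensity_sub_le hd hβ hb hab hVi α μ y (half_pos hε).le (m i)
      (u := fun j => D * (((j : ℝ) + |y|) * Real.exp (-(β * η * j)))) (hsum.mul_left D)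
      (fun j => by positivity) (B := C * Real.exp (-(β * η / 2 * V i))) ?_ ?_).trans_lt (by linarith)
    · rw [tsum_mul_left, ← hC]
      have hC0 : 0 ≤ C := tsum_nonneg fun j => by positivity
      have h6 : D ≤ Real.exp (-(β * η / 2 * V i)) *
          ∑' n, gibbsWeight d β μ a b (V i) (m i) n := by
        refine le_trans (le_of_eq ?_) (mul_le_mul_of_nonneg_left h2 (Real.exp_pos _).le)
        rw [← Real.exp_add, hD]
        congr 1
        ring
      calc D * C ≤ (Real.exp (-(β * η / 2 * V i)) *
            ∑' n, gibbsWeight d β μ a b (V i) (m i) n) * C := mul_le_mul_of_nonneg_right h6 hC0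
        _ = _ := by ring
    · intro j hj hjδ
      have h6 := h1 j hj hjδ
      have h7 : |(j : ℝ) / V i - y| ≤ j + |y| := by
        refine (abs_sub _ _).trans ?_
        rw [abs_of_nonneg (by positivity)]
        gcongr
        exact div_le_self (by positivity) h5
      rw [mul_left_comm, hD, ← Real.exp_add]
      refine mul_le_mul h7 (Real.exp_le_exp.2 ?_) (Real.exp_pos _).le (by positivity)
      have h8 : V i * longWeight d β (m i) ≤ V i * (β * η / 4) :=
        mul_le_mul_of_nonneg_left h3.le hVi.le
      have h9 : β * V i * (meanFieldPressure d β a μ - energyGap d β a b μ (j / V i)) ≤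
          β * V i * (E - η * (1 + j / V i)) := by
        refine mul_le_mul_of_nonneg_left ?_ (mul_pos hβ hVi).le
        rw [hE]
        linarith
      have h10 : β * V i * (E - η * (1 + j / V i)) = β * V i * (E - η) - β * η * j := by
        field_simp
        ring
      linarith
  obtain ⟨N, hN⟩ := eventually_atTop.1 hev
  exact ⟨N, fun n hn => hN n hn.le⟩

theorem IsEquilibrium.isLongCycleLimit (hd : 1 ≤ d) (hβ : 0 < β) (hb : 0 < b) (hab : b < a)
    {κ : ℝ≥0∞} {μ y : ℝ} (h : IsEquilibrium d β a b κ μ y) (α : ℝ) :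
    IsLongCycleLimit d β α a b κ μ y := by
  rintro Λ m ⟨hΛ, hV, hm, hκ⟩
  refine tendsto_integral_longCycleDensity hd hβ hb hab α h hV hm (hκ.congr' ?_)
  filter_upwards [hV.eventually_gt_atTop 0] with i hi
  obtain ⟨l, -, hl⟩ := hΛ i
  have hfin : volume (Λ i) ≠ ⊤ := by
    rw [hl]
    exact isCompact_Icc.measure_lt_top.ne
  rw [ENNReal.ofReal_div_of_pos hi, ENNReal.ofReal_natCast, Measure.real, ENNReal.ofReal_toReal hfin]

/-! ### Existence of thermodynamic sequences -/

/-- `IsLongCycleLimit` quantifies over all sequences, so without one such sequence a limit would not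
be determined. -/
lemma exists_isThermodynamicSequence (hd : 1 ≤ d) {κ : ℝ} (hκ : 0 ≤ κ) :
    ∃ Λ m, IsThermodynamicSequence d (ENNReal.ofReal κ) Λ m := by
  set l : ℕ → Fin d → ℝ := fun i _ => ((i : ℝ) + 1) ^ 2 with hl
  set V : ℕ → ℝ := fun i => (2 * ((i : ℝ) + 1) ^ 2) ^ d with hVdef
  have hvol : ∀ i, volume (Set.Icc (-l i) (l i)) = ENNReal.ofReal (V i) := fun i => by
    have h : ∀ j, l i j - (-l i) j = 2 * ((i : ℝ) + 1) ^ 2 := fun j => by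
      simp only [hl, Pi.neg_apply]
      ring
    simp only [Real.volume_Icc_pi, h, Finset.prod_const, Finset.card_univ, Fintype.card_fin]
    rw [← ENNReal.ofReal_pow (by positivity)]
  have hVlow : ∀ i : ℕ, ((i : ℝ) + 1) ^ 2 ≤ V i := fun i => by
    have h1 : (1 : ℝ) ≤ 2 * ((i : ℝ) + 1) ^ 2 := by
      have : (0 : ℝ) ≤ i := Nat.cast_nonneg i
      nlinarith
    have h2 := pow_le_pow_right₀ h1 hd
    rw [pow_one] at h2
    have : (0 : ℝ) ≤ ((i : ℝ) + 1) ^ 2 := by positivity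
    simp only [hVdef]
    linarith
  have hVpos : ∀ i, 0 < V i := fun i => by simp only [hVdef]; positivity
  have hVlim : Tendsto V atTop atTop := by
    refine tendsto_atTop_mono (fun i => ?_) tendsto_natCast_atTop_atTop
    refine le_trans ?_ (hVlow i)
    have : (0 : ℝ) ≤ i := Nat.cast_nonneg i
    nlinarith
  -- The summand `i` makes m → ∞ also when κ = 0. The quadratic side length keeps i/V → 0 already in
  -- dimension one.
  refine ⟨fun i => Set.Icc (-l i) (l i), fun i => ⌈κ * V i⌉₊ + i,
    fun i => ⟨l i, fun j => by simp only [hl]; positivity, rfl⟩, ?_, ?_, ?_⟩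
  · refine hVlim.congr fun i => ?_
    rw [Measure.real, hvol, ENNReal.toReal_ofReal (hVpos i).le]
  · exact tendsto_atTop_mono (fun i => Nat.le_add_left _ _) tendsto_id
  · have h1 : Tendsto (fun i => (⌈κ * V i⌉₊ : ℝ) / V i) atTop (𝓝 κ) :=
      (tendsto_nat_ceil_mul_div_atTop (R := ℝ) hκ).comp hVlim
    have h2 : Tendsto (fun i : ℕ => (i : ℝ) / V i) atTop (𝓝 0) := by
      refine squeeze_zero (fun i => div_nonneg (Nat.cast_nonneg i) (hVpos i).le) (fun i => ?_)
        tendsto_one_div_add_atTop_nhds_zero_nat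
      rw [div_le_div_iff₀ (hVpos i) (by positivity), one_mul]
      refine le_trans ?_ (hVlow i)
      have : (0 : ℝ) ≤ i := Nat.cast_nonneg i
      nlinarith
    have h3 := h1.add h2
    rw [add_zero] at h3
    refine ((ENNReal.continuous_ofReal.tendsto κ).comp h3).congr fun i => ?_
    simp only [Function.comp_apply]
    rw [hvol, ← add_div, ENNReal.ofReal_div_of_pos (hVpos i), ← Nat.cast_add,
      ENNReal.ofReal_natCast]

lemma IsLongCycleLimit.unique (hd : 1 ≤ d) {κ α μ r r' : ℝ} (hκ : 0 ≤ κ)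
    (h : IsLongCycleLimit d β α a b (ENNReal.ofReal κ) μ r)
    (h' : IsLongCycleLimit d β α a b (ENNReal.ofReal κ) μ r') : r = r' := by
  obtain ⟨Λ, m, hs⟩ := exists_isThermodynamicSequence (d := d) hd hκ
  exact tendsto_nhds_unique (h Λ m hs) (h' Λ m hs)

/-! ### Continuity and jumps of the limiting density -/

lemma not_continuousAt_of_jump {f : ℝ → ℝ} {x c : ℝ} (hc : 0 < c) (hl : ∀ y < x, f y = 0)
    (hr : ∀ y > x, c ≤ f y) : ¬ ContinuousAt f x := by
  intro h
  have h1 : f x ≤ 0 := by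
    refine le_of_tendsto (h.tendsto.mono_left nhdsWithin_le_nhds : Tendsto f (𝓝[<] x) _) ?_
    filter_upwards [self_mem_nhdsWithin] with y hy using (hl y hy).le
  have h2 : c ≤ f x := by
    refine ge_of_tendsto (h.tendsto.mono_left nhdsWithin_le_nhds : Tendsto f (𝓝[>] x) _) ?_
    filter_upwards [self_mem_nhdsWithin] with y hy using hr y hy
  linarith

/-- A function that is constant to the left of `x` and agrees with `yTwo` to the right of `x` is
continuous at `x` if the two values agree there. -/
lemma continuousAt_of_eq_yTwo (hβ : 0 < β) (hb : 0 < b) (hab : b < a) {f : ℝ → ℝ} {x : ℝ}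
    (hx : muT d β a b ≤ x) (hl : ∀ᶠ ν in 𝓝[≤] x, f ν = yTwo d β a b x)
    (hr : ∀ ν > x, f ν = yTwo d β a b ν) : ContinuousAt f x := by
  have hfx : f x = yTwo d β a b x := hl.self_of_nhdsWithin Set.self_mem_Iic
  rw [continuousAt_iff_continuous_left_right]
  constructor
  · rw [ContinuousWithinAt, hfx]
    refine tendsto_const_nhds.congr' ?_
    filter_upwards [hl] with ν hν using hν.symm
  · rw [ContinuousWithinAt, hfx]
    refine (tendsto_yTwo_nhdsGE hβ hb hab hx).congr' ?_
    filter_upwards [self_mem_nhdsWithin] with ν hν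
    rcases (Set.mem_Ici.1 hν).eq_or_lt with rfl | h
    · exact hfx.symm
    · exact (hr ν h).symm

end Concentration

end CycleHYL

/-! ### Assembly of the theorem -/

theorem mainTheorem6 (d : ℕ) (hd : 1 ≤ d) (β a b : ℝ) (hβ : 0 < β) (hb : 0 < b) (hab : b < a) :
    -- the expectations are well defined
    (∀ α < 0, ∀ μ V : ℝ, 0 < V → ∀ m : ℕ,
      IsProbabilityMeasure (gibbsMeasure d β α μ a b V m) ∧
      Integrable (longCycleDensity V m) (gibbsMeasure d β α μ a b V m)) ∧
    ∃ μs : ℝ, IsTransitionZero d β a b μs ∧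
      -- the case κ = 0
      (∀ α < 0,
        (∀ μ < μs, IsLongCycleLimit d β α a b 0 μ 0) ∧
        (∀ μ > μs, IsLongCycleLimit d β α a b 0 μ ((μ - a * xTwo d β a b μ) / (a - b))) ∧
        ((μs : EReal) < muC d β a →
          ∀ ϱ : ℝ → ℝ, (∀ μ ≠ μs, IsLongCycleLimit d β α a b 0 μ (ϱ μ)) →
            ¬ ContinuousAt ϱ μs) ∧
        ((μs : EReal) = muC d β a →
          xOne d β a μs = xTwo d β a b μs ∧
          IsLongCycleLimit d β α a b 0 μs 0 ∧
          ∀ ϱ : ℝ → ℝ, (∀ μ, IsLongCycleLimit d β α a b 0 μ (ϱ μ)) → ContinuousAt ϱ μs)) ∧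
      ((μs : EReal) = muC d β a ↔
        idealPressureSecondAtZero d β ≤ (((a - b) / (a * b) : ℝ) : EReal)) ∧
      -- the case κ ∈ (0, ∞)
      (∀ κ : ℝ, 0 < κ → ∃ μκ : ℝ, IsTransitionPos d β a b κ μs μκ ∧
        ∀ α < 0,
          (∀ μ < μκ, IsLongCycleLimit d β α a b (ENNReal.ofReal κ) μ 0) ∧
          (∀ μ, μκ < μ → μ ≤ muR d β a b κ →
            IsLongCycleLimit d β α a b (ENNReal.ofReal κ) μ κ) ∧
          (∀ μ, μκ < μ → muR d β a b κ ≤ μ →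
            IsLongCycleLimit d β α a b (ENNReal.ofReal κ) μ
              ((μ - a * xTwo d β a b μ) / (a - b))) ∧
          ∀ ϱ : ℝ → ℝ,
            (∀ μ ≠ μκ, IsLongCycleLimit d β α a b (ENNReal.ofReal κ) μ (ϱ μ)) →
            (muR d β a b κ ≠ μκ → ContinuousAt ϱ (muR d β a b κ)) ∧
            ¬ ContinuousAt ϱ μκ) ∧
      -- the case κ = ∞
      (∀ α < 0, ∀ μ : ℝ, IsLongCycleLimit d β α a b ⊤ μ 0) := by
  have ha : 0 < a := hb.trans hab
  have hμt := muT_le_transitionPotential (d := d) hd hβ hb hab le_rfl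
  refine ⟨fun α _ μ V hV m => ⟨?_, ?_⟩, transitionPotential d β a b 0,
    isTransitionZero_transitionPotential hd hβ hb hab, fun α _ => ⟨fun μ hμ => ?_, fun μ hμ => ?_,
      fun hlt ϱ hϱ => ?_, fun heq => ?_⟩,
    transitionPotential_eq_muC_iff_second hd hβ hb hab,
    fun κ hκ => ⟨transitionPotential d β a b κ, isTransitionPos_transitionPotential hd hβ hb hab hκ,
      fun α _ => ⟨fun μ hμ => ?_, fun μ hμ hμr => ?_, fun μ hμ hμr => ?_, fun ϱ hϱ => ?_⟩⟩,
    fun α _ μ => ?_⟩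
  · exact isProbabilityMeasure_gibbsMeasure hβ hV α μ (summable_gibbsWeight hd hβ hb hab hV μ m)
  · exact integrable_gibbsMeasure hβ hV α μ (summable_gibbsWeight hd hβ hb hab hV μ m)
      (summable_gibbs_longCycleDensity hd hβ hb hab hV μ m)
  · exact (isEquilibrium_zero_of_lt hd hβ hb hab hμ).isLongCycleLimit hd hβ hb hab α
  · exact (isEquilibrium_zero_of_gt hd hβ hb hab hμ).isLongCycleLimit hd hβ hb hab α
  · rw [← ENNReal.ofReal_zero] at hϱ
    -- This is the size of the jump: ỹ₂ is nondecreasing, so it stays above its positive value at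
    -- μ^*.
    have hpos : 0 < yTwo d β a b (transitionPotential d β a b 0) := by
      refine lt_of_le_of_ne (yTwo_nonneg hβ hb hab hμt) fun h => hlt.ne ?_
      rw [transitionPotential_eq_muC_iff hd hβ hb hab,
        ← yTwo_transition_eq_zero_iff hd hβ hb hab, ← h]
    refine not_continuousAt_of_jump hpos (fun ν hν => ?_) fun ν hν => ?_
    · refine (hϱ ν hν.ne).unique hd le_rfl ?_
      rw [ENNReal.ofReal_zero]
      exact (isEquilibrium_zero_of_lt hd hβ hb hab hν).isLongCycleLimit hd hβ hb hab α
    · refine (yTwo_mono hβ hb hab hμt (le_of_lt hν)).trans (le_of_eq ?_)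
      refine IsLongCycleLimit.unique hd le_rfl ?_ (hϱ ν (ne_of_gt hν))
      rw [ENNReal.ofReal_zero]
      exact (isEquilibrium_zero_of_gt hd hβ hb hab hν).isLongCycleLimit hd hβ hb hab α
  · have hy0 : yTwo d β a b (transitionPotential d β a b 0) = 0 := by
      rwa [yTwo_transition_eq_zero_iff hd hβ hb hab, ← transitionPotential_eq_muC_iff hd hβ hb hab]
    have hlim := (isEquilibrium_zero_transition hd hβ hb hab hy0).isLongCycleLimit hd hβ hb hab α
    refine ⟨?_, hlim, fun ϱ hϱ => ?_⟩
    · have := sub_mul_yTwo hβ hb hab hμt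
      rw [hy0, mul_zero, sub_zero] at this
      rw [xOne_eq hβ ha, xTwo_eq hβ hb hab hμt, ← this]
    · rw [← ENNReal.ofReal_zero] at hϱ
      refine continuousAt_of_eq_yTwo hβ hb hab hμt ?_ fun ν hν => ?_
      · filter_upwards [self_mem_nhdsWithin] with ν hν
        rw [hy0]
        refine (hϱ ν).unique hd le_rfl ?_
        rw [ENNReal.ofReal_zero]
        rcases (Set.mem_Iic.1 hν).lt_or_eq with h | rfl
        · exact (isEquilibrium_zero_of_lt hd hβ hb hab h).isLongCycleLimit hd hβ hb hab α
        · exact hlim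
      · refine (hϱ ν).unique hd le_rfl ?_
        rw [ENNReal.ofReal_zero]
        exact (isEquilibrium_zero_of_gt hd hβ hb hab hν).isLongCycleLimit hd hβ hb hab α
  · exact (isEquilibrium_pos_of_lt hd hβ hb hab hκ hμ).isLongCycleLimit hd hβ hb hab α
  · exact (isEquilibrium_pos_kappa hd hβ hb hab hκ hμ hμr).isLongCycleLimit hd hβ hb hab α
  · exact (isEquilibrium_pos_of_gt hd hβ hb hab hκ hμ hμr).isLongCycleLimit hd hβ hb hab α
  · have hzero : ∀ ν < transitionPotential d β a b κ, ϱ ν = 0 := fun ν hν =>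
      (hϱ ν hν.ne).unique hd hκ.le
        ((isEquilibrium_pos_of_lt hd hβ hb hab hκ hν).isLongCycleLimit hd hβ hb hab α)
    have hkappa : ∀ ν, transitionPotential d β a b κ < ν → ν ≤ muR d β a b κ → ϱ ν = κ :=
      fun ν hν hνr => (hϱ ν hν.ne').unique hd hκ.le
        ((isEquilibrium_pos_kappa hd hβ hb hab hκ hν hνr).isLongCycleLimit hd hβ hb hab α)
    have htwo : ∀ ν, transitionPotential d β a b κ < ν → muR d β a b κ ≤ ν →
        ϱ ν = yTwo d β a b ν := fun ν hν hνr => (hϱ ν hν.ne').unique hd hκ.le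
        ((isEquilibrium_pos_of_gt hd hβ hb hab hκ hν hνr).isLongCycleLimit hd hβ hb hab α)
    refine ⟨fun hne => ?_, not_continuousAt_of_jump hκ hzero fun ν hν => ?_⟩
    · rcases hne.lt_or_gt with h | h
      -- If μ_r lies below the transition, ϱ vanishes in a whole neighbourhood of it.
      · refine continuousAt_const.congr (f := fun _ => (0 : ℝ)) ?_
        filter_upwards [Iio_mem_nhds h] with ν hν using (hzero ν hν).symm
      -- At μ_r both regimes apply, and uniqueness of the limit gives ỹ₂(μ_r) = κ.
      · have hr := (htwo _ h le_rfl).symm.trans (hkappa _ h le_rfl)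
        refine continuousAt_of_eq_yTwo hβ hb hab (muT_le_muR_and hβ hb hab hκ).1 ?_
          fun ν hν => htwo ν (h.trans hν) (le_of_lt hν)
        filter_upwards [Ioc_mem_nhdsLE h] with ν hν
        rw [hr, hkappa ν hν.1 hν.2]
    · rcases le_total ν (muR d β a b κ) with h | h
      · exact (hkappa ν hν h).ge
      · exact (le_yTwo_of_muR_le hβ hb hab hκ h).trans (htwo ν hν h).ge
  · exact (isEquilibrium_top d β a b μ).isLongCycleLimit hd hβ hb hab α
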